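/- Conventions. $\mathbb N=\{0,1,2,\dots\}$ and $g_\nu(s)=\sum_{n\ge0}\nu(n)s^n$ is the generating function of a law $\nu$ on $\mathbb N$. Let $\xi,\mu$ be probability laws on $\mathbb N$ with $\xi(1)<1$. A GW$(\xi)$-real tree is the rooted real tree with unit edge lengths of the family tree in which all individuals have independent $\xi$-distributed numbers of children, where the progenitor is joined to the root $\rho$ by one further unit edge; $Q_\xi$ is the law of its isometry class. A GW$(\xi;\mu)$-real forest is the concatenation at a common root $\rho$ of a $\mu$-distributed number of independent GW$(\xi)$-real trees. Random forests are subsets of a metric space $X$ with base point $\rho$; a forest, or a forest with pruning times attached to some of its points, is said to have a given law if its (root- and mark-preserving) isometry class has that law. For a rooted real tree $(T,d,\rho)$ put $\Gamma(T)=\sup_{v\in T}d(\rho,v)$, $T_v=\{w\in T:v\in[[\rho,w]]\}$ (rooted at $v$), and let $\mathrm n(v,T)$ be the number of connected components of $T\setminus\{v\}$. The $h$-erasure is $R^h(T)=\{\rho\}$ if $\Gamma(T)\le h$, and $R^h(T)=\{v\in T:\Gamma(T_v)\ge h\}$ otherwise. Let $\mathrm{Br}^+(T)$ be the set of points $v\in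 T\setminus\{\rho\}$ with $d(\rho,v)\in\mathbb N$ and $\mathrm n(v,T)\neq1$. For a family $H=(H_m,m\ge1)$ of probability laws on $(0,\infty]$, an $H$-pruning process of a GW$(\xi;\mu)$-real forest $\mathcal F$ is a process $(\mathcal F(\theta),\theta\ge0)$ for which there are pruning times $\Theta_v$, $v\in\mathrm{Br}^+(\mathcal F)$, that, given the isometry class of $\mathcal F$, are independent with $\Theta_v\sim H_{\mathrm n(v,\mathcal F)-1}$, such that almost surely, for all $\theta\ge0$, $\mathcal F(\theta)$ is the closure of the connected component containing $\rho$ of $\mathcal F\setminus\{v\in\mathrm{Br}^+(\mathcal F):\Theta_v\le\theta\}$, and such that $(\mathcal F(\theta),\theta\ge 0)$ is almost surely a decreasing, right-continuous (for the localised Hausdorff distance) family of complete, separable, locally compact rooted real trees with $\mathcal F(0)=\mathcal F$. It is a pruning process with pruning at branch points (at exponential rates) if $H_m=\mathrm{Exp}(m-1)$ for $m\ge2$ and $H_1=\delta_\infty$. Proposition. Let $(\mathcal F^B(\theta),\theta\ge0)$ be a pruning process of a GW$(\xi;\mu)$-real forest $\mathcal F^B(0)=\mathcal F$ with pruning at branch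 points, let $h\in\mathbb N$, and assume that $p=Q_\xi(\Gamma\le h)<1$ (that is, $h=0$ or $\xi(0)<1$). Then $R^h(\mathcal F)$ is a GW$(\xi^h;\mu^h)$-real forest, where $\xi^h$ and $\mu^h$ are the probability laws on $\mathbb N$ with $$g_{\xi^h}(s)=\frac{g_\xi(p+s(1-p))-p}{1-p},\qquad g_{\mu^h}(s)=g_\mu(p+s(1-p)),\qquad 0\le s\le1,$$ and $(\mathcal F^B(\theta)\cap R^h(\mathcal F),\theta\ge0)$ is an $H$-pruning process of $R^h(\mathcal F)$, where $H_m$, $m\ge1$, are probability laws on $(0,\infty]$ such that for all $\theta\ge0$ $$H_1((\theta,\infty])=\frac{g_\xi'(pe^{-\theta})}{g_\xi'(p)},\qquad H_m((\theta,\infty])=\frac{e^{-(m-1)\theta}g_\xi^{(m)}(pe^{-\theta})}{g_\xi^{(m)}(p)},\quad m\ge2;$$ such laws exist, and when $g_\xi^{(m)}(p)=0$ (in which case $\xi^h(m)=0$) $H_m$ may be any law on $(0,\infty]$. In particular, for every $\theta\ge0$, $\mathcal F^B(\theta)\cap R^h(\mathcal F)$ is a GW$(\xi^h_\theta;\mu^h)$-real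 forest, where $\xi^h_\theta$ is the probability law on $\mathbb N$ with $$g_{\xi^h_\theta}(s)=\frac{g_\xi(pe^{-\theta}+s(1-p)e^{-\theta})-pe^{-\theta}-g_\xi(e^{-\theta})+e^{-\theta}}{(1-p)e^{-\theta}},\qquad 0\le s\le1.$$ -/

import Mathlib

open MeasureTheory ProbabilityTheory Filter Topology Set
open scoped ENNReal NNReal

namespace GWPruning

noncomputable section

/-! ### Rooted real trees inside a pointed metric space `(X, ρ)` -/

section RealTrees

variable {X : Type*} [MetricSpace X]

/-- `T ⊆ X` is a complete, separable, locally compact real tree containing the root `ρ`: any two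
points `v, w ∈ T` are joined by a path in `T` of length `d(v, w)`, and the (range of an) injective
path in `T` from `v` to `w` is unique. -/
structure IsRootedRealTree (ρ : X) (T : Set X) : Prop where
  root_mem : ρ ∈ T
  geodesic : ∀ v ∈ T, ∀ w ∈ T, ∃ f : ℝ → X,
    (∀ s ∈ Icc 0 (dist v w), f s ∈ T) ∧ f 0 = v ∧ f (dist v w) = w ∧
    ∀ s ∈ Icc 0 (dist v w), ∀ t ∈ Icc 0 (dist v w), dist (f s) (f t) = |s - t|
  unique_path : ∀ γ γ' : unitInterval → X,
    Continuous γ → Function.Injective γ → (∀ s, γ s ∈ T) →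
    Continuous γ' → Function.Injective γ' → (∀ s, γ' s ∈ T) →
    γ 0 = γ' 0 → γ 1 = γ' 1 → range γ = range γ'
  complete : IsComplete T
  separable : TopologicalSpace.IsSeparable T
  locallyCompact : LocallyCompactSpace T

/-- The segment `[[v, w]]` of the real tree `T`. -/
def segment (T : Set X) (v w : X) : Set X := {x ∈ T | dist v x + dist x w = dist v w}

/-- The subtree `T_v = {w ∈ T : v ∈ [[ρ, w]]}` above `v`. -/
def subtreeAbove (ρ : X) (T : Set X) (v : X) : Set X := {w ∈ T | v ∈ segment T ρ w}

/-- The height `Γ(T) = sup {d(ρ, v) : v ∈ T} ∈ [0, ∞]` of a tree with root `ρ`. -/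
def height (ρ : X) (T : Set X) : ℝ≥0∞ := ⨆ v ∈ T, edist ρ v

open scoped Classical in
/-- The `h`-erasure: `R^h(T) = {ρ}` if `Γ(T) ≤ h`, and `R^h(T) = {v ∈ T : Γ(T_v) ≥ h}` otherwise,
where `T_v` is rooted at `v`. -/
def erase (ρ : X) (h : ℝ≥0∞) (T : Set X) : Set X :=
  if height ρ T ≤ h then {ρ} else {v ∈ T | h ≤ height v (subtreeAbove ρ T v)}

/-- The degree `n(v, T)`: the number of connected components of `T \ {v}`. -/
def degree (v : X) (T : Set X) : ℕ∞ := ENat.card (ConnectedComponents ↥(T \ {v}))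

/-- `Br⁺(T)`: the non-root points of `T` at integer distance from the root that are not leaves
(a leaf is a non-root point of degree `1`). -/
def brPlus (ρ : X) (T : Set X) : Set X :=
  {v ∈ T | v ≠ ρ ∧ degree v T ≠ 1 ∧ ∃ n : ℕ, dist ρ v = n}

/-- The tree at time `θ` of the pruning process of `T` associated with the point measure
`∑_{v ∈ Br⁺(T)} δ_{(Θ v, v)}`: the completion (closure) of the connected component containing `ρ`
of `T` minus the set of points `v ∈ Br⁺(T)` with `Θ v ≤ θ`. -/
def prune (ρ : X) (T : Set X) (Θ : X → ℝ≥0∞) (θ : ℝ≥0) : Set X :=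
  closure (connectedComponentIn (T \ {v ∈ brPlus ρ T | Θ v ≤ θ}) ρ)

/-- The localised Hausdorff distance `∫₀^∞ d_Haus(S ∩ B(ρ, r), T ∩ B(ρ, r)) e^{-r} dr`. -/
def localHausdorff (ρ : X) (S T : Set X) : ℝ≥0∞ :=
  ∫⁻ r in Ioi (0 : ℝ),
    Metric.hausdorffEDist (S ∩ Metric.closedBall ρ r) (T ∩ Metric.closedBall ρ r) *
      ENNReal.ofReal (Real.exp (-r))

/-- A (deterministic) pruning process of `T`: a right-continuous, decreasing path of rooted real
trees in `X` that starts from `T`. -/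
structure IsPruningProcess (ρ : X) (T : Set X) (𝒯 : ℝ≥0 → Set X) : Prop where
  tree : ∀ θ, IsRootedRealTree ρ (𝒯 θ)
  start : 𝒯 0 = T
  decreasing : Antitone 𝒯
  rightContinuous : ∀ θ, Tendsto (fun θ' => localHausdorff ρ (𝒯 θ') (𝒯 θ)) (𝓝[≥] θ) (𝓝 0)

end RealTrees

/-! ### Combinatorial forests and their real trees -/

/-- A forest is coded by giving, for each finite word `u` of natural numbers, the number `k u` of
children of the individual with label `u`; the children of `u` are `u ++ [0], …, u ++ [k u - 1]`.
The empty word is the root `ρ`; its children are the progenitors of the trees of the forest.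
Individuals of the forest are the words for which `InForest` holds. -/
abbrev Forest := List ℕ → ℕ

/-- A forest in which the individual `u` has `(k u).1` children and pruning time `(k u).2`. -/
abbrev MarkedForest := List ℕ → ℕ × ℝ≥0∞

/-- The word `u` labels an individual of the forest `k`. -/
def InForest (k : Forest) (u : List ℕ) : Prop := ∀ v i, v ++ [i] <+: u → i < k v

/-- The space `ℓ₁` over the countable set of words. -/
abbrev EllOne := lp (fun _ : List ℕ => ℝ) 1

/-- The position in `ℓ₁` of the individual `u`: the sum of the unit vectors of all nonempty
prefixes of `u`. The root is at `0`. -/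
def vertex (u : List ℕ) : EllOne :=
  ∑ i ∈ Finset.range u.length, lp.single 1 (u.take (i + 1)) (1 : ℝ)

/-- The real forest (with unit edge lengths and root `0`) of the combinatorial forest `k`: each
individual `u ≠ ρ` of `k` contributes the unit segment from its parent to `u`. -/
def realForest (k : Forest) : Set EllOne :=
  {0} ∪ {x | ∃ u, u ≠ [] ∧ InForest k u ∧ ∃ s ∈ Icc (0 : ℝ) 1,
    x = vertex u.dropLast + s • lp.single 1 u (1 : ℝ)}

/-! ### Galton-Watson laws -/

open scoped Classical in
/-- Forget the child numbers of words that are not individuals of the forest. -/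
def trim (k : Forest) : Forest := fun u => if InForest k u then k u else 0

open scoped Classical in
/-- Forget the child numbers of words that are not individuals of the forest, and the pruning
times of all words other than individuals `u ≠ ρ` that have children. -/
def trimMarked (k : MarkedForest) : MarkedForest := fun u =>
  if InForest (fun v => (k v).1) u then
    ((k u).1, if u ≠ [] ∧ (k u).1 ≠ 0 then (k u).2 else ⊤)
  else (0, ⊤)

/-- The law of the combinatorial Galton-Watson forest: the number of trees has law `μ`, and each
individual has an independent `ξ`-distributed number of children. -/
def gwLaw (ξ μ : PMF ℕ) : Measure Forest :=
  (Measure.infinitePi fun u : List ℕ => (if u = [] then μ else ξ).toMeasure).map trim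

/-- The law of a pair `(K, M)` where `K ∼ ν` and, given `K = m`, `M ∼ H m`. -/
def markedVertexLaw (ν : PMF ℕ) (H : ℕ → ProbabilityMeasure ℝ≥0∞) :
    ProbabilityMeasure (ℕ × ℝ≥0∞) :=
  haveI : IsMarkovKernel (Kernel.ofFunOfCountable fun m : ℕ => (H m : Measure ℝ≥0∞)) :=
    ⟨fun m => inferInstanceAs (IsProbabilityMeasure (H m : Measure ℝ≥0∞))⟩
  ⟨ν.toMeasure ⊗ₘ Kernel.ofFunOfCountable fun m : ℕ => (H m : Measure ℝ≥0∞), inferInstance⟩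

/-- The law of the combinatorial Galton-Watson forest together with pruning times that, given the
forest, are independent, with law `H m` for individuals with `m ≥ 1` children. -/
def gwMarkedLaw (ξ μ : PMF ℕ) (H : ℕ → ProbabilityMeasure ℝ≥0∞) : Measure MarkedForest :=
  (Measure.infinitePi fun u : List ℕ =>
    (markedVertexLaw (if u = [] then μ else ξ) H : Measure (ℕ × ℝ≥0∞))).map trimMarked

theorem measurableSet_inForest (u : List ℕ) : MeasurableSet {k : Forest | InForest k u} := by
  have : {k : Forest | InForest k u} =
      ⋂ v : List ℕ, ⋂ i : ℕ, {k : Forest | v ++ [i] <+: u → i < k v} := by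
    ext k; simp [InForest]
  rw [this]
  refine MeasurableSet.iInter fun v => MeasurableSet.iInter fun i => ?_
  by_cases hv : v ++ [i] <+: u
  · simp only [hv, true_implies]
    exact measurableSet_lt measurable_const (measurable_pi_apply v)
  · simp [hv]

theorem measurable_trim : Measurable trim := by
  classical
  refine measurable_pi_lambda _ fun u => ?_
  exact Measurable.ite (measurableSet_inForest u) (measurable_pi_apply u) measurable_const

theorem measurable_trimMarked : Measurable trimMarked := by
  classical
  refine measurable_pi_lambda _ fun u => ?_
  have h1 : Measurable fun k : MarkedForest => (fun v => (k v).1 : Forest) :=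
    measurable_pi_lambda _ fun v => measurable_fst.comp (measurable_pi_apply v)
  have hu1 : Measurable fun k : MarkedForest => (k u).1 :=
    measurable_fst.comp (measurable_pi_apply u)
  have hu2 : Measurable fun k : MarkedForest => (k u).2 :=
    measurable_snd.comp (measurable_pi_apply u)
  refine Measurable.ite (h1 (measurableSet_inForest u)) (hu1.prodMk ?_) measurable_const
  refine Measurable.ite ?_ hu2 measurable_const
  exact (MeasurableSet.const _).inter (hu1 (measurableSet_singleton 0)).compl

instance (ξ μ : PMF ℕ) : IsProbabilityMeasure (gwLaw ξ μ) :=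
  Measure.isProbabilityMeasure_map measurable_trim.aemeasurable

instance (ξ μ : PMF ℕ) (H : ℕ → ProbabilityMeasure ℝ≥0∞) :
    IsProbabilityMeasure (gwMarkedLaw ξ μ H) :=
  Measure.isProbabilityMeasure_map measurable_trimMarked.aemeasurable

/-! ### Random real forests and pruning processes -/

section Random

variable {X Ω : Type*} [MetricSpace X] [MeasurableSpace Ω]

/-- The rooted tree `F ⊆ X` is root-preservingly isometric to the real forest of `k`. -/
def IsCodedBy (ρ : X) (F : Set X) (k : Forest) : Prop :=
  ∃ φ : realForest k → X, Isometry φ ∧ range φ = F ∧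
    ∀ x : realForest k, (x : EllOne) = 0 → φ x = ρ

/-- The rooted tree `F ⊆ X` with pruning times `Θ` on `Br⁺(F)` is root-preservingly isometric to the
real forest of the marked forest `k`, by an isometry that also preserves the pruning times. The
points of `Br⁺(F)` correspond to the individuals `u ≠ ρ` with at least one child, and the number
of children of `u` is the degree of the corresponding point minus `1`. -/
def IsMarkedCodedBy (ρ : X) (F : Set X) (Θ : X → ℝ≥0∞) (k : MarkedForest) : Prop :=
  ∃ φ : realForest (fun u => (k u).1) → X, Isometry φ ∧ range φ = F ∧
    (∀ x : realForest fun u => (k u).1, (x : EllOne) = 0 → φ x = ρ) ∧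
    ∀ (x : realForest fun u => (k u).1) (u : List ℕ), InForest (fun v => (k v).1) u → u ≠ [] →
      (k u).1 ≠ 0 → (x : EllOne) = vertex u → Θ (φ x) = (k u).2

/-- `F` is a random `GW(ξ; μ)`-real forest in `X`: its isometry class has the law of the isometry
class of the real forest of a combinatorial Galton-Watson forest. Equality in law of the isometry
classes is expressed by a coupling under which the two trees are almost surely isometric. -/
def IsGWForest (P : Measure Ω) (ρ : X) (ξ μ : PMF ℕ) (F : Ω → Set X) : Prop :=
  ξ 1 < 1 ∧ ∃ Q : Measure (Ω × Forest),
    Q.map Prod.fst = P ∧ Q.map Prod.snd = gwLaw ξ μ ∧ ∀ᵐ z ∂Q, IsCodedBy ρ (F z.1) z.2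

/-- `F` is a random `GW(ξ; μ)`-real forest in `X` whose points `v ∈ Br⁺(F)` carry, given the isometry
class of `F`, independent pruning times `Θ v` with law `H m`, `m = n(v, F) - 1`. As in `IsGWForest`,
the law is that of the isometry class (of the tree with its pruning times). -/
def IsMarkedGWForest (P : Measure Ω) (ρ : X) (ξ μ : PMF ℕ) (H : ℕ → ProbabilityMeasure ℝ≥0∞)
    (F : Ω → Set X) (Θ : Ω → X → ℝ≥0∞) : Prop :=
  ξ 1 < 1 ∧ ∃ Q : Measure (Ω × MarkedForest),
    Q.map Prod.fst = P ∧ Q.map Prod.snd = gwMarkedLaw ξ μ H ∧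
    ∀ᵐ z ∂Q, IsMarkedCodedBy ρ (F z.1) (Θ z.1) z.2

/-- `(𝒯 θ, θ ≥ 0)` is an `H`-pruning process of the `GW(ξ; μ)`-real forest `F`, where
`H m`, `m ≥ 1`, are laws on `(0, ∞]` (the value `H 0` is irrelevant). -/
def IsHPruningProcess (P : Measure Ω) (ρ : X) (ξ μ : PMF ℕ) (H : ℕ → ProbabilityMeasure ℝ≥0∞)
    (F : Ω → Set X) (𝒯 : ℝ≥0 → Ω → Set X) : Prop :=
  (∀ m, 1 ≤ m → (H m : Measure ℝ≥0∞) {0} = 0) ∧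
  (∀ᵐ ω ∂P, IsPruningProcess ρ (F ω) fun θ => 𝒯 θ ω) ∧
  ∃ Θ : Ω → X → ℝ≥0∞, IsMarkedGWForest P ρ ξ μ H F Θ ∧
    ∀ᵐ ω ∂P, ∀ θ, 𝒯 θ ω = prune ρ (F ω) (Θ ω) θ

end Random

/-- The pruning time laws for pruning at branch points: `Exp(m - 1)` for `m ≥ 2`, and the point mass
at `∞` for `m = 1` (and, irrelevantly, for `m = 0`). -/
def branchPointLaws (m : ℕ) : ProbabilityMeasure ℝ≥0∞ :=
  if hm : 2 ≤ m then
    haveI : IsProbabilityMeasure (expMeasure ((m : ℝ) - 1)) :=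
      isProbabilityMeasure_expMeasure (by
        have : (2 : ℝ) ≤ m := by exact_mod_cast hm
        linarith)
    ⟨(expMeasure ((m : ℝ) - 1)).map ENNReal.ofReal,
      Measure.isProbabilityMeasure_map ENNReal.measurable_ofReal.aemeasurable⟩
  else ⟨Measure.dirac ⊤, inferInstance⟩

/-- The generating function `g_ξ(s) = ∑ ξ(n) sⁿ`. -/
def gen (ξ : PMF ℕ) (s : ℝ) : ℝ := ∑' n, (ξ n).toReal * s ^ n

/-- `Q_ξ(Γ ≤ h)`: the probability that the real tree of a single Galton-Watson tree (with an edge of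
unit length below the progenitor) has height at most `h`. -/
def heightProb (ξ : PMF ℕ) (h : ℝ≥0∞) : ℝ :=
  (gwLaw ξ (PMF.pure 1)).real {k | height 0 (realForest k) ≤ h}

/-- `H m`, `m ≥ 1`, are laws on `(0, ∞]` with tails
`H_1((θ, ∞]) = g'_ξ(p e^{-θ}) / g'_ξ(p)` and
`H_m((θ, ∞]) = e^{-(m-1)θ} g_ξ^{(m)}(p e^{-θ}) / g_ξ^{(m)}(p)`, `m ≥ 2`, for all `θ ≥ 0`.
If `g_ξ^{(m)}(p) = 0`, then the quotient is undefined and `H m` may be any law on `(0, ∞]`. -/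
def HasErasedTails (ξ : PMF ℕ) (p : ℝ) (H : ℕ → ProbabilityMeasure ℝ≥0∞) : Prop :=
  (∀ m, 1 ≤ m → (H m : Measure ℝ≥0∞) {0} = 0) ∧
  (deriv (gen ξ) p ≠ 0 → ∀ θ : ℝ≥0, (H 1 : Measure ℝ≥0∞) (Ioi (θ : ℝ≥0∞)) =
    ENNReal.ofReal (deriv (gen ξ) (p * Real.exp (-θ)) / deriv (gen ξ) p)) ∧
  ∀ m, 2 ≤ m → iteratedDeriv m (gen ξ) p ≠ 0 → ∀ θ : ℝ≥0,
    (H m : Measure ℝ≥0∞) (Ioi (θ : ℝ≥0∞)) =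
      ENNReal.ofReal (Real.exp (-((m : ℝ) - 1) * θ) *
        iteratedDeriv m (gen ξ) (p * Real.exp (-θ)) / iteratedDeriv m (gen ξ) p)

end

end GWPruning

namespace GWPruning

/-! ### Trees of words in `ℓ₁` -/

/-! The proof splits into a deterministic statement about trees and a computation of one law.

Geometry. Every forest considered is almost surely an isometric image of a word tree in `ℓ₁`, in
which the point at the top of a word has coordinate `1` at each of its nonempty prefixes.
Betweenness in `ℓ₁` can be checked coordinate by coordinate, so segments, connected components,
degrees and heights translate into statements about prefixes. Pruning at time `θ` keeps the words
that are not strictly above a nonempty word with mark at most `θ` (`prune_range_eq`), and erasure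
keeps the root and the words with a descendant `h` generations later (`erase_range_eq`). Both select
prefix-closed sets of words, and the first selection restricts well to the second set. Hence pruning
and then intersecting with the erased forest is the same as pruning the erased forest with the same
times (`prune_inter_erase`). What remains is the joint law of the erased forest and its times.

Law. The branches at the root are independent of each other and of the data of the root, and each
reaches generation `h` of its own tree with probability `1 - p`. An individual with `K` children
therefore retains `m` of them with weight `K.choose m * p ^ (K - m) * (1 - p) ^ m` and keeps its
pruning time, and the retained branches are independent copies conditioned on survival
(`infinitePi_survivors`). Comparing cylinder events generation by generation shows that the erased
marked forest is again a marked Galton-Watson forest (`infinitePi_map_trimMarked_eraseForest`). The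
time of an individual with `m` retained children is a mixture over `K` of the laws `Exp(K - 1)`, and
since `K - 1 = (m - 1) + (K - m)`, the mixture has the tail `∑ K, ξ K * K.choose m * p ^ (K - m) *
exp (-(K - 1) θ) = exp (-(m - 1) θ) * g⁽ᵐ⁾(p exp (-θ)) / m!`. Dividing by the value at `θ = 0` gives
`H m` (`erasedTimes_Ioi`, `HasErasedTails.smul_eq`). In particular an individual with a single
retained child may have a finite time, because it may have had several children.

One-dimensional marginals. At time `θ` an individual whose time has passed loses all its children,
so the offspring law gives `m ≥ 1` the mass `ξh m * H m (θ, ∞]`. Summing the binomial series gives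
the generating function up to its constant term, which is fixed by the value `1` at `s = 1`
(`gen_prunedOffspringLaw`).

Equality in law of isometry classes is expressed by couplings, and the property of being coded by a
forest need not be measurable. Such properties are carried along maps of the coupling by
disintegration (`ae_map_prodMap_of_imp`). -/

/-- The point at distance `s` from `vertex v` on the edge from `vertex v` to `vertex (v ++ [i])`. -/
noncomputable def edgePoint (v : List ℕ) (i : ℕ) (s : ℝ) : EllOne :=
  vertex v + s • lp.single 1 (v ++ [i]) (1 : ℝ)

/-- The real tree in `ℓ₁` whose edges are those below the nonempty words in `W`. -/
def wordTree (W : Set (List ℕ)) : Set EllOne :=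
  {0} ∪ {x | ∃ v i, v ++ [i] ∈ W ∧ ∃ s ∈ Icc (0 : ℝ) 1, x = edgePoint v i s}

def PrefixClosed (W : Set (List ℕ)) : Prop := ∀ ⦃u v : List ℕ⦄, u <+: v → v ∈ W → u ∈ W

/-- The individuals of a combinatorial forest. -/
def individuals (k : Forest) : Set (List ℕ) := {u | InForest k u}

theorem realForest_eq_wordTree (k : Forest) : realForest k = wordTree (individuals k) := by
  ext x
  simp only [realForest, wordTree, individuals, mem_union, mem_ofPred_eq]
  refine or_congr Iff.rfl ⟨?_, ?_⟩
  · rintro ⟨u, hu, hk, s, hs, rfl⟩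
    obtain rfl | ⟨v, i, rfl⟩ := List.eq_nil_or_concat' u
    · exact absurd rfl hu
    · exact ⟨v, i, hk, s, hs, by simp [edgePoint]⟩
  · rintro ⟨v, i, hk, s, hs, rfl⟩
    exact ⟨v ++ [i], by simp, hk, s, hs, by simp [edgePoint]⟩

theorem prefix_concat_iff {u v : List ℕ} {i : ℕ} : u <+: v ++ [i] ↔ u = v ++ [i] ∨ u <+: v := by
  constructor
  · intro h
    obtain ⟨t, ht⟩ := h
    obtain rfl | ⟨t', j, rfl⟩ := List.eq_nil_or_concat' t
    · left; simpa using ht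
    · right
      rw [← List.append_assoc] at ht
      obtain ⟨h1, -⟩ := List.append_inj' ht rfl
      exact ⟨t', h1⟩
  · rintro (rfl | h)
    · exact List.prefix_rfl
    · exact h.trans (List.prefix_append _ _)

theorem not_concat_prefix (v : List ℕ) (i : ℕ) : ¬ v ++ [i] <+: v := fun h => by
  simpa using h.length_le

theorem vertex_nil : vertex [] = 0 := by simp [vertex]

theorem vertex_concat (v : List ℕ) (i : ℕ) :
    vertex (v ++ [i]) = vertex v + lp.single 1 (v ++ [i]) (1 : ℝ) := by
  unfold vertex
  rw [List.length_append, List.length_singleton, Finset.sum_range_succ]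
  congr 1
  · refine Finset.sum_congr rfl fun j hj => ?_
    have : j + 1 ≤ v.length := by simpa using hj
    rw [List.take_append_of_le_length this]
  · congr 1
    rw [List.take_of_length_le (by simp)]

-- The coordinates of a vertex record its ancestral line. This is what turns geometric questions
-- into questions about prefixes.
open scoped Classical in
theorem vertex_apply (u w : List ℕ) : vertex u w = if w ≠ [] ∧ w <+: u then 1 else 0 := by
  induction u using List.reverseRecOn with
  | nil =>
    rw [vertex_nil]
    simp
  | append_singleton v i ih =>
    rw [vertex_concat, lp.coeFn_add, Pi.add_apply, ih, lp.single_apply, Pi.single_apply]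
    by_cases h : w = v ++ [i]
    · subst h
      simp [not_concat_prefix]
    · simp [prefix_concat_iff, h]

open scoped Classical in
theorem edgePoint_apply (v : List ℕ) (i : ℕ) (s : ℝ) (w : List ℕ) :
    edgePoint v i s w = if w = v ++ [i] then s else if w ≠ [] ∧ w <+: v then 1 else 0 := by
  rw [edgePoint, lp.coeFn_add, Pi.add_apply, vertex_apply, lp.coeFn_smul, Pi.smul_apply,
    lp.single_apply, Pi.single_apply]
  by_cases h : w = v ++ [i]
  · subst h; simp [not_concat_prefix]
  · simp [h]

theorem edgePoint_zero (v : List ℕ) (i : ℕ) : edgePoint v i 0 = vertex v := by simp [edgePoint]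

theorem edgePoint_one (v : List ℕ) (i : ℕ) : edgePoint v i 1 = vertex (v ++ [i]) := by
  simp [edgePoint, vertex_concat]

theorem edgePoint_apply_self (v : List ℕ) (i : ℕ) (s : ℝ) : edgePoint v i s (v ++ [i]) = s := by
  simp [edgePoint_apply]

theorem edgePoint_apply_prefix {v w : List ℕ} (i : ℕ) (s : ℝ) (hw : w ≠ []) (h : w <+: v) :
    edgePoint v i s w = 1 := by
  rw [edgePoint_apply, if_neg, if_pos ⟨hw, h⟩]
  rintro rfl
  exact not_concat_prefix _ _ h

theorem vertex_apply_prefix {u w : List ℕ} (hw : w ≠ []) (h : w <+: u) : vertex u w = 1 := by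
  rw [vertex_apply, if_pos ⟨hw, h⟩]

theorem vertex_apply_of_not_prefix {u w : List ℕ} (h : ¬ w <+: u) : vertex u w = 0 := by
  rw [vertex_apply, if_neg fun h' => h h'.2]

theorem dist_edgePoint (v : List ℕ) (i : ℕ) (s t : ℝ) :
    dist (edgePoint v i s) (edgePoint v i t) = |s - t| := by
  rw [dist_eq_norm, edgePoint, edgePoint, add_sub_add_left_eq_sub, ← sub_smul, norm_smul,
    lp.norm_single (by simp)]
  simp

/-! ### Distances in `ℓ₁` -/

theorem hasSum_dist (x y : EllOne) : HasSum (fun w => |x w - y w|) (dist x y) := by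
  have := lp.hasSum_norm (p := 1) (by simp) (x - y)
  simpa [dist_eq_norm] using this

theorem abs_coord_sub_le_dist (x y : EllOne) (w : List ℕ) : |x w - y w| ≤ dist x y :=
  le_hasSum (hasSum_dist x y) w fun _ _ => abs_nonneg _

theorem continuous_coord (w : List ℕ) : Continuous fun x : EllOne => x w := by
  refine (LipschitzWith.of_dist_le_mul (K := 1) fun x y => ?_).continuous
  simpa [Real.dist_eq] using abs_coord_sub_le_dist x y w

/-- `y` lies on a geodesic between `a` and `b`. -/
def Between {X : Type*} [MetricSpace X] (a y b : X) : Prop := dist a y + dist y b = dist a b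

/-- The `ℓ₁` distance is the sum of the coordinate distances, and each coordinate satisfies the
triangle inequality. The sum of the nonnegative defects vanishes only if each defect does. -/
theorem between_iff_coord {a y b : EllOne} :
    Between a y b ↔ ∀ w, |a w - y w| + |y w - b w| = |a w - b w| := by
  have h1 := (hasSum_dist a y).add (hasSum_dist y b)
  have h2 := hasSum_dist a b
  have h3 := h1.sub h2
  constructor
  · intro h w
    rw [Between] at h
    rw [h, sub_self, hasSum_zero_iff_of_nonneg] at h3
    · have := congrFun h3 w
      simp only [Pi.zero_apply] at this
      linarith
    · intro w
      have := abs_sub_le (a w) (y w) (b w)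
      simp only
      linarith
  · intro h
    have h4 : (fun w => |a w - y w| + |y w - b w|) = fun w => |a w - b w| := funext h
    rw [h4] at h1
    exact h1.unique h2

theorem coord_dist_add_iff {a y b : ℝ} :
    |a - y| + |y - b| = |a - b| ↔ (a ≤ y ∧ y ≤ b) ∨ (b ≤ y ∧ y ≤ a) := by
  constructor
  · intro h
    by_contra! hc
    rcases le_total a y with h1 | h1 <;> rcases le_total y b with h2 | h2 <;>
      rcases le_total a b with h3 | h3 <;>
      simp only [abs_of_nonneg, abs_of_nonpos, sub_nonneg, sub_nonpos, h1, h2, h3] at h <;>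
      first
      | linarith [hc.1 h1]
      | (have := hc.2 h2; linarith)
      | (have := hc.2 (by linarith); linarith)
      | (have := hc.1 (by linarith); linarith)
  · rintro (⟨h1, h2⟩ | ⟨h1, h2⟩)
    · rw [abs_of_nonpos (by linarith), abs_of_nonpos (by linarith), abs_of_nonpos (by linarith)]
      ring
    · rw [abs_of_nonneg (by linarith), abs_of_nonneg (by linarith), abs_of_nonneg (by linarith)]
      ring

theorem between_iff {a y b : EllOne} :
    Between a y b ↔ ∀ w, (a w ≤ y w ∧ y w ≤ b w) ∨ (b w ≤ y w ∧ y w ≤ a w) := by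
  simp only [between_iff_coord, coord_dist_add_iff]

/-! ### Structure of the points of a word tree -/

section Points

variable {W : Set (List ℕ)}

theorem zero_mem_wordTree (W : Set (List ℕ)) : (0 : EllOne) ∈ wordTree W := Or.inl rfl

theorem edgePoint_mem {v : List ℕ} {i : ℕ} {s : ℝ} (h : v ++ [i] ∈ W) (hs : s ∈ Icc (0 : ℝ) 1) :
    edgePoint v i s ∈ wordTree W := Or.inr ⟨v, i, h, s, hs, rfl⟩

theorem vertex_mem {u : List ℕ} (h : u ∈ W) : vertex u ∈ wordTree W := by
  obtain rfl | ⟨v, i, rfl⟩ := List.eq_nil_or_concat' u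
  · rw [vertex_nil]; exact zero_mem_wordTree W
  · rw [← edgePoint_one]; exact edgePoint_mem h ⟨zero_le_one, le_rfl⟩

theorem wordTree_mono {W W' : Set (List ℕ)} (h : W ⊆ W') : wordTree W ⊆ wordTree W' := by
  rintro x (hx | ⟨v, i, hv, s, hs, rfl⟩)
  · exact Or.inl hx
  · exact edgePoint_mem (h hv) hs

theorem prefixClosed_univ : PrefixClosed univ := fun _ _ _ _ => mem_univ _

/-- A nonzero point of a word tree is on a unique edge, at positive distance from its lower end. -/
theorem exists_edgePoint_of_mem (hW : PrefixClosed W) {x : EllOne} (hx : x ∈ wordTree W) :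
    x = 0 ∨ ∃ v i s, v ++ [i] ∈ W ∧ 0 < s ∧ s ≤ 1 ∧ x = edgePoint v i s := by
  obtain hx | ⟨v, i, hv, s, hs, rfl⟩ := hx
  · exact Or.inl hx
  obtain hs0 | hs0 := hs.1.eq_or_lt
  · subst hs0
    rw [edgePoint_zero]
    obtain rfl | ⟨v', j, rfl⟩ := List.eq_nil_or_concat' v
    · exact Or.inl vertex_nil
    · exact Or.inr ⟨v', j, 1, hW (List.prefix_append _ _) hv, one_pos, le_rfl,
        (edgePoint_one _ _).symm⟩
  · exact Or.inr ⟨v, i, s, hv, hs0, hs.2, rfl⟩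

theorem coord_mem_Icc {x : EllOne} (hx : x ∈ wordTree W) (w : List ℕ) : x w ∈ Icc (0 : ℝ) 1 := by
  classical
  obtain hx | ⟨v, i, hv, s, hs, rfl⟩ := hx
  · rw [hx]; simp
  · rw [edgePoint_apply]
    split_ifs
    · exact hs
    · simp
    · simp

theorem coord_nonneg {x : EllOne} (hx : x ∈ wordTree W) (w : List ℕ) : 0 ≤ x w :=
  (coord_mem_Icc hx w).1

theorem coord_le_one {x : EllOne} (hx : x ∈ wordTree W) (w : List ℕ) : x w ≤ 1 :=
  (coord_mem_Icc hx w).2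

theorem edgePoint_ne_zero_iff {v : List ℕ} {i : ℕ} {s : ℝ} (hs : 0 < s) {w : List ℕ} :
    edgePoint v i s w ≠ 0 ↔ w ≠ [] ∧ w <+: v ++ [i] := by
  classical
  rw [edgePoint_apply, prefix_concat_iff]
  by_cases h : w = v ++ [i]
  · subst h; simp [hs.ne']
  · simp [h]

theorem mem_of_coord_ne_zero (hW : PrefixClosed W) {x : EllOne} (hx : x ∈ wordTree W)
    {w : List ℕ} (hw : x w ≠ 0) : w ∈ W := by
  obtain rfl | ⟨v, i, s, hv, hs, -, rfl⟩ := exists_edgePoint_of_mem hW hx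
  · simp at hw
  · exact hW ((edgePoint_ne_zero_iff hs).1 hw).2 hv

/-- The support of a point of the full tree consists of the word of its edge and the nonempty
prefixes of that word, so it decides which subtrees contain the point. -/
theorem mem_wordTree_of_coord {x : EllOne} (hx : x ∈ wordTree univ)
    (h : ∀ w, w ≠ [] → x w ≠ 0 → w ∈ W) : x ∈ wordTree W := by
  obtain rfl | ⟨v, i, s, hv, hs, hs1, rfl⟩ := exists_edgePoint_of_mem prefixClosed_univ hx
  · exact zero_mem_wordTree W
  · exact edgePoint_mem (h _ (by simp) (by rw [edgePoint_apply_self]; exact hs.ne')) ⟨hs.le, hs1⟩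

theorem coord_eq_one_of_prefix (hW : PrefixClosed W) {x : EllOne} (hx : x ∈ wordTree W)
    {w w' : List ℕ} (hw : x w ≠ 0) (h : w' <+: w) (hne : w' ≠ w) (hnil : w' ≠ []) : x w' = 1 := by
  obtain rfl | ⟨v, i, s, hv, hs, -, rfl⟩ := exists_edgePoint_of_mem hW hx
  · simp at hw
  · have h1 := ((edgePoint_ne_zero_iff hs).1 hw).2
    refine edgePoint_apply_prefix i s hnil ?_
    obtain rfl | h2 := prefix_concat_iff.1 h1
    · exact (prefix_concat_iff.1 h).resolve_left hne
    · exact h.trans h2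

/-- The support of a point is a chain for the prefix order, since all its words are prefixes of the
word of one edge. -/
theorem prefix_or_prefix_of_coord (hW : PrefixClosed W) {x : EllOne} (hx : x ∈ wordTree W)
    {w w' : List ℕ} (hw : x w ≠ 0) (hw' : x w' ≠ 0) : w <+: w' ∨ w' <+: w := by
  obtain rfl | ⟨v, i, s, hv, hs, -, rfl⟩ := exists_edgePoint_of_mem hW hx
  · simp at hw
  · exact List.prefix_or_prefix_of_prefix ((edgePoint_ne_zero_iff hs).1 hw).2
      ((edgePoint_ne_zero_iff hs).1 hw').2

theorem coord_concat_unique (hW : PrefixClosed W) {x : EllOne} (hx : x ∈ wordTree W)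
    {u : List ℕ} {i j : ℕ} (hi : x (u ++ [i]) ≠ 0) (hj : x (u ++ [j]) ≠ 0) : i = j := by
  have key : ∀ {i j : ℕ}, u ++ [i] <+: u ++ [j] → i = j := fun h => by
    simpa using h.eq_of_length (by simp)
  rcases prefix_or_prefix_of_coord hW hx hi hj with h | h
  · exact key h
  · exact (key h).symm

/-- A point of a word tree other than `vertex u` is either not above `vertex u`, or above one of
its children. -/
theorem ne_vertex_cases (hW : PrefixClosed W) {x : EllOne} (hx : x ∈ wordTree W) {u : List ℕ}
    (hne : x ≠ vertex u) : (u ≠ [] ∧ x u < 1) ∨ ∃ j, 0 < x (u ++ [j]) := by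
  by_contra! hc
  obtain ⟨h1, h2⟩ := hc
  apply hne
  obtain rfl | ⟨v, i, s, hv, hs, hs1, rfl⟩ := exists_edgePoint_of_mem hW hx
  · by_cases hu : u = []
    · rw [hu, vertex_nil]
    · exact absurd (h1 hu) (by simp)
  · have h3 : u <+: v ++ [i] := by
      by_cases hu : u = []
      · rw [hu]; exact List.nil_prefix
      · exact ((edgePoint_ne_zero_iff (w := u) hs).1 (by linarith [h1 hu])).2
    obtain ⟨t, ht⟩ := h3
    cases t with
    | nil =>
      rw [List.append_nil] at ht
      subst ht
      have := h1 (by simp)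
      rw [edgePoint_apply_self] at this
      rw [le_antisymm hs1 this, edgePoint_one]
    | cons j t =>
      exfalso
      have h4 : edgePoint v i s (u ++ [j]) ≠ 0 :=
        (edgePoint_ne_zero_iff hs).2 ⟨by simp, t, by rw [← ht]; simp⟩
      have h5 := coord_nonneg (W := univ) (edgePoint_mem (mem_univ (v ++ [i])) ⟨hs.le, hs1⟩)
        (u ++ [j])
      exact h4 (le_antisymm (h2 j) h5)

theorem eq_edgePoint_of_coord (hW : PrefixClosed W) {x : EllOne} (hx : x ∈ wordTree W)
    {v : List ℕ} {i : ℕ} (h0 : 0 < x (v ++ [i])) (h1 : x (v ++ [i]) < 1) :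
    x = edgePoint v i (x (v ++ [i])) := by
  obtain rfl | ⟨v', i', s, hv, hs, hs1, rfl⟩ := exists_edgePoint_of_mem hW hx
  · simp at h0
  · have h2 := ((edgePoint_ne_zero_iff hs).1 h0.ne').2
    obtain h3 | h3 := prefix_concat_iff.1 h2
    · obtain ⟨rfl, h4⟩ := List.append_inj' h3 rfl
      obtain rfl : i = i' := by simpa using h4
      rw [edgePoint_apply_self]
    · rw [edgePoint_apply_prefix i' s (by simp) h3] at h1
      exact absurd h1 (lt_irrefl _)

theorem vertex_ne_nil_coord_cases (hW : PrefixClosed W) {x : EllOne} (hx : x ∈ wordTree W)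
    {u : List ℕ} {j : ℕ} (h : 0 < x (u ++ [j])) (hu : u ≠ []) : x u = 1 :=
  coord_eq_one_of_prefix hW hx h.ne' (List.prefix_append _ _) (by simp) hu

/-- The separation property of the real tree of a set of words. -/
theorem mem_of_between_of_isPreconnected (hW : PrefixClosed W) {C : Set EllOne}
    (hC : IsPreconnected C) (hCW : C ⊆ wordTree W) {a b y : EllOne} (ha : a ∈ C) (hb : b ∈ C)
    (hy : y ∈ wordTree W) (hab : Between a y b) : y ∈ C := by
  by_contra hyC
  rw [between_iff] at hab
  -- A cover of `C` by two open sets that are disjoint on `C` must leave `a` and `b` on the same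
  -- side. A missing point `y` will produce such a cover with `a` and `b` on different sides.
  have hsep : ∀ U V : Set EllOne, IsOpen U → IsOpen V → C ⊆ U ∪ V →
      (∀ x ∈ C, x ∈ U → x ∈ V → False) → a ∈ U → b ∈ U := by
    intro U V hU hV hUV hd haU
    by_contra hbU
    obtain ⟨x, hxC, hxU, hxV⟩ := hC U V hU hV hUV ⟨a, ha, haU⟩
      ⟨b, hb, (hUV hb).resolve_left hbU⟩
    exact hd x hxC hxU hxV
  -- A missing vertex splits `C` into the part that is not above it and one part for each child. On
  -- the first part coordinate `u` is below its value `1` at the vertex; on the part of child `j`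
  -- coordinate `u ++ [j]` exceeds its value `0` there. Two points in the same part then contradict
  -- betweenness in that coordinate.
  have hvert : ∀ u : List ℕ, y ≠ vertex u := by
    rintro u rfl
    have hcase : ∀ x ∈ C, (u ≠ [] ∧ x u < 1) ∨ ∃ j, 0 < x (u ++ [j]) := fun x hx =>
      ne_vertex_cases hW (hCW hx) (fun h => hyC (h ▸ hx))
    have hpos : ∀ j, IsOpen {x : EllOne | 0 < x (u ++ [j])} := fun j =>
      isOpen_lt continuous_const (continuous_coord _)
    have hlt : IsOpen {x : EllOne | u ≠ [] ∧ x u < 1} :=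
      isOpen_const.inter (isOpen_lt (continuous_coord _) continuous_const)
    obtain ⟨hu, ha1⟩ | ⟨j, haj⟩ := hcase a ha
    · have h1 := hsep {x | u ≠ [] ∧ x u < 1} (⋃ j, {x | 0 < x (u ++ [j])}) hlt
        (isOpen_iUnion hpos)
        (fun x hx => (hcase x hx).imp id fun ⟨j, hj⟩ => mem_iUnion.2 ⟨j, hj⟩)
        (fun x hx h1 h2 => by
          obtain ⟨j, hj⟩ := mem_iUnion.1 h2
          exact h1.2.ne (vertex_ne_nil_coord_cases hW (hCW hx) hj hu)) ⟨hu, ha1⟩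
      have h2 := hab u
      rw [vertex_apply_prefix hu List.prefix_rfl] at h2
      have h3 : b u < 1 := h1.2
      rcases h2 with h2 | h2 <;> linarith
    · have h1 := hsep {x | 0 < x (u ++ [j])}
        ({x | u ≠ [] ∧ x u < 1} ∪ ⋃ (i : ℕ) (_ : i ≠ j), {x | 0 < x (u ++ [i])})
        (hpos j) (hlt.union (isOpen_iUnion fun i => isOpen_iUnion fun _ => hpos i))
        (fun x hx => by
          obtain h | ⟨i, hi⟩ := hcase x hx
          · exact Or.inr (Or.inl h)
          · by_cases hij : i = j
            · subst hij; exact Or.inl hi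
            · exact Or.inr (Or.inr (mem_iUnion₂.2 ⟨i, hij, hi⟩)))
        (fun x hx h1 h2 => by
          obtain h2 | h2 := h2
          · exact h2.2.ne (vertex_ne_nil_coord_cases hW (hCW hx) h1 h2.1)
          · obtain ⟨i, hij, hi⟩ := mem_iUnion₂.1 h2
            exact hij (coord_concat_unique hW (hCW hx) (ne_of_gt hi) (ne_of_gt h1))) haj
      have h2 := hab (u ++ [j])
      rw [vertex_apply_of_not_prefix (not_concat_prefix u j)] at h2
      have h3 : 0 < b (u ++ [j]) := h1
      rcases h2 with h2 | h2 <;> linarith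
  obtain rfl | ⟨v, i, s, hv, hs, hs1, rfl⟩ := exists_edgePoint_of_mem hW hy
  · exact hvert [] vertex_nil.symm
  have hs1' : s < 1 := lt_of_le_of_ne hs1 fun h => hvert _ (by rw [h, edgePoint_one])
  -- A missing interior point of an edge is the only point of the tree whose coordinate on that edge
  -- equals `s`, so this coordinate separates `C`.
  have hne : ∀ x ∈ C, x (v ++ [i]) < s ∨ s < x (v ++ [i]) := fun x hx => by
    refine lt_or_gt_of_ne fun h => hyC ?_
    have := eq_edgePoint_of_coord hW (hCW hx) (v := v) (i := i) (by rw [h]; exact hs)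
      (by rw [h]; exact hs1')
    rw [h] at this
    rwa [← this]
  have hlt : IsOpen {x : EllOne | x (v ++ [i]) < s} :=
    isOpen_lt (continuous_coord _) continuous_const
  have hgt : IsOpen {x : EllOne | s < x (v ++ [i])} :=
    isOpen_lt continuous_const (continuous_coord _)
  have h2 := hab (v ++ [i])
  rw [edgePoint_apply_self] at h2
  rcases hne a ha with h | h
  · have h3 := hsep _ _ hlt hgt hne (fun x _ h1 h2 => by
      simp only [mem_ofPred_eq] at h1 h2; exact lt_asymm h1 h2) h
    have h4 : b (v ++ [i]) < s := h3
    rcases h2 with h2 | h2 <;> linarith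
  · have h3 := hsep _ _ hgt hlt (fun x hx => (hne x hx).symm) (fun x _ h1 h2 => by
      simp only [mem_ofPred_eq] at h1 h2; exact lt_asymm h1 h2) h
    have h4 : s < b (v ++ [i]) := h3
    rcases h2 with h2 | h2 <;> linarith

end Points

/-! ### Geodesics -/

section Geodesics

variable {X : Type*} [MetricSpace X]

/-- `v` and `w` are joined by a geodesic in `T`. -/
def GeodJoined (T : Set X) (v w : X) : Prop :=
  ∃ f : ℝ → X, (∀ s ∈ Icc 0 (dist v w), f s ∈ T) ∧ f 0 = v ∧ f (dist v w) = w ∧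
    ∀ s ∈ Icc 0 (dist v w), ∀ t ∈ Icc 0 (dist v w), dist (f s) (f t) = |s - t|

theorem GeodJoined.refl {T : Set X} {v : X} (hv : v ∈ T) : GeodJoined T v v := by
  refine ⟨fun _ => v, fun _ _ => hv, rfl, rfl, fun s hs t ht => ?_⟩
  rw [dist_self, Icc_self, mem_singleton_iff] at hs ht
  simp [hs, ht]

theorem GeodJoined.symm {T : Set X} {v w : X} (h : GeodJoined T v w) : GeodJoined T w v := by
  obtain ⟨f, h1, h2, h3, h4⟩ := h
  have key : ∀ s ∈ Icc 0 (dist w v), dist v w - s ∈ Icc 0 (dist v w) := fun s hs => by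
    rw [dist_comm w v] at hs
    exact ⟨by linarith [hs.2], by linarith [hs.1]⟩
  refine ⟨fun s => f (dist v w - s), fun s hs => h1 _ (key s hs), by simpa using h3, ?_,
    fun s hs t ht => ?_⟩
  · simp [dist_comm w v, h2]
  · rw [h4 _ (key s hs) _ (key t ht), abs_sub_comm]
    congr 1; ring

theorem GeodJoined.trans {T : Set X} {a m b : X} (h1 : GeodJoined T a m) (h2 : GeodJoined T m b)
    (hm : Between a m b) : GeodJoined T a b := by
  classical
  obtain ⟨f, f1, f2, f3, f4⟩ := h1
  obtain ⟨g, g1, g2, g3, g4⟩ := h2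
  rw [Between] at hm
  have d1 : 0 ≤ dist a m := dist_nonneg
  have d2 : 0 ≤ dist m b := dist_nonneg
  have hF : ∀ s ∈ Icc 0 (dist a b), ¬ s ≤ dist a m → s - dist a m ∈ Icc 0 (dist m b) :=
    fun s hs h => ⟨by linarith, by linarith [hs.2]⟩
  -- The upper bound goes through `m`. The lower bound comes from the path `a, f s, g t, b`, because
  -- `m` lies on a geodesic from `a` to `b`.
  have cross : ∀ s ∈ Icc 0 (dist a m), ∀ t ∈ Icc 0 (dist m b),
      dist (f s) (g t) = dist a m - s + t := by
    intro s hs t ht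
    have e1 : dist (f s) m = dist a m - s := by
      conv_lhs => rw [← f3]
      rw [f4 s hs _ ⟨d1, le_rfl⟩, abs_of_nonpos (by linarith [hs.2])]; ring
    have e2 : dist m (g t) = t := by
      conv_lhs => rw [← g2]
      rw [g4 0 ⟨le_rfl, d2⟩ t ht, abs_of_nonpos (by linarith [ht.1])]; ring
    have e3 : dist a (f s) = s := by
      conv_lhs => rw [← f2]
      rw [f4 0 ⟨le_rfl, d1⟩ s hs, abs_of_nonpos (by linarith [hs.1])]; ring
    have e4 : dist (g t) b = dist m b - t := by
      conv_lhs => rw [← g3]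
      rw [g4 t ht _ ⟨d2, le_rfl⟩, abs_of_nonpos (by linarith [ht.2])]; ring
    have := dist_triangle (f s) m (g t)
    have := dist_triangle4 a (f s) (g t) b
    linarith
  refine ⟨fun s => if s ≤ dist a m then f s else g (s - dist a m), fun s hs => ?_, ?_, ?_,
    fun s hs t ht => ?_⟩
  · dsimp only
    split_ifs with h
    · exact f1 s ⟨hs.1, h⟩
    · exact g1 _ (hF s hs h)
  · simp [d1, f2]
  · by_cases h : dist a b ≤ dist a m
    · have h0 : dist m b = 0 := by linarith
      have hmb : m = b := dist_eq_zero.1 h0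
      subst hmb
      simp [f3]
    · dsimp only
      rw [if_neg h, show dist a b - dist a m = dist m b by linarith, g3]
  · dsimp only
    split_ifs with h h' h'
    · exact f4 s ⟨hs.1, h⟩ t ⟨ht.1, h'⟩
    · rw [cross s ⟨hs.1, h⟩ _ (hF t ht h'), abs_of_nonpos (by linarith)]; ring
    · rw [dist_comm, cross t ⟨ht.1, h'⟩ _ (hF s hs h), abs_of_nonneg (by linarith)]; ring
    · rw [g4 _ (hF s hs h) _ (hF t ht h')]
      congr 1; ring

theorem GeodJoined.image {Y : Type*} [MetricSpace Y] {T : Set X} {v w : X} (h : GeodJoined T v w)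
    {φ : T → Y} (hφ : Isometry φ) (hv : v ∈ T) (hw : w ∈ T) :
    GeodJoined (range φ) (φ ⟨v, hv⟩) (φ ⟨w, hw⟩) := by
  classical
  obtain ⟨f, h1, h2, h3, h4⟩ := h
  have hd : dist (φ ⟨v, hv⟩) (φ ⟨w, hw⟩) = dist v w := hφ.dist_eq _ _
  have d0 : 0 ≤ dist v w := dist_nonneg
  rw [GeodJoined, hd]
  -- The map `φ` is defined on `T` only, and `f` is known to stay in `T` only on the parameter
  -- interval; the value elsewhere is irrelevant.
  refine ⟨fun s => if hs : s ∈ Icc 0 (dist v w) then φ ⟨f s, h1 s hs⟩ else φ ⟨v, hv⟩,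
    fun s hs => ?_, ?_, ?_, fun s hs t ht => ?_⟩
  · simp only [hs, dite_true, mem_range_self]
  · simp only [left_mem_Icc, d0, dite_true, h2]
  · simp only [right_mem_Icc, d0, dite_true, h3]
  · simp only [hs, ht, dite_true, hφ.dist_eq, Subtype.dist_eq, h4 s hs t ht]

theorem mem_segment_iff {T : Set X} {v w x : X} : x ∈ segment T v w ↔ x ∈ T ∧ Between v x w :=
  Iff.rfl

/-- A geodesic set in which connected sets contain the segments between their points. -/
structure SepTree (T : Set X) : Prop where
  geod : ∀ v ∈ T, ∀ w ∈ T, GeodJoined T v w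
  sep : ∀ C ⊆ T, IsPreconnected C → ∀ v ∈ C, ∀ w ∈ C, segment T v w ⊆ C

theorem left_mem_segment {T : Set X} {v w : X} (hv : v ∈ T) : v ∈ segment T v w := ⟨hv, by simp⟩

theorem right_mem_segment {T : Set X} {v w : X} (hw : w ∈ T) : w ∈ segment T v w := ⟨hw, by simp⟩

theorem between_trans {v z y w : X} (h1 : Between v z y) (h2 : Between v y w) : Between v z w := by
  unfold Between at *
  have := dist_triangle z y w
  have := dist_triangle v z w
  linarith

theorem segment_subset_segment {T : Set X} {v y w : X} (hy : y ∈ segment T v w) :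
    segment T v y ⊆ segment T v w := fun _ hz => ⟨hz.1, between_trans hz.2 hy.2⟩

theorem GeodJoined.isPreconnected_subset {T : Set X} {v w : X} (h : GeodJoined T v w) :
    ∃ C, IsPreconnected C ∧ v ∈ C ∧ w ∈ C ∧ C ⊆ segment T v w := by
  obtain ⟨f, h1, h2, h3, h4⟩ := h
  have d0 : 0 ≤ dist v w := dist_nonneg
  refine ⟨f '' Icc 0 (dist v w), isPreconnected_Icc.image _ ?_, ⟨0, ⟨le_rfl, d0⟩, h2⟩,
    ⟨_, ⟨d0, le_rfl⟩, h3⟩, ?_⟩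
  · refine LipschitzOnWith.continuousOn (K := 1) ?_
    refine LipschitzOnWith.of_dist_le_mul fun s hs t ht => ?_
    simp [h4 s hs t ht, Real.dist_eq]
  · rintro _ ⟨s, hs, rfl⟩
    refine ⟨h1 s hs, ?_⟩
    have e1 := h4 0 ⟨le_rfl, d0⟩ s hs
    have e2 := h4 s hs _ ⟨d0, le_rfl⟩
    rw [h2, abs_of_nonpos (by linarith [hs.1])] at e1
    rw [h3, abs_of_nonpos (by linarith [hs.2])] at e2
    linarith

theorem SepTree.isPreconnected_segment {T : Set X} (hT : SepTree T) {v : X} (hv : v ∈ T)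
    (w : X) : IsPreconnected (segment T v w) := by
  refine isPreconnected_of_forall v fun y hy => ?_
  obtain ⟨C, hC, hvC, hyC, hCs⟩ := (hT.geod v hv y hy.1).isPreconnected_subset
  exact ⟨C, hCs.trans (segment_subset_segment hy), hvC, hyC, hC⟩

/-- The range is connected, so it contains the segment by the separation property. Conversely, `γ`
is an embedding of a compact interval, so the preimage of the connected segment is connected; it
contains both ends and is therefore the whole interval. -/
theorem SepTree.range_eq_segment {T : Set X} (hT : SepTree T) {γ : unitInterval → X}
    (hc : Continuous γ) (hi : Function.Injective γ) (hγ : ∀ s, γ s ∈ T) :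
    range γ = segment T (γ 0) (γ 1) := by
  have hsub : segment T (γ 0) (γ 1) ⊆ range γ :=
    hT.sep _ (range_subset_iff.2 hγ) (isPreconnected_range hc) _ (mem_range_self _) _
      (mem_range_self _)
  refine Subset.antisymm ?_ hsub
  have hemb : IsClosedEmbedding γ := hc.isClosedEmbedding hi
  have hK : IsPreconnected (γ ⁻¹' segment T (γ 0) (γ 1)) := by
    rw [← hemb.isInducing.isPreconnected_image, image_preimage_eq_of_subset hsub]
    exact hT.isPreconnected_segment (hγ 0) _
  rintro _ ⟨s, rfl⟩
  exact hK.Icc_subset (left_mem_segment (hγ 0)) (right_mem_segment (hγ 1)) ⟨s.2.1, s.2.2⟩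

theorem SepTree.unique_path {T : Set X} (hT : SepTree T) (γ γ' : unitInterval → X)
    (hc : Continuous γ) (hi : Function.Injective γ) (hγ : ∀ s, γ s ∈ T)
    (hc' : Continuous γ') (hi' : Function.Injective γ') (hγ' : ∀ s, γ' s ∈ T)
    (h0 : γ 0 = γ' 0) (h1 : γ 1 = γ' 1) : range γ = range γ' := by
  rw [hT.range_eq_segment hc hi hγ, hT.range_eq_segment hc' hi' hγ', h0, h1]

/-- A point is cut off from `ρ` exactly when its segment to `ρ` meets `C`: connected sets contain
segments, and segments are connected. -/
theorem SepTree.connectedComponentIn_diff {T : Set X} (hT : SepTree T) {ρ : X} (hρ : ρ ∈ T)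
    {C : Set X} (hC : ρ ∉ C) :
    connectedComponentIn (T \ C) ρ = {x ∈ T | ∀ c ∈ C, c ∉ segment T ρ x} := by
  have hρ' : ρ ∈ T \ C := ⟨hρ, hC⟩
  ext x
  constructor
  · intro hx
    have hxT := connectedComponentIn_subset _ _ hx
    refine ⟨hxT.1, fun c hc hcs => ?_⟩
    have := hT.sep _ ((connectedComponentIn_subset _ _).trans sdiff_subset)
      isPreconnected_connectedComponentIn _ (mem_connectedComponentIn hρ') _ hx hcs
    exact (connectedComponentIn_subset _ _ this).2 hc
  · rintro ⟨hx, hxC⟩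
    have hsub : segment T ρ x ⊆ T \ C := fun y hy => ⟨hy.1, fun hyC => hxC y hyC hy⟩
    exact (hT.isPreconnected_segment hρ x).subset_connectedComponentIn (left_mem_segment hρ)
      hsub (right_mem_segment hx)

theorem degree_eq_one_iff {v : X} {T : Set X} : degree v T = 1 ↔ IsConnected (T \ {v}) := by
  rw [degree, ENat.card_eq_one_iff_unique, isConnected_iff_connectedSpace]
  constructor
  · rintro ⟨h⟩
    obtain ⟨x, -⟩ := ConnectedComponents.surjective_coe h.default
    refine connectedSpace_iff_connectedComponent.2 ⟨x, eq_univ_of_forall fun y => ?_⟩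
    rw [← ConnectedComponents.coe_eq_coe']
    exact Subsingleton.elim _ _
  · intro h
    obtain ⟨x⟩ := h.toNonempty
    exact ⟨{ default := (x : ConnectedComponents ↥(T \ {v})), uniq := fun _ => Subsingleton.elim _ _ }⟩

/-- The branch points are the non-root points at integer height that have points above them. -/
theorem SepTree.mem_brPlus_iff {T : Set X} (hT : SepTree T) {ρ : X} (hρ : ρ ∈ T) {v : X} :
    v ∈ brPlus ρ T ↔ v ∈ T ∧ v ≠ ρ ∧ (∃ x ∈ T, x ≠ v ∧ v ∈ segment T ρ x) ∧
      ∃ n : ℕ, dist ρ v = n := by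
  rw [brPlus, mem_ofPred_eq]
  refine and_congr_right fun hv => and_congr_right fun hne => and_congr_left fun _ => ?_
  -- Degree `1` means that `T \ {v}` is connected. This holds exactly when no other point has `v` on
  -- its segment from `ρ`, since then all these segments stay connected inside `T \ {v}`.
  rw [Ne, degree_eq_one_iff, not_iff_comm]
  have hρ' : ρ ∈ T \ {v} := ⟨hρ, fun h => hne h.symm⟩
  constructor
  · intro h
    push Not at h
    refine ⟨⟨ρ, hρ'⟩, isPreconnected_of_forall ρ fun x hx => ?_⟩
    refine ⟨segment T ρ x, fun y hy => ⟨hy.1, ?_⟩, left_mem_segment hρ, right_mem_segment hx.1,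
      hT.isPreconnected_segment hρ x⟩
    rintro rfl
    exact h x hx.1 hx.2 hy
  · rintro h ⟨x, hxT, hxv, hvx⟩
    exact (hT.sep _ sdiff_subset h.isPreconnected ρ hρ' x ⟨hxT, hxv⟩ hvx).2 rfl

end Geodesics

/-! ### Word trees are rooted real trees -/

section WordTree

variable {W : Set (List ℕ)}

theorem prefix_or_prefix_or_branch (u u' : List ℕ) :
    u <+: u' ∨ u' <+: u ∨ ∃ c i j, i ≠ j ∧ c ++ [i] <+: u ∧ c ++ [j] <+: u' := by
  induction u generalizing u' with
  | nil => exact Or.inl List.nil_prefix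
  | cons a u ih =>
    cases u' with
    | nil => exact Or.inr (Or.inl List.nil_prefix)
    | cons b u' =>
      by_cases hab : a = b
      · subst hab
        obtain h | h | ⟨c, i, j, hij, h1, h2⟩ := ih u'
        · exact Or.inl (by simpa using h)
        · exact Or.inr (Or.inl (by simpa using h))
        · exact Or.inr (Or.inr ⟨a :: c, i, j, hij, by simpa using h1, by simpa using h2⟩)
      · exact Or.inr (Or.inr ⟨[], a, b, hab, by simp, by simp⟩)

theorem edgePoint_le_one {v : List ℕ} {i : ℕ} {s : ℝ} (hs : s ∈ Icc (0 : ℝ) 1) (w : List ℕ) :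
    edgePoint v i s w ≤ 1 :=
  coord_le_one (W := univ) (edgePoint_mem (mem_univ _) hs) w

theorem edgePoint_le_of_prefix {v v' : List ℕ} {i i' : ℕ} {s s' : ℝ} (hs : 0 < s) (hs1 : s ≤ 1)
    (hs' : 0 < s') (hs1' : s' ≤ 1) (h : v ++ [i] <+: v') (w : List ℕ) :
    edgePoint v i s w ≤ edgePoint v' i' s' w := by
  by_cases hw : edgePoint v i s w = 0
  · rw [hw]
    exact coord_nonneg (W := univ) (edgePoint_mem (mem_univ _) ⟨hs'.le, hs1'⟩) w
  · have h1 := (edgePoint_ne_zero_iff hs).1 hw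
    rw [edgePoint_apply_prefix i' s' h1.1 (h1.2.trans h)]
    exact edgePoint_le_one ⟨hs.le, hs1⟩ w

theorem edgePoint_mono {v : List ℕ} {i : ℕ} {s t : ℝ} (h : s ≤ t) (w : List ℕ) :
    edgePoint v i s w ≤ edgePoint v i t w := by
  classical
  rw [edgePoint_apply, edgePoint_apply]
  split_ifs
  · exact h
  · exact le_rfl
  · exact le_rfl

/-- The most recent common ancestor of two points. -/
theorem exists_meet (hW : PrefixClosed W) {a b : EllOne} (ha : a ∈ wordTree W)
    (hb : b ∈ wordTree W) : ∃ m ∈ wordTree W, ∀ w, m w = min (a w) (b w) := by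
  obtain rfl | ⟨v, i, s, hv, hs, hs1, rfl⟩ := exists_edgePoint_of_mem hW ha
  · exact ⟨0, ha, fun w => (min_eq_left (coord_nonneg hb w)).symm⟩
  obtain rfl | ⟨v', i', s', hv', hs', hs1', rfl⟩ := exists_edgePoint_of_mem hW hb
  · exact ⟨0, hb, fun w => (min_eq_right (coord_nonneg ha w)).symm⟩
  have hsame : v ++ [i] = v' ++ [i'] →
      ∃ m ∈ wordTree W, ∀ w, m w = min (edgePoint v i s w) (edgePoint v' i' s' w) := by
    intro h
    obtain ⟨rfl, h4⟩ := List.append_inj' h rfl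
    obtain rfl : i = i' := by simpa using h4
    rcases le_total s s' with hss | hss
    · exact ⟨_, ha, fun w => (min_eq_left (edgePoint_mono hss w)).symm⟩
    · exact ⟨_, hb, fun w => (min_eq_right (edgePoint_mono hss w)).symm⟩
  obtain h | h | ⟨c, j, j', hjj, h1, h2⟩ := prefix_or_prefix_or_branch (v ++ [i]) (v' ++ [i'])
  · obtain h | h := prefix_concat_iff.1 h
    · exact hsame h
    · exact ⟨_, ha, fun w => (min_eq_left (edgePoint_le_of_prefix hs hs1 hs' hs1' h w)).symm⟩
  · obtain h | h := prefix_concat_iff.1 h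
    · exact hsame h.symm
    · exact ⟨_, hb, fun w => (min_eq_right (edgePoint_le_of_prefix hs' hs1' hs hs1 h w)).symm⟩
  -- The two words diverge after `c`, so the common part of the two ancestral lines ends at `vertex
  -- c`.
  · have hc : ∀ {v i j}, c ++ [j] <+: v ++ [i] → c <+: v := fun {v i j} h => by
      obtain h | h := prefix_concat_iff.1 h
      · rw [(List.append_inj' h rfl).1]
      · exact (List.prefix_append _ _).trans h
    refine ⟨vertex c, vertex_mem (hW ((List.prefix_append _ _).trans h1) hv), fun w => ?_⟩
    by_cases hw : w ≠ [] ∧ w <+: c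
    · rw [vertex_apply_prefix hw.1 hw.2, edgePoint_apply_prefix _ _ hw.1 (hw.2.trans (hc h1)),
        edgePoint_apply_prefix _ _ hw.1 (hw.2.trans (hc h2)), min_self]
    · classical
      rw [vertex_apply, if_neg hw]
      by_cases ha0 : edgePoint v i s w = 0
      · rw [ha0, min_eq_left (coord_nonneg hb w)]
      by_cases hb0 : edgePoint v' i' s' w = 0
      · rw [hb0, min_eq_right (coord_nonneg ha w)]
      exfalso
      have e1 := (edgePoint_ne_zero_iff hs).1 ha0
      have e2 := (edgePoint_ne_zero_iff hs').1 hb0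
      obtain e3 | e3 := List.prefix_or_prefix_of_prefix e1.2 h1
      · obtain e3 | e3 := prefix_concat_iff.1 e3
        · rw [e3] at e2
          have := List.prefix_of_prefix_length_le e2.2 h2 (by simp)
          exact hjj (by simpa using this.eq_of_length (by simp))
        · exact hw ⟨e1.1, e3⟩
      · have := List.prefix_of_prefix_length_le (e3.trans e2.2) h2 (by simp)
        exact hjj (by simpa using this.eq_of_length (by simp))

theorem geodJoined_edge {v : List ℕ} {i : ℕ} (hv : v ++ [i] ∈ W) {s t : ℝ}
    (hs : 0 ≤ s) (hst : s ≤ t) (ht : t ≤ 1) :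
    GeodJoined (wordTree W) (edgePoint v i s) (edgePoint v i t) := by
  have hd : dist (edgePoint v i s) (edgePoint v i t) = t - s := by
    rw [dist_edgePoint, abs_of_nonpos (by linarith)]; ring
  rw [GeodJoined, hd]
  refine ⟨fun r => edgePoint v i (s + r), fun r hr => edgePoint_mem hv
    ⟨by linarith [hr.1], by linarith [hr.2]⟩, by simp, by simp, fun r _ r' _ => ?_⟩
  rw [dist_edgePoint]
  congr 1; ring

theorem eq_zero_of_le_zero {m : EllOne} (hm : m ∈ wordTree W) (h : ∀ w, m w ≤ 0) : m = 0 := by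
  ext w
  exact le_antisymm (h w) (coord_nonneg hm w)

theorem between_of_le {a m b : EllOne} (h1 : ∀ w, a w ≤ m w) (h2 : ∀ w, m w ≤ b w) :
    Between a m b := between_iff.2 fun w => Or.inl ⟨h1 w, h2 w⟩

/-- A point below a point of an edge that has a positive coordinate on this edge lies on the edge
itself; coordinate `1` leaves only the upper end, since a larger point would have a coordinate on a
child edge. -/
theorem eq_edgePoint_of_le (hW : PrefixClosed W) {m : EllOne} (hm : m ∈ wordTree W) {v : List ℕ}
    {i : ℕ} {s : ℝ} (hle : ∀ w, m w ≤ edgePoint v i s w) (h0 : m (v ++ [i]) ≠ 0) :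
    m = edgePoint v i (m (v ++ [i])) := by
  obtain h1 | h1 := (coord_le_one hm (v ++ [i])).lt_or_eq
  · exact eq_edgePoint_of_coord hW hm (lt_of_le_of_ne (coord_nonneg hm _) h0.symm) h1
  · rw [h1, edgePoint_one]
    by_contra hne
    obtain h | ⟨j, hj⟩ := ne_vertex_cases hW hm hne
    · exact h.2.ne h1
    · have := hle (v ++ [i] ++ [j])
      classical
      rw [edgePoint_apply, if_neg (by simp), if_neg] at this
      · linarith
      · rintro ⟨-, h⟩
        have := h.length_le
        simp at this

/-- Geodesics along an ancestral line are glued one edge at a time, by induction on the word: either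
`m` is on the last edge, or it is below the lower end of that edge and the induction hypothesis
applies. -/
theorem geodJoined_of_le_edgePoint (hW : PrefixClosed W) (v : List ℕ) : ∀ (i : ℕ) (s : ℝ),
    v ++ [i] ∈ W → s ∈ Icc (0 : ℝ) 1 → ∀ m ∈ wordTree W, (∀ w, m w ≤ edgePoint v i s w) →
    GeodJoined (wordTree W) m (edgePoint v i s) := by
  induction v using List.reverseRecOn with
  | nil =>
    intro i s hi hs m hm hle
    by_cases h0 : m ([] ++ [i]) = 0
    · have : m = edgePoint [] i 0 := by
        rw [edgePoint_zero, vertex_nil]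
        refine eq_zero_of_le_zero hm fun w => ?_
        classical
        by_cases hw : w = [] ++ [i]
        · rw [hw, h0]
        · refine (hle w).trans ?_
          rw [edgePoint_apply, if_neg hw, if_neg]
          rintro ⟨h1, h2⟩
          exact h1 (List.prefix_nil.1 h2)
      rw [this]
      exact geodJoined_edge hi le_rfl hs.1 hs.2
    · rw [eq_edgePoint_of_le hW hm hle h0]
      have := hle ([] ++ [i])
      rw [edgePoint_apply_self] at this
      exact geodJoined_edge hi (coord_nonneg hm _) this hs.2
  | append_singleton v j ih =>
    intro i s hi hs m hm hle
    by_cases h0 : m (v ++ [j] ++ [i]) = 0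
    · have hle' : ∀ w, m w ≤ edgePoint v j 1 w := fun w => by
        classical
        rw [edgePoint_one]
        by_cases hw : w = v ++ [j] ++ [i]
        · rw [hw, h0, vertex_apply_of_not_prefix (not_concat_prefix _ _)]
        · refine (hle w).trans ?_
          rw [edgePoint_apply, if_neg hw, vertex_apply]
      have h1 := ih j 1 (hW (List.prefix_append _ _) hi) ⟨zero_le_one, le_rfl⟩ m hm hle'
      have h2 := geodJoined_edge hi le_rfl hs.1 hs.2
      rw [edgePoint_zero, ← edgePoint_one] at h2
      refine h1.trans h2 (between_of_le hle' fun w => ?_)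
      rw [edgePoint_one, ← edgePoint_zero (v ++ [j]) i]
      exact edgePoint_mono hs.1 w
    · rw [eq_edgePoint_of_le hW hm hle h0]
      have := hle (v ++ [j] ++ [i])
      rw [edgePoint_apply_self] at this
      exact geodJoined_edge hi (coord_nonneg hm _) this hs.2

theorem geodJoined_of_le (hW : PrefixClosed W) {m x : EllOne} (hm : m ∈ wordTree W)
    (hx : x ∈ wordTree W) (hle : ∀ w, m w ≤ x w) : GeodJoined (wordTree W) m x := by
  obtain hx | ⟨v, i, hv, s, hs, rfl⟩ := id hx
  · have : m = 0 := eq_zero_of_le_zero hm fun w => by simpa [mem_singleton_iff.1 hx] using hle w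
    rw [this, mem_singleton_iff.1 hx]
    exact GeodJoined.refl (zero_mem_wordTree W)
  · exact geodJoined_of_le_edgePoint hW v i s hv hs m hm hle

/-- The geodesic descends from `a` to the most recent common ancestor and then climbs to `b`. The
ancestor is between `a` and `b` because its coordinates are the minima of theirs. -/
theorem geodJoined_wordTree (hW : PrefixClosed W) {a b : EllOne} (ha : a ∈ wordTree W)
    (hb : b ∈ wordTree W) : GeodJoined (wordTree W) a b := by
  obtain ⟨m, hm, hmin⟩ := exists_meet hW ha hb
  have h1 : ∀ w, m w ≤ a w := fun w => by rw [hmin]; exact min_le_left _ _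
  have h2 : ∀ w, m w ≤ b w := fun w => by rw [hmin]; exact min_le_right _ _
  refine (geodJoined_of_le hW hm ha h1).symm.trans (geodJoined_of_le hW hm hb h2)
    (between_iff.2 fun w => ?_)
  rw [hmin w]
  rcases le_total (a w) (b w) with h | h
  · left; simp [h]
  · right; simp [h]

theorem sepTree_range {X : Type*} [MetricSpace X] (hW : PrefixClosed W) {φ : wordTree W → X}
    (hφ : Isometry φ) : SepTree (range φ) := by
  refine ⟨?_, ?_⟩
  · rintro _ ⟨a, rfl⟩ _ ⟨b, rfl⟩
    exact (geodJoined_wordTree hW a.2 b.2).image hφ a.2 b.2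
  · rintro C hC hpre v hv w hw x ⟨hx, hxb⟩
    obtain ⟨a, rfl⟩ := hC hv
    obtain ⟨b, rfl⟩ := hC hw
    obtain ⟨y, rfl⟩ := hx
    have h1 : IsPreconnected (φ ⁻¹' C) := by
      rw [← hφ.isEmbedding.isInducing.isPreconnected_image, image_preimage_eq_of_subset hC]
      exact hpre
    have h2 : IsPreconnected (Subtype.val '' (φ ⁻¹' C)) :=
      h1.image _ continuous_subtype_val.continuousOn
    have h3 : Between (a : EllOne) y b := by
      simpa [Between, hφ.dist_eq, Subtype.dist_eq] using hxb
    obtain ⟨y', hy', hyy⟩ := mem_of_between_of_isPreconnected hW h2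
      (by rintro _ ⟨z, -, rfl⟩; exact z.2) ⟨a, hv, rfl⟩ ⟨b, hw, rfl⟩ y.2 h3
    rwa [← Subtype.ext hyy]

/-! ### Heights and compactness -/

theorem dist_zero_edgePoint_eq {v : List ℕ} {i : ℕ} {s : ℝ} (hs : s ∈ Icc (0 : ℝ) 1) :
    dist 0 (edgePoint v i s) = dist 0 (vertex v) + s := by
  have hb : Between 0 (edgePoint v i 0) (edgePoint v i s) := by
    refine between_of_le (fun w => ?_) (edgePoint_mono hs.1)
    exact coord_nonneg (W := univ) (edgePoint_mem (mem_univ _) ⟨le_rfl, zero_le_one⟩) w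
  rw [Between, dist_edgePoint, edgePoint_zero] at hb
  rw [← hb, zero_sub, abs_neg, abs_of_nonneg hs.1]

theorem dist_zero_vertex (u : List ℕ) : dist 0 (vertex u) = u.length := by
  induction u using List.reverseRecOn with
  | nil => simp [vertex_nil]
  | append_singleton v i ih =>
    rw [← edgePoint_one, dist_zero_edgePoint_eq ⟨zero_le_one, le_rfl⟩, ih]
    simp

theorem dist_zero_edgePoint {v : List ℕ} {i : ℕ} {s : ℝ} (hs : s ∈ Icc (0 : ℝ) 1) :
    dist 0 (edgePoint v i s) = v.length + s := by
  rw [dist_zero_edgePoint_eq hs, dist_zero_vertex]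

/-- Finitely many words of each length. -/
def LocallyFiniteWords (W : Set (List ℕ)) : Prop := ∀ n : ℕ, {u ∈ W | u.length ≤ n}.Finite

theorem LocallyFiniteWords.mono {W W' : Set (List ℕ)} (h : LocallyFiniteWords W') (hs : W ⊆ W') :
    LocallyFiniteWords W := fun n => (h n).subset fun _ hu => ⟨hs hu.1, hu.2⟩

/-- A ball meets only finitely many edges, and each edge is an isometric image of `[0, 1]`. -/
theorem isCompact_wordTree_inter_closedBall (hfin : LocallyFiniteWords W) (r : ℝ) :
    IsCompact (wordTree W ∩ Metric.closedBall 0 r) := by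
  -- An edge with a point at height at most `r` has its upper end at height at most `r + 1`.
  obtain ⟨n, hn⟩ := exists_nat_ge (r + 1)
  have hcomp : IsCompact ({0} ∪ ⋃ u ∈ {u ∈ W | u.length ≤ n},
      {x | ∃ v i, v ++ [i] = u ∧ ∃ s ∈ Icc (0 : ℝ) 1, x = edgePoint v i s}) := by
    refine isCompact_singleton.union ((hfin n).isCompact_biUnion fun u hu => ?_)
    obtain rfl | ⟨v, i, rfl⟩ := List.eq_nil_or_concat' u
    · convert isCompact_empty
      ext x; simp
    · have : {x | ∃ v' i', v' ++ [i'] = v ++ [i] ∧ ∃ s ∈ Icc (0 : ℝ) 1, x = edgePoint v' i' s} =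
          edgePoint v i '' Icc (0 : ℝ) 1 := by
        ext x
        constructor
        · rintro ⟨v', i', h, s, hs, rfl⟩
          obtain ⟨rfl, h4⟩ := List.append_inj' h rfl
          obtain rfl : i' = i := by simpa using h4
          exact ⟨s, hs, rfl⟩
        · rintro ⟨s, hs, rfl⟩
          exact ⟨v, i, rfl, s, hs, rfl⟩
      rw [this]
      refine isCompact_Icc.image (Isometry.continuous (Isometry.of_dist_eq fun s t => ?_))
      rw [dist_edgePoint, Real.dist_eq]
  convert hcomp.inter_right (t := Metric.closedBall 0 r) Metric.isClosed_closedBall using 1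
  ext x
  simp only [mem_inter_iff]
  refine and_congr_left fun hx => ⟨?_, ?_⟩
  · rintro (h | ⟨v, i, hv, s, hs, rfl⟩)
    · exact Or.inl h
    · refine Or.inr (mem_iUnion₂.2 ⟨v ++ [i], ⟨hv, ?_⟩, v, i, rfl, s, hs, rfl⟩)
      rw [Metric.mem_closedBall, dist_comm, dist_zero_edgePoint hs] at hx
      have h2 : ((v.length + 1 : ℕ) : ℝ) ≤ n := by push_cast; linarith [hs.1]
      have h3 : v.length + 1 ≤ n := by exact_mod_cast h2
      simpa using h3
  · rintro (h | h)
    · exact Or.inl h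
    · obtain ⟨u, hu, v, i, rfl, s, hs, rfl⟩ := mem_iUnion₂.1 h
      exact edgePoint_mem hu.1 hs

/-- Properness supplies both the completeness and the local compactness demanded of a rooted real
tree. -/
theorem properSpace_wordTree (hfin : LocallyFiniteWords W) : ProperSpace (wordTree W) := by
  refine ProperSpace.of_seq_closedBall (x := ⟨0, zero_mem_wordTree W⟩) (r := fun n : ℕ => (n : ℝ))
    tendsto_natCast_atTop_atTop (Eventually.of_forall fun n => ?_)
  rw [Subtype.isCompact_iff]
  convert isCompact_wordTree_inter_closedBall hfin n using 1
  ext x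
  constructor
  · rintro ⟨y, hy, rfl⟩
    exact ⟨y.2, hy⟩
  · rintro ⟨h1, h2⟩
    exact ⟨⟨x, h1⟩, h2, rfl⟩

theorem isRootedRealTree_range {X : Type*} [MetricSpace X] (hW : PrefixClosed W)
    (hfin : LocallyFiniteWords W) {φ : wordTree W → X} (hφ : Isometry φ) :
    IsRootedRealTree (φ ⟨0, zero_mem_wordTree W⟩) (range φ) := by
  have := properSpace_wordTree hfin
  have hS := sepTree_range hW hφ
  exact
    { root_mem := mem_range_self _
      geodesic := hS.geod
      unique_path := hS.unique_path
      complete := hφ.isUniformInducing.isComplete_range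
      separable := TopologicalSpace.isSeparable_range hφ.continuous
      locallyCompact := hφ.isEmbedding.toHomeomorph.symm.isClosedEmbedding.locallyCompactSpace }

end WordTree

/-! ### Pruning and erasure of embedded word trees -/

section Embedded

variable {X : Type*} {W : Set (List ℕ)} {φ : wordTree W → X}

/-- The part of an embedded word tree that is spanned by the words in `W'`. -/
def subTree (φ : wordTree W → X) (W' : Set (List ℕ)) : Set X :=
  φ '' {a | (a : EllOne) ∈ wordTree W'}

/-- The marks `Θ` on the branch points of an embedded word tree are given by `M`. -/
def MarkedBy (φ : wordTree W → X) (Θ : X → ℝ≥0∞) (M : List ℕ → ℝ≥0∞) : Prop :=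
  ∀ (a : wordTree W) (u : List ℕ), u ≠ [] → (∃ i, u ++ [i] ∈ W) → (a : EllOne) = vertex u →
    Θ (φ a) = M u

theorem MarkedBy.comp_inclusion {Θ : X → ℝ≥0∞} {M : List ℕ → ℝ≥0∞} (hM : MarkedBy φ Θ M)
    {W' : Set (List ℕ)} (h : W' ⊆ W) : MarkedBy (φ ∘ inclusion (wordTree_mono h)) Θ M :=
  fun a u hu ⟨i, hi⟩ ha => hM (inclusion (wordTree_mono h) a) u hu ⟨i, h hi⟩ ha

theorem subTree_mono (φ : wordTree W → X) {W₁ W₂ : Set (List ℕ)} (h : W₁ ⊆ W₂) :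
    subTree φ W₁ ⊆ subTree φ W₂ := image_mono fun _ ha => wordTree_mono h ha

theorem subTree_eq_range {W' : Set (List ℕ)} (h : W' ⊆ W) :
    subTree φ W' = range (φ ∘ inclusion (wordTree_mono h)) := by
  ext x
  constructor
  · rintro ⟨a, ha, rfl⟩
    exact ⟨⟨a, ha⟩, rfl⟩
  · rintro ⟨a, rfl⟩
    exact ⟨_, a.2, rfl⟩

theorem root_mem_subTree (φ : wordTree W → X) (W' : Set (List ℕ)) :
    φ ⟨0, zero_mem_wordTree W⟩ ∈ subTree φ W' := ⟨_, zero_mem_wordTree W', rfl⟩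

variable [MetricSpace X]

theorem isometry_comp_inclusion (hφ : Isometry φ) {W' : Set (List ℕ)} (h : W' ⊆ W) :
    Isometry (φ ∘ inclusion (wordTree_mono h)) :=
  hφ.comp (Isometry.of_dist_eq fun _ _ => rfl)

theorem isRootedRealTree_subTree (hφ : Isometry φ) (hfin : LocallyFiniteWords W)
    {W' : Set (List ℕ)} (h : W' ⊆ W) (hW' : PrefixClosed W') :
    IsRootedRealTree (φ ⟨0, zero_mem_wordTree W⟩) (subTree φ W') := by
  rw [subTree_eq_range h]
  exact isRootedRealTree_range hW' (hfin.mono h) (isometry_comp_inclusion hφ h)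

theorem wordTree_inter {W₁ W₂ : Set (List ℕ)} (h₁ : PrefixClosed W₁) (h₂ : PrefixClosed W₂) :
    wordTree W₁ ∩ wordTree W₂ = wordTree (W₁ ∩ W₂) := by
  refine Subset.antisymm ?_
    (subset_inter (wordTree_mono inter_subset_left) (wordTree_mono inter_subset_right))
  rintro x ⟨hx₁, hx₂⟩
  exact mem_wordTree_of_coord (wordTree_mono (subset_univ _) hx₁) fun w _ hw =>
    ⟨mem_of_coord_ne_zero h₁ hx₁ hw, mem_of_coord_ne_zero h₂ hx₂ hw⟩

theorem subTree_inter (hφ : Isometry φ) {W₁ W₂ : Set (List ℕ)} (h₁ : PrefixClosed W₁)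
    (h₂ : PrefixClosed W₂) : subTree φ W₁ ∩ subTree φ W₂ = subTree φ (W₁ ∩ W₂) := by
  rw [subTree, subTree, ← image_inter hφ.injective, subTree]
  congr 1
  ext a
  rw [mem_ofPred_eq, ← wordTree_inter h₁ h₂]
  rfl

theorem between_zero_iff {a b : EllOne} (ha : a ∈ wordTree W) (hb : b ∈ wordTree W) :
    Between 0 b a ↔ ∀ w, b w ≤ a w := by
  rw [between_iff]
  refine forall_congr' fun w => ⟨?_, fun h => Or.inl ⟨coord_nonneg hb w, h⟩⟩
  rintro (h | h)
  · exact h.2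
  · exact h.2.trans (coord_nonneg ha w)

theorem mem_segment_range_iff (hφ : Isometry φ) (a b : wordTree W) :
    φ b ∈ segment (range φ) (φ ⟨0, zero_mem_wordTree W⟩) (φ a) ↔
      ∀ w, (b : EllOne) w ≤ (a : EllOne) w := by
  rw [← between_zero_iff a.2 b.2, mem_segment_iff, and_iff_right (mem_range_self _)]
  simp [Between, hφ.dist_eq, Subtype.dist_eq]

theorem vertex_le_iff (hW : PrefixClosed W) {u : List ℕ} (hu : u ≠ []) {a : EllOne}
    (ha : a ∈ wordTree W) : (∀ w, vertex u w ≤ a w) ↔ a u = 1 := by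
  constructor
  · intro h
    have := h u
    rw [vertex_apply_prefix hu List.prefix_rfl] at this
    exact le_antisymm (coord_le_one ha u) this
  · intro h w
    by_cases hw : w ≠ [] ∧ w <+: u
    · rw [vertex_apply_prefix hw.1 hw.2]
      by_cases hwu : w = u
      · rw [hwu, h]
      · rw [coord_eq_one_of_prefix hW ha (w := u) (by rw [h]; exact one_ne_zero) hw.2 hwu hw.1]
    · classical
      rw [vertex_apply, if_neg hw]
      exact coord_nonneg ha w

theorem vertex_ne_of_ne {u v : List ℕ} (h : u ≠ v) : vertex u ≠ vertex v := by
  intro he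
  have key : ∀ {u v : List ℕ}, vertex u = vertex v → u <+: v := fun {u v} he => by
    by_cases hu : u = []
    · rw [hu]; exact List.nil_prefix
    · have h1 := vertex_apply_prefix hu (List.prefix_refl u)
      rw [he] at h1
      by_contra hc
      rw [vertex_apply_of_not_prefix hc] at h1
      exact zero_ne_one h1
  have h1 := key he
  exact h (h1.eq_of_length (le_antisymm h1.length_le (key he.symm).length_le))

/-- Integer height forces a vertex, and a point strictly above a vertex has a positive coordinate at
one of its children. -/
theorem mem_brPlus_range_iff (hW : PrefixClosed W) (hφ : Isometry φ) (a : wordTree W) :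
    φ a ∈ brPlus (φ ⟨0, zero_mem_wordTree W⟩) (range φ) ↔
      ∃ u, u ≠ [] ∧ (∃ i, u ++ [i] ∈ W) ∧ (a : EllOne) = vertex u := by
  rw [(sepTree_range hW hφ).mem_brPlus_iff (mem_range_self _),
    and_iff_right (mem_range_self _)]
  constructor
  · rintro ⟨hne, ⟨_, ⟨x, rfl⟩, hxa, hx⟩, n, hn⟩
    rw [mem_segment_range_iff hφ] at hx
    rw [hφ.dist_eq, Subtype.dist_eq] at hn
    obtain h0 | ⟨v, i, s, hv, hs, hs1, has⟩ := exists_edgePoint_of_mem hW a.2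
    · exact absurd (congrArg φ (Subtype.ext h0)) hne
    rw [has, dist_zero_edgePoint ⟨hs.le, hs1⟩] at hn
    -- The height is `v.length + s` with `0 < s ≤ 1`, and it is an integer.
    obtain rfl : s = 1 := by
      have h1 : (v.length : ℝ) < n := by linarith
      have h2 : (v.length + 1 : ℝ) ≤ n := by exact_mod_cast h1
      linarith
    rw [edgePoint_one] at has
    refine ⟨v ++ [i], by simp, ?_, has⟩
    rw [has, vertex_le_iff hW (by simp) x.2] at hx
    obtain h | ⟨j, hj⟩ := ne_vertex_cases hW x.2 (u := v ++ [i])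
      (fun h => hxa (congrArg φ (Subtype.ext (h.trans has.symm))))
    · exact absurd hx h.2.ne
    · exact ⟨j, mem_of_coord_ne_zero hW x.2 hj.ne'⟩
  · rintro ⟨u, hu, ⟨i, hi⟩, ha⟩
    refine ⟨fun h => ?_, ⟨_, mem_range_self ⟨vertex (u ++ [i]), vertex_mem hi⟩, fun h => ?_, ?_⟩,
      u.length, ?_⟩
    · have := congrArg Subtype.val (hφ.injective h)
      exact vertex_ne_of_ne hu (ha.symm.trans (this.trans vertex_nil.symm))
    · have := congrArg Subtype.val (hφ.injective h)
      rw [ha] at this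
      exact vertex_ne_of_ne (by simp) this
    · rw [mem_segment_range_iff hφ, ha, vertex_le_iff hW hu (vertex_mem hi)]
      exact vertex_apply_prefix hu (List.prefix_append _ _)
    · rw [hφ.dist_eq, Subtype.dist_eq, ha, dist_zero_vertex]

/-- The words of `W` that are not strictly above a nonempty word with mark at most `θ`. -/
def pruneWords (W : Set (List ℕ)) (M : List ℕ → ℝ≥0∞) (θ : ℝ≥0∞) : Set (List ℕ) :=
  {u ∈ W | ∀ v i, v ≠ [] → v ++ [i] <+: u → θ < M v}

theorem pruneWords_subset (W : Set (List ℕ)) (M : List ℕ → ℝ≥0∞) (θ : ℝ≥0∞) :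
    pruneWords W M θ ⊆ W := fun _ hu => hu.1

theorem PrefixClosed.pruneWords (hW : PrefixClosed W) (M : List ℕ → ℝ≥0∞) (θ : ℝ≥0∞) :
    PrefixClosed (pruneWords W M θ) := fun _ _ huv hv =>
  ⟨hW huv hv.1, fun w i hw hwu => hv.2 w i hw (hwu.trans huv)⟩

/-- The connected component loses the cut vertices together with all that is above them. The closure
restores the cut vertices, and this is why `pruneWords` removes only words strictly above a cut. -/
theorem prune_range_eq (hW : PrefixClosed W) (hfin : LocallyFiniteWords W) (hφ : Isometry φ)
    {Θ : X → ℝ≥0∞} {M : List ℕ → ℝ≥0∞} (hM : MarkedBy φ Θ M) (θ : ℝ≥0) :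
    prune (φ ⟨0, zero_mem_wordTree W⟩) (range φ) Θ θ = subTree φ (pruneWords W M θ) := by
  set ρ := φ ⟨0, zero_mem_wordTree W⟩ with hρ
  have hcomp : connectedComponentIn (range φ \ {v ∈ brPlus ρ (range φ) | Θ v ≤ θ}) ρ =
      φ '' {a | ∀ u, u ≠ [] → (∃ i, u ++ [i] ∈ W) → M u ≤ θ → (a : EllOne) u ≠ 1} := by
    rw [(sepTree_range hW hφ).connectedComponentIn_diff (mem_range_self _)
      (fun h => h.1.2.1 rfl)]
    ext x
    constructor
    · rintro ⟨⟨a, rfl⟩, ha⟩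
      refine ⟨a, fun u hu hi hMu hau => ?_, rfl⟩
      have hu' : u ∈ W := hi.elim fun i hi => hW (List.prefix_append _ _) hi
      refine ha (φ ⟨vertex u, vertex_mem hu'⟩) ⟨?_, ?_⟩ ?_
      · exact (mem_brPlus_range_iff hW hφ _).2 ⟨u, hu, hi, rfl⟩
      · rw [hM _ u hu hi rfl]; exact hMu
      · rw [mem_segment_range_iff hφ]
        exact (vertex_le_iff hW hu a.2).2 hau
    · rintro ⟨a, ha, rfl⟩
      refine ⟨mem_range_self _, ?_⟩
      rintro c ⟨hc, hcθ⟩ hcs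
      obtain ⟨b, rfl⟩ := hc.1
      obtain ⟨u, hu, hi, hbu⟩ := (mem_brPlus_range_iff hW hφ b).1 hc
      rw [hM b u hu hi hbu] at hcθ
      rw [mem_segment_range_iff hφ, hbu, vertex_le_iff hW hu a.2] at hcs
      exact ha u hu hi hcθ hcs
  rw [prune, hcomp]
  -- The subtree is complete and hence closed, so it contains the closure once it contains the
  -- component. For the converse every point is approached from below along its edge.
  refine Subset.antisymm (closure_minimal ?_ ?_) ?_
  · rintro _ ⟨a, ha, rfl⟩
    refine ⟨a, mem_wordTree_of_coord (wordTree_mono (subset_univ _) a.2) fun w hw hw0 => ?_, rfl⟩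
    have hwW := mem_of_coord_ne_zero hW a.2 hw0
    refine ⟨hwW, fun v i hv hvw => ?_⟩
    by_contra! hc
    refine ha v hv ⟨i, hW hvw hwW⟩ hc ?_
    refine coord_eq_one_of_prefix hW a.2 hw0 ((List.prefix_append _ _).trans hvw) ?_ hv
    rintro rfl
    exact not_concat_prefix _ _ hvw
  · exact (isRootedRealTree_subTree hφ hfin (pruneWords_subset W M θ)
      (hW.pruneWords M θ)).complete.isClosed
  · rintro _ ⟨a, ha, rfl⟩
    obtain h0 | ⟨v, i, s, hv, hs, hs1, has⟩ := exists_edgePoint_of_mem (hW.pruneWords M θ) ha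
    · refine subset_closure ⟨a, fun u _ _ _ hau => ?_, rfl⟩
      rw [h0] at hau
      exact zero_ne_one hau
    · rw [Metric.mem_closure_iff]
      intro ε hε
      -- Going down by at most `s / 2` keeps the point off the lower end of its edge, and by at most
      -- `ε / 2` keeps it within `ε`. Since `s' < 1`, a possible cut at the upper end of the edge
      -- does not affect it.
      set s' := s - min (s / 2) (ε / 2) with hs'
      have h1 : 0 < min (s / 2) (ε / 2) := lt_min (by linarith) (by linarith)
      have h2 := min_le_left (s / 2) (ε / 2)
      have h3 := min_le_right (s / 2) (ε / 2)
      have hs'0 : 0 < s' := by linarith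
      refine ⟨_, ⟨⟨edgePoint v i s', edgePoint_mem hv.1 ⟨hs'0.le, by linarith⟩⟩,
        fun u hu _ hMu hau => ?_, rfl⟩, ?_⟩
      · have h4 := ((edgePoint_ne_zero_iff (v := v) (i := i) (w := u) hs'0).1
          (by rw [show edgePoint v i s' u = 1 from hau]; exact one_ne_zero)).2
        obtain h5 | h5 := prefix_concat_iff.1 h4
        · have : edgePoint v i s' u = 1 := hau
          rw [h5, edgePoint_apply_self] at this
          linarith
        · obtain ⟨t, rfl⟩ := h5
          have : ∃ j, u ++ [j] <+: u ++ t ++ [i] := by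
            cases t with
            | nil => exact ⟨i, by simp⟩
            | cons j t => exact ⟨j, by simp⟩
          obtain ⟨j, hj⟩ := this
          exact absurd (hv.2 u j hu hj) (not_lt.2 hMu)
      · rw [hφ.dist_eq, Subtype.dist_eq, has, dist_edgePoint, abs_of_nonneg (by linarith)]
        linarith

/-- The words of `W` with a descendant in `W` at least `h` generations later, and the root. -/
def eraseWords (h : ℕ) (W : Set (List ℕ)) : Set (List ℕ) :=
  {u ∈ W | u = [] ∨ ∃ u' ∈ W, u <+: u' ∧ u.length + h ≤ u'.length}

theorem eraseWords_subset (h : ℕ) (W : Set (List ℕ)) : eraseWords h W ⊆ W := fun _ hu => hu.1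

theorem PrefixClosed.eraseWords (hW : PrefixClosed W) (h : ℕ) :
    PrefixClosed (eraseWords h W) := by
  rintro u v huv ⟨hv, hv'⟩
  refine ⟨hW huv hv, ?_⟩
  obtain rfl | ⟨u', hu', h1, h2⟩ := hv'
  · exact Or.inl (List.prefix_nil.1 huv)
  · exact Or.inr ⟨u', hu', huv.trans h1, by have := huv.length_le; omega⟩

theorem natCast_le_edist_iff {x y : X} {n : ℕ} : (n : ℝ≥0∞) ≤ edist x y ↔ (n : ℝ) ≤ dist x y := by
  rw [edist_dist, ← ENNReal.ofReal_natCast, ENNReal.ofReal_le_ofReal_iff dist_nonneg]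

theorem edist_le_natCast_iff {x y : X} {n : ℕ} : edist x y ≤ n ↔ dist x y ≤ n := by
  rw [edist_dist, ← ENNReal.ofReal_natCast, ENNReal.ofReal_le_ofReal_iff (by positivity)]

theorem height_range_le_iff (hφ : Isometry φ) (h : ℕ) :
    height (φ ⟨0, zero_mem_wordTree W⟩) (range φ) ≤ h ↔ ∀ u ∈ W, u.length ≤ h := by
  rw [height, iSup₂_le_iff]
  constructor
  · intro H u hu
    have := H _ (mem_range_self ⟨vertex u, vertex_mem hu⟩)
    rw [edist_le_natCast_iff, hφ.dist_eq, Subtype.dist_eq, dist_zero_vertex] at this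
    exact_mod_cast this
  · rintro H _ ⟨a, rfl⟩
    rw [edist_le_natCast_iff, hφ.dist_eq, Subtype.dist_eq]
    obtain h0 | ⟨v, i, hv, s, hs, has⟩ := a.2
    · rw [mem_singleton_iff.1 h0, dist_self]; positivity
    · rw [has, dist_zero_edgePoint hs]
      have h1 : v.length + 1 ≤ h := by simpa using H _ hv
      have h2 : (v.length + 1 : ℝ) ≤ h := by exact_mod_cast h1
      linarith [hs.2]

/-- With unit edges and integer `h`, the condition `Γ(T_v) ≥ h` is constant on each edge without its
lower end, and it holds there exactly when the upper end has a descendant `h` generations later. If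
the height is at most `h`, no nonempty word has such a descendant, which agrees with the convention
`{ρ}`; otherwise the root satisfies the condition. -/
theorem erase_range_eq (hW : PrefixClosed W) (hφ : Isometry φ) (h : ℕ) :
    erase (φ ⟨0, zero_mem_wordTree W⟩) h (range φ) = subTree φ (eraseWords h W) := by
  rw [erase]
  split_ifs with hh
  · rw [height_range_le_iff hφ] at hh
    ext x
    constructor
    · rintro rfl
      exact ⟨_, zero_mem_wordTree _, rfl⟩
    · rintro ⟨a, ha, rfl⟩
      obtain h0 | ⟨v, i, hv, -⟩ := ha
      · exact congrArg φ (Subtype.ext h0)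
      · obtain h1 | ⟨u', hu', -, h2⟩ := hv.2
        · simp at h1
        · have := hh u' hu'
          simp at h2
          omega
  · ext x
    constructor
    · rintro ⟨⟨a, rfl⟩, ha⟩
      refine ⟨a, mem_wordTree_of_coord (wordTree_mono (subset_univ _) a.2) ?_, rfl⟩
      obtain h0 | ⟨v, i, s, hv, hs, hs1, has⟩ := exists_edgePoint_of_mem hW a.2
      · intro w _ hw
        rw [h0] at hw
        exact absurd rfl hw
      suffices hu : v ++ [i] ∈ eraseWords h W by
        intro w hw hw0
        rw [has, edgePoint_ne_zero_iff hs] at hw0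
        exact hW.eraseWords h hw0.2 hu
      refine ⟨hv, Or.inr ?_⟩
      by_contra! hc
      -- Descendants of `v ++ [i]` are here shorter than `v.length + 1 + h`, so they have height at
      -- most `v.length + h`, which is `h - s` above the point at height `v.length + s`.
      have hlt : ENNReal.ofReal (h - s) < h := by
        rw [← ENNReal.ofReal_natCast]
        have h1 := hc _ hv List.prefix_rfl
        have h2 : 0 < h := by omega
        exact (ENNReal.ofReal_lt_ofReal_iff (by exact_mod_cast h2)).2 (by linarith)
      refine absurd ha (not_le.2 (lt_of_le_of_lt ?_ hlt))
      rw [height, iSup₂_le_iff]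
      rintro _ ⟨⟨b, rfl⟩, hb⟩
      rw [edist_dist]
      refine ENNReal.ofReal_le_ofReal ?_
      rw [mem_segment_range_iff hφ] at hb
      have hbt : Between 0 (a : EllOne) b := (between_zero_iff b.2 a.2).2 hb
      rw [hφ.dist_eq, Subtype.dist_eq]
      have hb0 : (b : EllOne) (v ++ [i]) ≠ 0 := by
        have := hb (v ++ [i])
        rw [has, edgePoint_apply_self] at this
        exact (lt_of_lt_of_le hs this).ne'
      obtain h0 | ⟨v', i', s', hv', hs', hs1', hbs⟩ := exists_edgePoint_of_mem hW b.2
      · rw [h0] at hb0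
        exact absurd rfl hb0
      rw [Between, has, dist_zero_edgePoint ⟨hs.le, hs1⟩, ← has, hbs,
        dist_zero_edgePoint ⟨hs'.le, hs1'⟩, ← hbs] at hbt
      rw [hbs, edgePoint_ne_zero_iff hs'] at hb0
      have h3 := hc _ hv' hb0.2
      simp only [List.length_append, List.length_singleton] at h3
      have h4 : (v'.length + 1 : ℝ) < v.length + 1 + h := by exact_mod_cast h3
      have h5 : (v'.length + 1 + 1 : ℝ) ≤ v.length + 1 + h := by exact_mod_cast h3
      linarith
    · rintro ⟨a, ha, rfl⟩
      refine ⟨mem_range_self _, ?_⟩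
      have hkey : ∀ u ∈ W, (∀ w, (a : EllOne) w ≤ vertex u w) → dist 0 (a : EllOne) + h ≤ u.length →
          (h : ℝ≥0∞) ≤ height (φ a) (subtreeAbove (φ ⟨0, zero_mem_wordTree W⟩) (range φ) (φ a)) := by
        intro u hu hau hd
        have hmem : φ ⟨vertex u, vertex_mem hu⟩ ∈
            subtreeAbove (φ ⟨0, zero_mem_wordTree W⟩) (range φ) (φ a) :=
          ⟨mem_range_self _, (mem_segment_range_iff hφ _ _).2 hau⟩
        refine le_trans ?_ (le_iSup₂ (f := fun v _ => edist (φ a) v) _ hmem)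
        rw [natCast_le_edist_iff, hφ.dist_eq, Subtype.dist_eq]
        have hbt : Between 0 (a : EllOne) (vertex u) := (between_zero_iff (vertex_mem hu) a.2).2 hau
        rw [Between, dist_zero_vertex] at hbt
        linarith
      obtain h0 | ⟨v, i, s, hv, hs, hs1, has⟩ := exists_edgePoint_of_mem (hW.eraseWords h) ha
      · rw [height_range_le_iff hφ] at hh
        push Not at hh
        obtain ⟨u, hu, hlt⟩ := hh
        refine hkey u hu ?_ ?_
        · rw [h0]
          exact coord_nonneg (vertex_mem hu)
        · rw [h0, dist_self, zero_add]
          exact_mod_cast hlt.le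
      · obtain h1 | ⟨u', hu', h2, h3⟩ := hv.2
        · simp at h1
        refine hkey u' hu' (fun w => ?_) ?_
        · by_cases hw : edgePoint v i s w = 0
          · rw [has, hw]
            exact coord_nonneg (vertex_mem hu') w
          · have h4 := (edgePoint_ne_zero_iff hs).1 hw
            rw [vertex_apply_prefix h4.1 (h4.2.trans h2)]
            exact coord_le_one a.2 w
        · rw [has, dist_zero_edgePoint ⟨hs.le, hs1⟩]
          simp only [List.length_append, List.length_singleton] at h3
          have h4 : (v.length + 1 + h : ℝ) ≤ u'.length := by exact_mod_cast h3
          linarith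

end Embedded

/-! ### Pruning processes of embedded word trees -/

section PruningProcess

variable {X : Type*} [MetricSpace X]

/-- Radii up to `n` contribute nothing. For larger `r` both sets contain `ρ` and lie in the ball of
radius `r`, so their Hausdorff distance is at most `r`. -/
theorem localHausdorff_le {ρ : X} {S T : Set X} (hS : ρ ∈ S) (hT : ρ ∈ T) (n : ℕ)
    (h : ∀ r ≤ (n : ℝ), S ∩ Metric.closedBall ρ r = T ∩ Metric.closedBall ρ r) :
    localHausdorff ρ S T ≤
      ∫⁻ r in Ioi (n : ℝ), ENNReal.ofReal r * ENNReal.ofReal (Real.exp (-r)) := by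
  have hle : ∀ r ∈ Ioi (0 : ℝ),
      Metric.hausdorffEDist (S ∩ Metric.closedBall ρ r) (T ∩ Metric.closedBall ρ r) *
        ENNReal.ofReal (Real.exp (-r)) ≤ (Ioi (n : ℝ)).indicator
          (fun r => ENNReal.ofReal r * ENNReal.ofReal (Real.exp (-r))) r := by
    intro r hr
    by_cases hrn : r ≤ n
    · rw [h r hrn, Metric.hausdorffEDist_self, zero_mul]
      exact zero_le
    · rw [indicator_of_mem (show r ∈ Ioi (n : ℝ) from not_le.1 hrn)]
      gcongr
      have hr0 : (0 : ℝ) ≤ r := le_of_lt hr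
      have hρ : ρ ∈ Metric.closedBall ρ r := Metric.mem_closedBall_self hr0
      have hb : ∀ x ∈ Metric.closedBall ρ r, edist x ρ ≤ ENNReal.ofReal r := fun x hx => by
        rw [edist_dist]
        exact ENNReal.ofReal_le_ofReal hx
      exact Metric.hausdorffEDist_le_of_mem_edist (fun x hx => ⟨ρ, ⟨hT, hρ⟩, hb x hx.2⟩)
        (fun x hx => ⟨ρ, ⟨hS, hρ⟩, hb x hx.2⟩)
  rw [localHausdorff]
  refine (setLIntegral_mono' measurableSet_Ioi hle).trans ?_
  refine (setLIntegral_le_lintegral _ _).trans ?_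
  rw [lintegral_indicator measurableSet_Ioi]

theorem tendsto_tail_lintegral :
    Tendsto (fun n : ℕ => ∫⁻ r in Ioi (n : ℝ), ENNReal.ofReal r * ENNReal.ofReal (Real.exp (-r)))
      atTop (𝓝 0) := by
  set g : ℝ → ℝ≥0∞ := fun r => ENNReal.ofReal r * ENNReal.ofReal (Real.exp (-r)) with hg
  have hfin : ∫⁻ r in Ioi (0 : ℝ), g r ≠ ∞ := by
    -- The integral of `r * exp (-r)` over the half-line is `Γ(2)`.
    have h1 := (Real.GammaIntegral_convergent (s := 2) two_pos)
    have h2 : ∫⁻ r in Ioi (0 : ℝ), g r ≤ ∫⁻ r in Ioi (0 : ℝ),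
        ‖Real.exp (-r) * r ^ ((2 : ℝ) - 1)‖ₑ := by
      refine setLIntegral_mono' measurableSet_Ioi fun r hr => ?_
      have hr0 : (0 : ℝ) ≤ r := le_of_lt hr
      simp only [hg]
      rw [← ENNReal.ofReal_mul hr0, Real.enorm_eq_ofReal_abs,
        show (2 : ℝ) - 1 = 1 by norm_num, Real.rpow_one, mul_comm]
      exact ENNReal.ofReal_le_ofReal (le_abs_self _)
    exact ne_top_of_le_ne_top h1.2.ne h2
  have hlim := tendsto_measure_iInter_atTop (μ := volume.withDensity g)
    (s := fun n : ℕ => Ioi (n : ℝ)) (fun n => measurableSet_Ioi.nullMeasurableSet)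
    (fun m n hmn => Ioi_subset_Ioi (by exact_mod_cast hmn))
    ⟨0, by rw [withDensity_apply _ measurableSet_Ioi, Nat.cast_zero]; exact hfin⟩
  have hempty : ⋂ n : ℕ, Ioi (n : ℝ) = ∅ := by
    refine eq_empty_of_forall_notMem fun x hx => ?_
    obtain ⟨n, hn⟩ := exists_nat_ge x
    exact absurd (mem_iInter.1 hx n) (not_lt.2 hn)
  rw [hempty, measure_empty] at hlim
  refine hlim.congr fun n => ?_
  simp only [Function.comp, withDensity_apply _ measurableSet_Ioi]

variable {W : Set (List ℕ)} {φ : wordTree W → X}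

theorem pruneWords_antitone (W : Set (List ℕ)) (M : List ℕ → ℝ≥0∞) : Antitone (pruneWords W M) :=
  fun _ _ h _ hu => ⟨hu.1, fun v i hv hvu => lt_of_le_of_lt h (hu.2 v i hv hvu)⟩

/-- Inside the ball of radius `n` only the finitely many marks of words of length at most `n`
matter, and `θ < M u` is an open condition on `θ`. For `θ'` slightly larger than `θ` the two trees
coincide in this ball, and the rest is bounded by the tail integral. -/
theorem tendsto_localHausdorff_pruneWords (hW : PrefixClosed W) (hfin : LocallyFiniteWords W)
    (hφ : Isometry φ) (M : List ℕ → ℝ≥0∞) (θ : ℝ≥0) :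
    Tendsto (fun θ' : ℝ≥0 => localHausdorff (φ ⟨0, zero_mem_wordTree W⟩)
      (subTree φ (pruneWords W M θ')) (subTree φ (pruneWords W M θ))) (𝓝[≥] θ) (𝓝 0) := by
  rw [ENNReal.tendsto_nhds_zero]
  intro ε hε
  obtain ⟨n, hn⟩ := ((ENNReal.tendsto_nhds_zero.1 tendsto_tail_lintegral) ε hε).exists
  have hev : ∀ᶠ θ' : ℝ≥0 in 𝓝[≥] θ, ∀ u ∈ {u ∈ W | u.length ≤ n}, (θ : ℝ≥0∞) < M u →
      (θ' : ℝ≥0∞) < M u := by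
    refine nhdsWithin_le_nhds ((Filter.eventually_all_finite (hfin n)).2 fun u _ => ?_)
    by_cases hu : (θ : ℝ≥0∞) < M u
    · filter_upwards [ENNReal.continuous_coe.continuousAt.eventually (isOpen_Iio.mem_nhds hu)] with _ h _
      exact h
    · exact Eventually.of_forall fun _ h => absurd h hu
  filter_upwards [hev, self_mem_nhdsWithin] with θ' hθ' hle
  refine (localHausdorff_le (root_mem_subTree φ _) (root_mem_subTree φ _) n
    fun r hr => Subset.antisymm ?_ ?_).trans hn
  · exact inter_subset_inter_left _
      (subTree_mono φ (pruneWords_antitone W M (ENNReal.coe_le_coe.2 hle)))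
  · rintro _ ⟨⟨a, ha, rfl⟩, hb⟩
    refine ⟨⟨a, ?_, rfl⟩, hb⟩
    rw [Metric.mem_closedBall, hφ.dist_eq, Subtype.dist_eq, dist_comm] at hb
    obtain h0 | ⟨v, i, s, hv, hs, hs1, has⟩ := exists_edgePoint_of_mem (hW.pruneWords M θ) ha
    · rw [mem_ofPred_eq, h0]; exact zero_mem_wordTree _
    · rw [mem_ofPred_eq, has]
      refine edgePoint_mem ⟨hv.1, fun u j hu hju => hθ' u ⟨?_, ?_⟩ (hv.2 u j hu hju)⟩ ⟨hs.le, hs1⟩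
      · exact hW ((List.prefix_append _ _).trans hju) hv.1
      -- Only ancestors that have a child below the point are relevant, so their length is at most
      -- `v.length < n`.
      · rw [has, dist_zero_edgePoint ⟨hs.le, hs1⟩] at hb
        have h1 : (v.length : ℝ) < n := by linarith
        have h2 : v.length < n := by exact_mod_cast h1
        have h3 := hju.length_le
        simp only [List.length_append, List.length_singleton] at h3
        omega

theorem isPruningProcess_prune (hW : PrefixClosed W) (hfin : LocallyFiniteWords W)
    (hφ : Isometry φ) {Θ : X → ℝ≥0∞} {M : List ℕ → ℝ≥0∞} (hM : MarkedBy φ Θ M)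
    (h0 : prune (φ ⟨0, zero_mem_wordTree W⟩) (range φ) Θ 0 = range φ) :
    IsPruningProcess (φ ⟨0, zero_mem_wordTree W⟩) (range φ)
      (fun θ => prune (φ ⟨0, zero_mem_wordTree W⟩) (range φ) Θ θ) where
  tree θ := by
    rw [prune_range_eq hW hfin hφ hM]
    exact isRootedRealTree_subTree hφ hfin (pruneWords_subset W M θ) (hW.pruneWords M θ)
  start := h0
  decreasing θ θ' h := by
    simp only [prune_range_eq hW hfin hφ hM]
    exact subTree_mono φ (pruneWords_antitone W M (ENNReal.coe_le_coe.2 h))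
  rightContinuous θ := by
    simp only [prune_range_eq hW hfin hφ hM]
    exact tendsto_localHausdorff_pruneWords hW hfin hφ M θ

theorem pruneWords_inter {W W' : Set (List ℕ)} (h : W' ⊆ W) (M : List ℕ → ℝ≥0∞) (θ : ℝ≥0∞) :
    pruneWords W M θ ∩ W' = pruneWords W' M θ := by
  ext u
  exact ⟨fun hu => ⟨hu.2, hu.1.2⟩, fun hu => ⟨⟨h hu.1, hu.2⟩, hu.1⟩⟩

/-- Pruning commutes with erasure. -/
theorem prune_inter_erase (hW : PrefixClosed W) (hfin : LocallyFiniteWords W)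
    (hφ : Isometry φ) {Θ : X → ℝ≥0∞} {M : List ℕ → ℝ≥0∞} (hM : MarkedBy φ Θ M) (h : ℕ)
    (θ : ℝ≥0) :
    prune (φ ⟨0, zero_mem_wordTree W⟩) (range φ) Θ θ ∩
        erase (φ ⟨0, zero_mem_wordTree W⟩) h (range φ) =
      prune (φ ⟨0, zero_mem_wordTree W⟩) (erase (φ ⟨0, zero_mem_wordTree W⟩) h (range φ)) Θ θ := by
  rw [erase_range_eq hW hφ, prune_range_eq hW hfin hφ hM,
    subTree_inter hφ (hW.pruneWords M θ) (hW.eraseWords h),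
    -- The condition that defines `pruneWords` looks only at the prefixes of a word and at their
    -- marks, so it is unaffected by shrinking the set of words.
    pruneWords_inter (eraseWords_subset h W), subTree_eq_range (eraseWords_subset h W)]
  have := prune_range_eq (hW.eraseWords h) (hfin.mono (eraseWords_subset h W))
    (isometry_comp_inclusion hφ (eraseWords_subset h W))
    (hM.comp_inclusion (eraseWords_subset h W)) θ
  refine Eq.trans ?_ this.symm
  ext x
  constructor
  · rintro ⟨a, ha, rfl⟩
    exact ⟨⟨a, wordTree_mono (pruneWords_subset _ M θ) ha⟩, ha, rfl⟩
  · rintro ⟨a, ha, rfl⟩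
    exact ⟨_, ha, rfl⟩

end PruningProcess

/-! ### Coded forests -/

section Coding

/-- The child numbers of a marked forest. -/
def kids (k : MarkedForest) : Forest := fun u => (k u).1

theorem prefixClosed_individuals (k : Forest) : PrefixClosed (individuals k) :=
  fun _ _ huv hv w i hw => hv w i (hw.trans huv)

theorem concat_mem_individuals {k : Forest} {u : List ℕ} {i : ℕ} :
    u ++ [i] ∈ individuals k ↔ u ∈ individuals k ∧ i < k u := by
  constructor
  · intro h
    exact ⟨prefixClosed_individuals k (List.prefix_append _ _) h, h u i List.prefix_rfl⟩
  · rintro ⟨h, hi⟩ v j hvj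
    obtain h1 | h1 := prefix_concat_iff.1 hvj
    · obtain ⟨rfl, h2⟩ := List.append_inj' h1 rfl
      obtain rfl : j = i := by simpa using h2
      exact hi
    · exact h v j h1

theorem nil_mem_individuals (k : Forest) : [] ∈ individuals k := fun v i h => by simp at h

theorem exists_concat_mem_individuals_iff {k : Forest} {u : List ℕ} :
    (∃ i, u ++ [i] ∈ individuals k) ↔ u ∈ individuals k ∧ k u ≠ 0 := by
  simp only [concat_mem_individuals, exists_and_left, and_congr_right_iff]
  exact fun _ => ⟨fun ⟨i, hi⟩ => by omega, fun h => ⟨0, Nat.pos_of_ne_zero h⟩⟩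

theorem locallyFiniteWords_individuals (k : Forest) : LocallyFiniteWords (individuals k) := by
  intro n
  induction n with
  | zero =>
    refine (finite_singleton []).subset fun u hu => ?_
    simpa using hu.2
  | succ n ih =>
    refine ((finite_singleton []).union (ih.biUnion (t := fun u => (fun i => u ++ [i]) '' Iio (k u))
      fun u _ => (finite_Iio _).image _)).subset fun u hu => ?_
    obtain rfl | ⟨v, i, rfl⟩ := List.eq_nil_or_concat' u
    · exact Or.inl rfl
    · obtain ⟨h1, h2⟩ := concat_mem_individuals.1 hu.1
      refine Or.inr (mem_iUnion₂.2 ⟨v, ⟨h1, ?_⟩, i, h2, rfl⟩)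
      have := hu.2
      simp only [List.length_append, List.length_singleton] at this
      omega

theorem markedBy_congr {X : Type*} {W : Set (List ℕ)} {φ : wordTree W → X} {Θ : X → ℝ≥0∞}
    {M M' : List ℕ → ℝ≥0∞} (h : ∀ u, u ≠ [] → (∃ i, u ++ [i] ∈ W) → M u = M' u) :
    MarkedBy φ Θ M ↔ MarkedBy φ Θ M' := by
  refine forall_congr' fun a => forall_congr' fun u => forall_congr' fun hu =>
    forall_congr' fun hi => ?_
  rw [h u hu hi]

variable {X : Type*} [MetricSpace X]

theorem isCodedBy_iff {ρ : X} {F : Set X} {k : Forest} :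
    IsCodedBy ρ F k ↔ ∃ φ : wordTree (individuals k) → X, Isometry φ ∧ range φ = F ∧
      φ ⟨0, zero_mem_wordTree _⟩ = ρ := by
  unfold IsCodedBy
  rw [realForest_eq_wordTree]
  refine exists_congr fun φ => and_congr_right fun _ => and_congr_right fun _ =>
    ⟨fun h => h _ rfl, fun h x hx => ?_⟩
  rw [← h]
  exact congrArg φ (Subtype.ext hx)

theorem isMarkedCodedBy_iff {ρ : X} {F : Set X} {Θ : X → ℝ≥0∞} {k : MarkedForest} :
    IsMarkedCodedBy ρ F Θ k ↔ ∃ φ : wordTree (individuals (kids k)) → X, Isometry φ ∧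
      range φ = F ∧ φ ⟨0, zero_mem_wordTree _⟩ = ρ ∧ MarkedBy φ Θ fun u => (k u).2 := by
  unfold IsMarkedCodedBy
  rw [realForest_eq_wordTree]
  refine exists_congr fun φ => and_congr_right fun _ => and_congr_right fun _ =>
    and_congr ⟨fun h => h _ rfl, fun h x hx => ?_⟩ ?_
  · rw [← h]
    exact congrArg φ (Subtype.ext hx)
  · constructor
    · intro h a u hu hi ha
      have := exists_concat_mem_individuals_iff.1 hi
      exact h a u this.1 hu this.2 ha
    · intro h a u hu hu0 hk ha
      exact h a u hu0 (exists_concat_mem_individuals_iff.2 ⟨hu, hk⟩) ha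

/-- Membership of a word depends only on the child numbers of its proper prefixes, so agreement on
common individuals propagates from one generation to the next. -/
theorem inForest_congr {k k' : Forest} (h : ∀ u, InForest k u → InForest k' u → k u = k' u)
    (u : List ℕ) : InForest k u ↔ InForest k' u := by
  induction u using List.reverseRecOn with
  | nil => exact ⟨fun _ => nil_mem_individuals k', fun _ => nil_mem_individuals k⟩
  | append_singleton v i ih =>
    change v ++ [i] ∈ individuals k ↔ v ++ [i] ∈ individuals k'
    rw [concat_mem_individuals, concat_mem_individuals]
    constructor
    · rintro ⟨h1, h2⟩
      exact ⟨ih.1 h1, h v h1 (ih.1 h1) ▸ h2⟩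
    · rintro ⟨h1, h2⟩
      exact ⟨ih.2 h1, (h v (ih.2 h1) h1).symm ▸ h2⟩

theorem inForest_trim (k : Forest) (u : List ℕ) : InForest (trim k) u ↔ InForest k u :=
  inForest_congr (fun u _ hu => by rw [trim, if_pos hu]) u

theorem individuals_trim (k : Forest) : individuals (trim k) = individuals k :=
  Set.ext (inForest_trim k)

theorem trimMarked_fst (k : MarkedForest) : kids (trimMarked k) = trim (kids k) := by
  funext u
  unfold kids trimMarked trim
  dsimp only
  split_ifs <;> rfl

theorem isCodedBy_trim {ρ : X} {F : Set X} {k : Forest} :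
    IsCodedBy ρ F (trim k) ↔ IsCodedBy ρ F k := by
  rw [isCodedBy_iff, isCodedBy_iff, individuals_trim]

theorem isMarkedCodedBy_trimMarked {ρ : X} {F : Set X} {Θ : X → ℝ≥0∞} {k : MarkedForest} :
    IsMarkedCodedBy ρ F Θ (trimMarked k) ↔ IsMarkedCodedBy ρ F Θ k := by
  rw [isMarkedCodedBy_iff, isMarkedCodedBy_iff, trimMarked_fst, individuals_trim]
  refine exists_congr fun φ => and_congr_right fun _ => and_congr_right fun _ =>
    and_congr_right fun _ => markedBy_congr fun u hu hi => ?_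
  obtain ⟨h1, h2⟩ := exists_concat_mem_individuals_iff.1 hi
  have h1' : InForest (fun v => (k v).1) u := h1
  have h2' : (k u).1 ≠ 0 := h2
  simp [trimMarked, h1', h2', hu]

theorem IsMarkedCodedBy.isCodedBy {ρ : X} {F : Set X} {Θ : X → ℝ≥0∞} {k : MarkedForest}
    (h : IsMarkedCodedBy ρ F Θ k) : IsCodedBy ρ F (kids k) := by
  obtain ⟨φ, h1, h2, h3, -⟩ := h
  exact ⟨φ, h1, h2, h3⟩

/-- Replace the child number of each individual other than the root by a function of its child
number and its mark. -/
def reproduce (f : ℕ × ℝ≥0∞ → ℕ) (k : MarkedForest) : Forest :=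
  fun u => if u = [] then (k u).1 else f (k u)

/-- Pruning is expressed as a modification of the offspring: an individual whose time has passed
stays in the tree but has no children. The root has no pruning time, so `reproduce` leaves it alone.
-/
theorem individuals_reproduce_prune (k : MarkedForest) (θ : ℝ≥0∞) :
    individuals (reproduce (fun a => if a.2 ≤ θ then 0 else a.1) k) =
      pruneWords (individuals (kids k)) (fun u => (k u).2) θ := by
  ext u
  induction u using List.reverseRecOn with
  | nil =>
    exact ⟨fun _ => ⟨nil_mem_individuals _, fun v i _ h => by simp at h⟩,
      fun _ => nil_mem_individuals _⟩
  | append_singleton v i ih =>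
    rw [concat_mem_individuals, ih]
    constructor
    · rintro ⟨⟨h1, h2⟩, h3⟩
      rw [reproduce] at h3
      by_cases hv : v = []
      · rw [if_pos hv] at h3
        refine ⟨concat_mem_individuals.2 ⟨h1, h3⟩, fun w j hw hwj => ?_⟩
        subst hv
        have h4 := hwj.length_le
        obtain ⟨a, w, rfl⟩ := List.exists_cons_of_ne_nil hw
        simp at h4
      · rw [if_neg hv] at h3
        split_ifs at h3 with h4
        · omega
        · refine ⟨concat_mem_individuals.2 ⟨h1, h3⟩, fun w j hw hwj => ?_⟩
          obtain h5 | h5 := prefix_concat_iff.1 hwj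
          · rw [(List.append_inj' h5 rfl).1]
            exact not_le.1 h4
          · exact h2 w j hw h5
    · rintro ⟨h1, h2⟩
      obtain ⟨h3, h4⟩ := concat_mem_individuals.1 h1
      refine ⟨⟨h3, fun w j hw hwj => h2 w j hw (hwj.trans (List.prefix_append _ _))⟩, ?_⟩
      rw [reproduce]
      split_ifs with hv hm
      · exact h4
      · exact absurd (h2 v i hv List.prefix_rfl) (not_lt.2 hm)
      · exact h4

theorem isCodedBy_range {W : Set (List ℕ)} {φ : wordTree W → X} (hφ : Isometry φ) {k : Forest}
    (h : individuals k ⊆ W) :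
    IsCodedBy (φ ⟨0, zero_mem_wordTree W⟩) (subTree φ (individuals k)) k := by
  rw [isCodedBy_iff, subTree_eq_range h]
  exact ⟨_, isometry_comp_inclusion hφ h, rfl, rfl⟩

theorem IsMarkedCodedBy.prune {ρ : X} {F : Set X} {Θ : X → ℝ≥0∞} {k : MarkedForest}
    (h : IsMarkedCodedBy ρ F Θ k) (θ : ℝ≥0) :
    IsCodedBy ρ (prune ρ F Θ θ) (reproduce (fun a => if a.2 ≤ θ then 0 else a.1) k) := by
  obtain ⟨φ, hφ, rfl, rfl, hM⟩ := isMarkedCodedBy_iff.1 h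
  rw [prune_range_eq (prefixClosed_individuals _) (locallyFiniteWords_individuals _) hφ hM,
    ← individuals_reproduce_prune]
  refine isCodedBy_range hφ ?_
  rw [individuals_reproduce_prune]
  exact pruneWords_subset _ _ _

theorem IsMarkedCodedBy.isPruningProcess {ρ : X} {F : Set X} {Θ : X → ℝ≥0∞} {k : MarkedForest}
    (h : IsMarkedCodedBy ρ F Θ k) (h0 : GWPruning.prune ρ F Θ 0 = F) :
    IsPruningProcess ρ F (fun θ => GWPruning.prune ρ F Θ θ) := by
  obtain ⟨φ, hφ, rfl, rfl, hM⟩ := isMarkedCodedBy_iff.1 h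
  exact isPruningProcess_prune (prefixClosed_individuals _) (locallyFiniteWords_individuals _)
    hφ hM h0

theorem IsMarkedCodedBy.prune_inter_erase {ρ : X} {F : Set X} {Θ : X → ℝ≥0∞} {k : MarkedForest}
    (hk : IsMarkedCodedBy ρ F Θ k) (h : ℕ) (θ : ℝ≥0) :
    GWPruning.prune ρ F Θ θ ∩ erase ρ h F = GWPruning.prune ρ (erase ρ h F) Θ θ := by
  obtain ⟨φ, hφ, rfl, rfl, hM⟩ := isMarkedCodedBy_iff.1 hk
  exact GWPruning.prune_inter_erase (prefixClosed_individuals _)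
    (locallyFiniteWords_individuals _) hφ hM h θ

end Coding

/-! ### Relabelling of words -/

section Relabel

/-- An injective relabelling of words that preserves the root and the parent relation. -/
structure IsRelabelling (σ : List ℕ → List ℕ) : Prop where
  nil : σ [] = []
  concat : ∀ v i, ∃ j, σ (v ++ [i]) = σ v ++ [j]
  injective : Function.Injective σ

variable {σ : List ℕ → List ℕ}

theorem IsRelabelling.length (hσ : IsRelabelling σ) (u : List ℕ) : (σ u).length = u.length := by
  induction u using List.reverseRecOn with
  | nil => rw [hσ.nil]
  | append_singleton v i ih =>
    obtain ⟨j, hj⟩ := hσ.concat v i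
    simp [hj, ih]

theorem IsRelabelling.prefix (hσ : IsRelabelling σ) {u v : List ℕ} (h : u <+: v) : σ u <+: σ v := by
  induction v using List.reverseRecOn with
  | nil => rw [List.prefix_nil.1 h]
  | append_singleton v i ih =>
    obtain rfl | h := prefix_concat_iff.1 h
    · exact List.prefix_rfl
    · obtain ⟨j, hj⟩ := hσ.concat v i
      rw [hj]
      exact (ih h).trans (List.prefix_append _ _)

/-- A relabelling preserves length and prefixes, and a prefix is determined by its length. Hence the
range of a relabelling is closed under prefixes. -/
theorem IsRelabelling.eq_of_prefix (hσ : IsRelabelling σ) {w v : List ℕ} (h : w <+: σ v) :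
    w = σ (v.take w.length) := by
  have h1 := hσ.prefix (List.take_prefix w.length v)
  have h2 : w.length ≤ v.length := by rw [← hσ.length v]; exact h.length_le
  have h3 : (σ (v.take w.length)).length = w.length := by
    rw [hσ.length, List.length_take, min_eq_left h2]
  exact (List.prefix_of_prefix_length_le h h1 h3.ge).eq_of_length h3.symm

theorem IsRelabelling.prefix_iff (hσ : IsRelabelling σ) {u v : List ℕ} :
    σ u <+: σ v ↔ u <+: v := by
  refine ⟨fun h => ?_, hσ.prefix⟩
  rw [hσ.injective (hσ.eq_of_prefix h)]
  exact List.take_prefix _ _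

theorem IsRelabelling.eq_nil_iff (hσ : IsRelabelling σ) {u : List ℕ} : σ u = [] ↔ u = [] := by
  rw [← List.length_eq_zero_iff, hσ.length, List.length_eq_zero_iff]

theorem IsRelabelling.edgePoint_apply (hσ : IsRelabelling σ) {v : List ℕ} {i j : ℕ}
    (hj : σ (v ++ [i]) = σ v ++ [j]) (s : ℝ) (w : List ℕ) :
    edgePoint (σ v) j s (σ w) = edgePoint v i s w := by
  classical
  simp only [GWPruning.edgePoint_apply, ← hj, hσ.injective.eq_iff, hσ.prefix_iff, Ne,
    hσ.eq_nil_iff]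

theorem IsRelabelling.exists_image (hσ : IsRelabelling σ) {W W' : Set (List ℕ)}
    (hW : PrefixClosed W) (h : ∀ u ∈ W, σ u ∈ W') {a : EllOne} (ha : a ∈ wordTree W) :
    ∃ b ∈ wordTree W', (∀ w, b (σ w) = a w) ∧ ∀ w ∉ range σ, b w = 0 := by
  obtain rfl | ⟨v, i, s, hv, hs, hs1, rfl⟩ := exists_edgePoint_of_mem hW ha
  · exact ⟨0, zero_mem_wordTree W', fun _ => rfl, fun _ _ => rfl⟩
  · obtain ⟨j, hj⟩ := hσ.concat v i
    refine ⟨edgePoint (σ v) j s, edgePoint_mem (hj ▸ h _ hv) ⟨hs.le, hs1⟩,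
      hσ.edgePoint_apply hj s, fun w hw => ?_⟩
    by_contra hne
    have h1 := ((edgePoint_ne_zero_iff hs).1 hne).2
    rw [← hj] at h1
    exact hw ⟨_, (hσ.eq_of_prefix h1).symm⟩

/-- A relabelling of words induces an isometry of the real trees. -/
theorem IsRelabelling.exists_isometry (hσ : IsRelabelling σ) {W W' : Set (List ℕ)}
    (hW : PrefixClosed W) (hW' : PrefixClosed W') (h : σ '' W = W') :
    ∃ ψ : wordTree W → wordTree W', Isometry ψ ∧ Function.Surjective ψ ∧
      ψ ⟨0, zero_mem_wordTree W⟩ = ⟨0, zero_mem_wordTree W'⟩ ∧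
      ∀ (a : wordTree W) (u : List ℕ), (a : EllOne) = vertex u → (ψ a : EllOne) = vertex (σ u) := by
  have h' : ∀ u ∈ W, σ u ∈ W' := fun u hu => h ▸ mem_image_of_mem σ hu
  choose! g hgW hg hg0 using fun a (ha : a ∈ wordTree W) => hσ.exists_image hW h' ha
  -- The image of a point is supported on the range of `σ`, so it is determined by its coordinates
  -- there; this also makes the distance a reindexed sum.
  have huniq : ∀ {b b' : EllOne}, (∀ w, b (σ w) = b' (σ w)) → (∀ w ∉ range σ, b w = 0) →
      (∀ w ∉ range σ, b' w = 0) → b = b' := by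
    intro b b' h1 h2 h3
    ext w
    by_cases hw : w ∈ range σ
    · obtain ⟨w, rfl⟩ := hw
      exact h1 w
    · rw [h2 w hw, h3 w hw]
  have hprefix : ∀ {w u}, w <+: σ u → w ∈ range σ := fun hw => ⟨_, (hσ.eq_of_prefix hw).symm⟩
  have hvertex : ∀ a u, a ∈ wordTree W → a = vertex u → g a = vertex (σ u) := by
    rintro a u ha rfl
    refine huniq (fun w => ?_) (hg0 _ ha) fun w hw => ?_
    · classical
      simp only [hg _ ha, vertex_apply, hσ.prefix_iff, Ne, hσ.eq_nil_iff]
    · exact vertex_apply_of_not_prefix fun hc => hw (hprefix hc)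
  have hzero : g 0 = 0 := by
    have := hvertex 0 [] (zero_mem_wordTree W) vertex_nil.symm
    rwa [hσ.nil, vertex_nil] at this
  refine ⟨fun a => ⟨g a, hgW a a.2⟩, Isometry.of_dist_eq fun a b => ?_, fun b => ?_, ?_,
    fun a u ha => hvertex a u a.2 ha⟩
  · rw [Subtype.dist_eq, Subtype.dist_eq]
    have h1 := hasSum_dist (g a) (g b)
    rw [← hσ.injective.hasSum_iff] at h1
    · refine h1.unique ?_
      convert hasSum_dist (a : EllOne) b using 2 with w
      simp only [Function.comp, hg _ a.2, hg _ b.2]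
    · intro w hw
      rw [hg0 _ a.2 w hw, hg0 _ b.2 w hw, sub_self, abs_zero]
  · obtain h0 | ⟨v', i', s, hv, hs, hs1, hb⟩ := exists_edgePoint_of_mem hW' b.2
    · exact ⟨⟨0, zero_mem_wordTree W⟩, Subtype.ext (hzero.trans h0.symm)⟩
    · rw [← h] at hv
      obtain ⟨u, hu, hσu⟩ := hv
      obtain rfl | ⟨v, i, rfl⟩ := List.eq_nil_or_concat' u
      · rw [hσ.nil] at hσu
        simp at hσu
      · obtain ⟨j, hj⟩ := hσ.concat v i
        rw [hj] at hσu
        obtain ⟨h1, h2⟩ := List.append_inj' hσu rfl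
        obtain rfl : j = i' := by simpa using h2
        have hm := edgePoint_mem hu ⟨hs.le, hs1⟩
        refine ⟨⟨edgePoint v i s, hm⟩, Subtype.ext ?_⟩
        rw [hb]
        refine huniq (fun w => ?_) (hg0 _ hm) fun w hw => ?_
        · rw [hg _ hm, ← h1, hσ.edgePoint_apply hj]
        · by_contra hne
          have h3 := ((edgePoint_ne_zero_iff hs).1 hne).2
          rw [← h1, ← hj] at h3
          exact hw (hprefix h3)
  · exact Subtype.ext hzero

end Relabel

/-! ### Erasure of combinatorial forests -/

section EraseForest

/-- The descendants of the child `i` of the root. -/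
def branch {α : Type*} (i : ℕ) (k : List ℕ → α) : List ℕ → α := fun u => k (i :: u)

/-- The forest has individuals in generation `h`. -/
def Alive (h : ℕ) (k : Forest) : Prop := ∃ u, InForest k u ∧ u.length = h

open scoped Classical in
/-- The children of the root that have descendants in the generation `h` of their tree. -/
noncomputable def survivors (h : ℕ) (k : Forest) : Finset ℕ :=
  (Finset.range (k [])).filter fun i => Alive h (branch i k)

/-- An injective sequence that starts with the elements of `A` in increasing order. -/
def enum (A : Finset ℕ) (j : ℕ) : ℕ :=
  -- Indices beyond the cardinality are sent above every element of `A`, so that the sequence is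
  -- injective on all of `ℕ` and avoids `A` from there on.
  if hj : j < A.card then A.orderEmbOfFin rfl ⟨j, hj⟩ else A.sup id + 1 + j

theorem enum_mem_iff {A : Finset ℕ} {j : ℕ} : enum A j ∈ A ↔ j < A.card := by
  rw [enum]
  split_ifs with h
  · exact iff_of_true (Finset.orderEmbOfFin_mem _ _ _) h
  · refine iff_of_false (fun hm => ?_) h
    have : A.sup id + 1 + j ≤ A.sup id := Finset.le_sup (f := id) hm
    omega

theorem enum_injective (A : Finset ℕ) : Function.Injective (enum A) := by
  intro i j hij
  by_cases hi : i < A.card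
  · have hj : j < A.card := by rw [← enum_mem_iff, ← hij, enum_mem_iff]; exact hi
    rw [enum, enum, dif_pos hi, dif_pos hj] at hij
    simpa using hij
  · have hj : ¬ j < A.card := by rw [← enum_mem_iff, ← hij, enum_mem_iff]; exact hi
    rw [enum, enum, dif_neg hi, dif_neg hj] at hij
    omega

theorem exists_enum_eq {A : Finset ℕ} {i : ℕ} (hi : i ∈ A) : ∃ j, enum A j = i := by
  have : i ∈ Set.range (A.orderEmbOfFin rfl) := by rw [Finset.range_orderEmbOfFin]; exact hi
  obtain ⟨⟨j, hj⟩, h⟩ := this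
  exact ⟨j, by rw [enum, dif_pos hj]; exact h⟩

/-- The individual of `k` whose label after erasure is `u`. -/
noncomputable def relabel (h : ℕ) : List ℕ → Forest → List ℕ
  | [], _ => []
  | j :: u, k =>
    enum (survivors h k) j :: relabel h u (branch (enum (survivors h k) j) k)

/-- The child number and the mark of the individual with label `u` after erasure. -/
noncomputable def eraseVertex (h : ℕ) : List ℕ → MarkedForest → ℕ × ℝ≥0∞
  | [], k => ((survivors h (kids k)).card, (k []).2)
  | j :: u, k => eraseVertex h u (branch (enum (survivors h (kids k)) j) k)

/-- The forest of the individuals that have descendants `h` generations later. -/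
noncomputable def eraseForest (h : ℕ) (k : MarkedForest) : MarkedForest :=
  fun u => eraseVertex h u k

theorem isRelabelling_relabel (h : ℕ) (k : Forest) : IsRelabelling fun u => relabel h u k where
  nil := rfl
  concat v i := by
    induction v generalizing k with
    | nil => exact ⟨_, rfl⟩
    | cons j v ih =>
      obtain ⟨m, hm⟩ := ih (branch (enum (survivors h k) j) k)
      refine ⟨m, ?_⟩
      simp only [List.cons_append, relabel, hm]
  injective u := by
    induction u generalizing k with
    | nil =>
      intro v hv
      cases v with
      | nil => rfl
      | cons j v => simp [relabel] at hv
    | cons i u ih =>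
      intro v hv
      cases v with
      | nil => simp [relabel] at hv
      | cons j v =>
        simp only [relabel, List.cons.injEq] at hv
        obtain rfl := enum_injective _ hv.1
        rw [ih _ hv.2]

theorem eraseVertex_snd (h : ℕ) (u : List ℕ) (k : MarkedForest) :
    (eraseVertex h u k).2 = (k (relabel h u (kids k))).2 := by
  induction u generalizing k with
  | nil => rfl
  | cons j u ih => exact ih _

theorem cons_mem_individuals {k : Forest} {i : ℕ} {u : List ℕ} :
    i :: u ∈ individuals k ↔ i < k [] ∧ u ∈ individuals (branch i k) := by
  constructor
  · intro h
    exact ⟨h [] i (by simp), fun v j hv => h (i :: v) j (by simpa using hv)⟩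
  · rintro ⟨h1, h2⟩ v j hv
    cases v with
    | nil =>
      obtain rfl : j = i := by simpa using hv
      exact h1
    | cons a v =>
      simp only [List.cons_append, List.cons_prefix_cons] at hv
      obtain ⟨rfl, hv⟩ := hv
      exact h2 v j hv

theorem Alive.of_le {h : ℕ} {k : Forest} {u : List ℕ} (hu : u ∈ individuals k)
    (hl : h ≤ u.length) : Alive h k :=
  ⟨u.take h, prefixClosed_individuals k (List.take_prefix _ _) hu, by simpa using hl⟩

theorem mem_survivors {h : ℕ} {k : Forest} {i : ℕ} :
    i ∈ survivors h k ↔ i < k [] ∧ Alive h (branch i k) := by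
  simp [survivors]

theorem alive_succ_iff {h : ℕ} {k : Forest} : Alive (h + 1) k ↔ (survivors h k).Nonempty := by
  constructor
  · rintro ⟨u, hu, hl⟩
    obtain ⟨i, u, rfl⟩ := List.exists_cons_of_length_eq_add_one hl
    obtain ⟨h1, h2⟩ := cons_mem_individuals.1 hu
    exact ⟨i, mem_survivors.2 ⟨h1, u, h2, by simpa using hl⟩⟩
  · rintro ⟨i, hi⟩
    obtain ⟨h1, u, h2, hl⟩ := mem_survivors.1 hi
    exact ⟨i :: u, cons_mem_individuals.2 ⟨h1, h2⟩, by simp [hl]⟩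

theorem Alive.mono {h h' : ℕ} (hh : h ≤ h') {k : Forest} (hk : Alive h' k) : Alive h k := by
  obtain ⟨u, hu, hl⟩ := hk
  exact Alive.of_le hu (hh.trans hl.ge)

/-- Erasure recurses on the first letter. For `w = []` the witness on the right-hand side is a
descendant of the child `i` in generation `h` of its tree, which has length `h + 1` in the forest.
-/
theorem cons_mem_eraseWords {h : ℕ} {k : Forest} {i : ℕ} {w : List ℕ} :
    i :: w ∈ eraseWords h (individuals k) ↔
      i ∈ survivors h k ∧ w ∈ eraseWords h (individuals (branch i k)) := by
  constructor
  · rintro ⟨h1, h2⟩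
    obtain ⟨u', hu', hw, hl⟩ := h2.resolve_left (by simp)
    obtain ⟨t, rfl⟩ := hw
    rw [List.cons_append, cons_mem_individuals] at hu'
    simp only [List.cons_append, List.length_cons] at hl
    refine ⟨mem_survivors.2 ⟨hu'.1, Alive.of_le hu'.2 (by omega)⟩,
      (cons_mem_individuals.1 h1).2, Or.inr ⟨_, hu'.2, List.prefix_append _ _, by omega⟩⟩
  · rintro ⟨h1, h2, h3⟩
    obtain ⟨h4, u0, hu0, hl0⟩ := mem_survivors.1 h1
    refine ⟨cons_mem_individuals.2 ⟨h4, h2⟩, Or.inr ?_⟩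
    obtain rfl | ⟨u', hu', hw, hl⟩ := h3
    · exact ⟨i :: u0, cons_mem_individuals.2 ⟨h4, hu0⟩, by simp, by simp [hl0, add_comm]⟩
    · exact ⟨i :: u', cons_mem_individuals.2 ⟨h4, hu'⟩, by simpa using hw,
        by simp only [List.length_cons]; omega⟩

theorem nil_mem_eraseWords (h : ℕ) (k : Forest) : [] ∈ eraseWords h (individuals k) :=
  ⟨nil_mem_individuals k, Or.inl rfl⟩

/-- The surviving children have the ranks below the number of survivors, so a new label is an
individual exactly when the word it stands for survives erasure. -/
theorem relabel_mem_iff {h : ℕ} {u : List ℕ} {k : MarkedForest} :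
    relabel h u (kids k) ∈ eraseWords h (individuals (kids k)) ↔
      u ∈ individuals (kids (eraseForest h k)) := by
  induction u generalizing k with
  | nil => exact iff_of_true (nil_mem_eraseWords h _) (nil_mem_individuals _)
  | cons j u ih =>
    rw [relabel, cons_mem_eraseWords, enum_mem_iff, cons_mem_individuals]
    exact and_congr_right fun _ => ih (k := branch (enum (survivors h (kids k)) j) k)

theorem exists_relabel_eq {h : ℕ} {w : List ℕ} {k : Forest}
    (hw : w ∈ eraseWords h (individuals k)) : ∃ u, relabel h u k = w := by
  induction w generalizing k with
  | nil => exact ⟨[], rfl⟩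
  | cons i w ih =>
    obtain ⟨h1, h2⟩ := cons_mem_eraseWords.1 hw
    obtain ⟨j, rfl⟩ := exists_enum_eq h1
    obtain ⟨u, hu⟩ := ih h2
    exact ⟨j :: u, by rw [relabel, hu]⟩

theorem relabel_image (h : ℕ) (k : MarkedForest) :
    (fun u => relabel h u (kids k)) '' individuals (kids (eraseForest h k)) =
      eraseWords h (individuals (kids k)) := by
  ext w
  constructor
  · rintro ⟨u, hu, rfl⟩
    exact relabel_mem_iff.2 hu
  · intro hw
    obtain ⟨u, rfl⟩ := exists_relabel_eq hw
    exact ⟨u, relabel_mem_iff.1 hw, rfl⟩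

/-- Erasure of a coded marked forest. -/
theorem IsMarkedCodedBy.erase {X : Type*} [MetricSpace X] {ρ : X} {F : Set X} {Θ : X → ℝ≥0∞}
    {k : MarkedForest} (hk : IsMarkedCodedBy ρ F Θ k) (h : ℕ) :
    IsMarkedCodedBy ρ (erase ρ h F) Θ (eraseForest h k) := by
  obtain ⟨φ, hφ, rfl, rfl, hM⟩ := isMarkedCodedBy_iff.1 hk
  have hW := prefixClosed_individuals (kids k)
  have hσ := isRelabelling_relabel h (kids k)
  obtain ⟨ψ, h1, h2, h3, h4⟩ := hσ.exists_isometry (prefixClosed_individuals _)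
    (hW.eraseWords h) (relabel_image h k)
  have hsub := eraseWords_subset h (individuals (kids k))
  rw [isMarkedCodedBy_iff, erase_range_eq hW hφ, subTree_eq_range hsub]
  refine ⟨(φ ∘ inclusion (wordTree_mono hsub)) ∘ ψ, (isometry_comp_inclusion hφ hsub).comp h1,
    h2.range_comp _, ?_, ?_⟩
  · rw [Function.comp_apply, h3]
    rfl
  · intro a u hu hi ha
    refine (hM (inclusion (wordTree_mono hsub) (ψ a)) (relabel h u (kids k))
      (fun hc => hu (hσ.eq_nil_iff.1 hc)) ?_ (h4 a u ha)).trans (eraseVertex_snd h u k).symm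
    obtain ⟨i, hi⟩ := hi
    obtain ⟨j, hj⟩ := hσ.concat u i
    refine ⟨j, hsub ?_⟩
    rw [← relabel_image]
    exact ⟨_, hi, hj⟩

end EraseForest

/-! ### Null sets and couplings -/

section Coupling

/-- An almost sure property of a coupling is inherited by its image under a map of the second
coordinate, without any measurability of the property. -/
theorem ae_map_prodMap_of_imp {Ω E E' : Type*} [MeasurableSpace Ω] [MeasurableSpace E]
    [StandardBorelSpace E] [Nonempty E] [MeasurableSpace E'] [StandardBorelSpace E']
    {Q : Measure (Ω × E)} [IsFiniteMeasure Q] {f : E → E'} (hf : Measurable f)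
    {p : Ω × E → Prop} {p' : Ω × E' → Prop} (h : ∀ᵐ z ∂Q, p z)
    (himp : ∀ ω k, p (ω, k) → p' (ω, f k)) : ∀ᵐ z ∂Q.map (Prod.map id f), p' z := by
  obtain ⟨N, hN, hNm, hN0⟩ := exists_measurable_superset_of_null h
  -- The preimage `k` is kept as a third coordinate. For almost every `(ω, y)` the conditional law
  -- of `k` charges only points outside the null set `N` with `f k = y`, so a suitable `k` exists
  -- and no projection of a set has to be measurable.
  have hg : Measurable fun z : Ω × E => ((z.1, f z.2), z.2) := by fun_prop
  set Q' := Q.map fun z => ((z.1, f z.2), z.2) with hQ'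
  have hfst : Q'.fst = Q.map (Prod.map id f) := by
    rw [Measure.fst, hQ', Measure.map_map measurable_fst hg]
    rfl
  have hae : ∀ᵐ r ∂Q', (r.1.1, r.2) ∉ N ∧ f r.2 = r.1.2 := by
    rw [hQ', ae_map_iff hg.aemeasurable]
    · filter_upwards [measure_eq_zero_iff_ae_notMem.1 hN0] with z hz
      exact ⟨hz, rfl⟩
    · refine MeasurableSet.inter ?_ ?_
      · exact (measurableSet_preimage (by fun_prop : Measurable
          fun r : (Ω × E') × E => (r.1.1, r.2)) hNm).compl
      · exact measurableSet_eq_fun (by fun_prop) (by fun_prop)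
  rw [← Q'.disintegrate Q'.condKernel] at hae
  rw [← hfst]
  filter_upwards [Measure.ae_ae_of_ae_compProd hae] with z hz
  obtain ⟨k, hk1, hk2⟩ := hz.exists
  have hp : p (z.1, k) := by
    by_contra hc
    exact hk1 (hN hc)
  have := himp z.1 k hp
  rwa [show f k = z.2 from hk2] at this

/-- Mapping the second coordinate to a point reduces this to `ae_map_prodMap_of_imp`. -/
theorem ae_of_ae_coupling {Ω E : Type*} [MeasurableSpace Ω] [MeasurableSpace E]
    [StandardBorelSpace E] [Nonempty E] {Q : Measure (Ω × E)} [IsFiniteMeasure Q]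
    {p : Ω × E → Prop} {p' : Ω → Prop} (h : ∀ᵐ z ∂Q, p z) (himp : ∀ ω k, p (ω, k) → p' ω) :
    ∀ᵐ ω ∂Q.map Prod.fst, p' ω := by
  have h1 := ae_map_prodMap_of_imp (p' := fun z : Ω × Unit => p' z.1)
    (measurable_const (a := ())) h himp
  have h2 : Q.map Prod.fst = (Q.map (Prod.map id fun _ => ())).map Prod.fst := by
    rw [Measure.map_map measurable_fst (by fun_prop)]
    rfl
  rw [h2, ae_iff]
  have h3 : Q.map (Prod.map id fun _ => ()) {z | ¬ p' z.1} = 0 := h1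
  obtain ⟨N, hN, hNm, hN0⟩ := exists_measurable_superset_of_null h3
  have hm : Measurable fun ω : Ω => (ω, ()) := by fun_prop
  refine measure_mono_null (t := (fun ω : Ω => (ω, ())) ⁻¹' N) (fun ω hω => hN hω) ?_
  rw [Measure.map_apply measurable_fst (hm hNm), ← hN0]
  rfl

end Coupling

/-! ### Independence of the branches -/

section Branches

variable {V : Type*} [MeasurableSpace V]

theorem measurable_branch (i : ℕ) : Measurable (branch i : (List ℕ → V) → List ℕ → V) :=
  measurable_pi_lambda _ fun _ => measurable_pi_apply _

/-- The root or a child of the root together with an individual below. -/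
def wordOfBlock : (Σ o : Option ℕ, o.elim Unit fun _ => List ℕ) → List ℕ
  | ⟨none, _⟩ => []
  | ⟨some i, u⟩ => i :: (show List ℕ from u)

theorem wordOfBlock_injective : Function.Injective wordOfBlock := by
  rintro ⟨_ | i, u⟩ ⟨_ | j, v⟩ h
  · rfl
  · simp [wordOfBlock] at h
  · simp [wordOfBlock] at h
  · obtain ⟨h1, h2⟩ := List.cons.inj h
    subst h1
    have h3 : u = v := h2
    rw [h3]

/-- The vertex data of the root and the branches at the root are independent. -/
theorem infinitePi_root_branches (ν : List ℕ → Measure V) [∀ u, IsProbabilityMeasure (ν u)]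
    (ν₁ : Measure V) [IsProbabilityMeasure ν₁] (hν : ∀ i u, ν (i :: u) = ν₁) {B : Set V}
    (hB : MeasurableSet B) (K : ℕ) {D : ℕ → Set (List ℕ → V)} (hD : ∀ i, MeasurableSet (D i)) :
    Measure.infinitePi ν {k | k [] ∈ B ∧ ∀ i < K, branch i k ∈ D i} =
      ν [] B * ∏ i ∈ Finset.range K, Measure.infinitePi (fun _ : List ℕ => ν₁) (D i) := by
  -- Words are grouped into the block of the root and one block for each first letter, and currying
  -- the product over all words makes these blocks independent.
  have h1 := Measure.map_infinitePi_infinitePi_of_inj (P := ν) wordOfBlock_injective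
  have h2 := Measure.infinitePi_map_piCurry
    (fun (o : Option ℕ) (j : o.elim Unit fun _ => List ℕ) => ν (wordOfBlock ⟨o, j⟩))
  have hm : Measurable fun (k : List ℕ → V) (p : Σ o : Option ℕ, o.elim Unit fun _ => List ℕ) =>
      k (wordOfBlock p) := by fun_prop
  have h3 : (Measure.infinitePi ν).map (fun k (o : Option ℕ)
      (j : o.elim Unit fun _ => List ℕ) => k (wordOfBlock ⟨o, j⟩)) =
      Measure.infinitePi fun o : Option ℕ => Measure.infinitePi
        fun j : o.elim Unit fun _ => List ℕ => ν (wordOfBlock ⟨o, j⟩) := by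
    rw [← h2, ← h1, Measure.map_map (MeasurableEquiv.measurable _) hm]
    rfl
  let t : (o : Option ℕ) → Set ((o.elim Unit fun _ => List ℕ) → V)
    | none => {g | g () ∈ B}
    | some i => D i
  have ht : ∀ o, MeasurableSet (t o) := by
    rintro (_ | i)
    · exact (measurable_pi_apply (X := fun _ : Unit => V) ()) hB
    · exact hD i
  have h4 : {k : List ℕ → V | k [] ∈ B ∧ ∀ i < K, branch i k ∈ D i} =
      (fun k (o : Option ℕ) (j : o.elim Unit fun _ => List ℕ) => k (wordOfBlock ⟨o, j⟩)) ⁻¹'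
        Set.pi (Finset.insertNone (Finset.range K) : Finset (Option ℕ)) t := by
    ext k
    simp only [mem_ofPred_eq, mem_preimage, Set.mem_pi, Finset.mem_coe, Option.forall,
      Finset.none_mem_insertNone, true_implies, Finset.some_mem_insertNone, Finset.mem_range]
    rfl
  have hm' : Measurable fun (k : List ℕ → V) (o : Option ℕ)
      (j : o.elim Unit fun _ => List ℕ) => k (wordOfBlock ⟨o, j⟩) := by fun_prop
  rw [h4, ← Measure.map_apply hm' (MeasurableSet.pi (Finset.countable_toSet _) fun o _ => ht o), h3,
    Measure.infinitePi_pi _ fun o _ => ht o, Finset.prod_insertNone]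
  congr 1
  · have := congrArg (fun m => m B) (Measure.infinitePi_map_eval
      (fun j : (none : Option ℕ).elim Unit fun _ => List ℕ => ν (wordOfBlock ⟨none, j⟩)) ())
    rw [← show _ = ν [] B from this]
    exact (Measure.map_apply (measurable_pi_apply (X := fun _ : Unit => V) ()) hB).symm
  · refine Finset.prod_congr rfl fun i _ => ?_
    have : (fun j : (some i : Option ℕ).elim Unit fun _ => List ℕ => ν (wordOfBlock ⟨some i, j⟩)) =
        fun _ : List ℕ => ν₁ := funext fun j => hν i j
    simp only [this]
    rfl

theorem measurable_kids : Measurable kids :=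
  measurable_pi_lambda _ fun u => measurable_fst.comp (measurable_pi_apply u)

theorem measurableSet_alive (h : ℕ) : MeasurableSet {k : Forest | Alive h k} := by
  have : {k : Forest | Alive h k} =
      ⋃ u : List ℕ, {k : Forest | InForest k u} ∩ {_k | u.length = h} := by
    ext k; simp [Alive]
  rw [this]
  exact MeasurableSet.iUnion fun u => (measurableSet_inForest u).inter (MeasurableSet.const _)

theorem measurableSet_survivors_eq (h : ℕ) (A : Finset ℕ) :
    MeasurableSet {k : Forest | survivors h k = A} := by
  have : {k : Forest | survivors h k = A} =
      ⋂ i : ℕ, {k : Forest | (i < k [] ∧ Alive h (branch i k)) ↔ i ∈ A} := by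
    ext k
    simp only [mem_ofPred_eq, mem_iInter, Finset.ext_iff, mem_survivors]
  rw [this]
  refine MeasurableSet.iInter fun i => ?_
  have hm : MeasurableSet {k : Forest | i < k [] ∧ Alive h (branch i k)} :=
    (measurableSet_lt measurable_const (measurable_pi_apply _)).inter
      (measurable_branch i (measurableSet_alive h))
  by_cases hi : i ∈ A
  · simpa only [hi, iff_true] using hm
  · simp only [hi, iff_false]
    exact hm.compl

/-- There are only countably many finite sets of survivors, so a function that depends on this set
may be measured piece by piece. -/
theorem measurable_comp_survivors {α β : Type*} [MeasurableSpace α] [MeasurableSpace β] (h : ℕ)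
    {g : α → Forest} (hg : Measurable g) {f : Finset ℕ → α → β} (hf : ∀ A, Measurable (f A)) :
    Measurable fun a => f (survivors h (g a)) a := by
  intro s hs
  have : (fun a => f (survivors h (g a)) a) ⁻¹' s =
      ⋃ A : Finset ℕ, g ⁻¹' {k | survivors h k = A} ∩ f A ⁻¹' s := by
    ext a; simp
  rw [this]
  exact MeasurableSet.iUnion fun A => (hg (measurableSet_survivors_eq h A)).inter (hf A hs)

theorem measurable_eraseVertex (h : ℕ) (u : List ℕ) : Measurable (eraseVertex h u) := by
  induction u with
  | nil =>
    exact (measurable_comp_survivors h measurable_kids (f := fun A _ => A.card)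
      fun _ => measurable_const).prodMk (measurable_snd.comp (measurable_pi_apply _))
  | cons j u ih =>
    exact measurable_comp_survivors h measurable_kids
      (f := fun A k => eraseVertex h u (branch (enum A j) k))
      fun A => ih.comp (measurable_branch _)

theorem measurable_eraseForest (h : ℕ) : Measurable (eraseForest h) :=
  measurable_pi_lambda _ (measurable_eraseVertex h)

end Branches

/-! ### Thinning -/

section Thinning

theorem measure_eq_tsum_inter_fiber {α : Type*} [MeasurableSpace α] (μ : Measure α) {E : Set α}
    (hE : MeasurableSet E) {N : α → ℕ} (hN : Measurable N) :
    μ E = ∑' m, μ (E ∩ {a | N a = m}) := by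
  rw [← measure_iUnion]
  · congr 1
    ext a; simp
  · intro i j hij
    rw [Function.onFun, Set.disjoint_left]
    rintro a ⟨-, h1⟩ ⟨-, h2⟩
    exact hij (h1.symm.trans h2)
  · exact fun m => hE.inter (hN (measurableSet_singleton m))

theorem prod_enum (A : Finset ℕ) (f : ℕ → ℝ≥0∞) :
    ∏ i ∈ A, f i = ∏ j ∈ Finset.range A.card, f (enum A j) := by
  symm
  refine Finset.prod_nbij (enum A) (fun j hj => enum_mem_iff.2 (Finset.mem_range.1 hj))
    (enum_injective A).injOn (fun i hi => ?_) fun _ _ => rfl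
  obtain ⟨j, rfl⟩ := exists_enum_eq hi
  exact ⟨j, by simpa using enum_mem_iff.1 hi, rfl⟩

/-- The marked forests with individuals in generation `h`. -/
def aliveSet (h : ℕ) : Set MarkedForest := {k | Alive h (kids k)}

theorem measurableSet_aliveSet (h : ℕ) : MeasurableSet (aliveSet h) :=
  measurable_kids (measurableSet_alive h)

/-- The branch `i` survives if and only if `i ∈ A`, and then it belongs to `D j` for its rank `j`. -/
def rankedSet (h : ℕ) (A : Finset ℕ) (D : ℕ → Set MarkedForest) (i : ℕ) : Set MarkedForest :=
  {t | (Alive h (kids t) ↔ i ∈ A) ∧ ∀ j < A.card, enum A j = i → t ∈ D j}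

theorem rankedSet_of_notMem {h : ℕ} {A : Finset ℕ} {D : ℕ → Set MarkedForest} {i : ℕ}
    (hi : i ∉ A) : rankedSet h A D i = (aliveSet h)ᶜ := by
  ext t
  simp only [rankedSet, hi, iff_false, mem_ofPred_eq, mem_compl_iff, aliveSet, and_iff_left_iff_imp]
  rintro - j hj rfl
  exact absurd (enum_mem_iff.2 hj) hi

theorem rankedSet_enum {h : ℕ} {A : Finset ℕ} {D : ℕ → Set MarkedForest} {j : ℕ}
    (hj : j < A.card) : rankedSet h A D (enum A j) = aliveSet h ∩ D j := by
  ext t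
  simp only [rankedSet, enum_mem_iff, hj, iff_true, mem_ofPred_eq, aliveSet, mem_inter_iff,
    and_congr_right_iff]
  refine fun _ => ⟨fun H => H j hj rfl, fun H i _ hij => ?_⟩
  rwa [enum_injective A hij]

theorem measurableSet_rankedSet {h : ℕ} {A : Finset ℕ} {D : ℕ → Set MarkedForest}
    (hD : ∀ j, MeasurableSet (D j)) (i : ℕ) : MeasurableSet (rankedSet h A D i) := by
  by_cases hi : i ∈ A
  · obtain ⟨j, rfl⟩ := exists_enum_eq hi
    rw [rankedSet_enum (enum_mem_iff.1 hi)]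
    exact (measurableSet_aliveSet h).inter (hD j)
  · rw [rankedSet_of_notMem hi]
    exact (measurableSet_aliveSet h).compl

theorem root_and_rankedSet_iff {h K : ℕ} {A : Finset ℕ} (hA : A ⊆ Finset.range K)
    {B : Set ℝ≥0∞} {D : ℕ → Set MarkedForest} {k : MarkedForest} :
    (k [] ∈ ({K} : Set ℕ) ×ˢ B ∧ ∀ i < K, branch i k ∈ rankedSet h A D i) ↔
      (k []).1 = K ∧ (k []).2 ∈ B ∧ survivors h (kids k) = A ∧
        ∀ j < A.card, branch (enum A j) k ∈ D j := by
  have hmem : ∀ i, i ∈ survivors h (kids k) ↔ i < (k []).1 ∧ Alive h (kids (branch i k)) :=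
    fun i => mem_survivors
  constructor
  · rintro ⟨⟨h1, h2⟩, h3⟩
    have h1' : (k []).1 = K := h1
    refine ⟨h1', h2, ?_, fun j hj => ?_⟩
    · ext i
      rw [hmem, h1']
      constructor
      · rintro ⟨hi, ha⟩
        exact (h3 i hi).1.1 ha
      · intro hi
        have hiK := Finset.mem_range.1 (hA hi)
        exact ⟨hiK, (h3 i hiK).1.2 hi⟩
    · exact (h3 _ (Finset.mem_range.1 (hA (enum_mem_iff.2 hj)))).2 j hj rfl
  · rintro ⟨h1, h2, h3, h4⟩
    refine ⟨⟨h1, h2⟩, fun i hi => ⟨?_, ?_⟩⟩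
    · rw [← h3, hmem, h1, and_iff_right hi]
    · rintro j hj rfl
      exact h4 j hj

/-- The law of the number of surviving branches at the root, together with the mark of the root and
the surviving branches. -/
theorem infinitePi_survivors (ν : List ℕ → Measure (ℕ × ℝ≥0∞)) [∀ u, IsProbabilityMeasure (ν u)]
    (ν₁ : Measure (ℕ × ℝ≥0∞)) [IsProbabilityMeasure ν₁] (hν : ∀ i u, ν (i :: u) = ν₁)
    (h m : ℕ) {B : Set ℝ≥0∞} (hB : MeasurableSet B) {D : ℕ → Set MarkedForest}
    (hD : ∀ j, MeasurableSet (D j)) :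
    Measure.infinitePi ν {k : MarkedForest | (survivors h (kids k)).card = m ∧ (k []).2 ∈ B ∧
        ∀ j < m, branch (enum (survivors h (kids k)) j) k ∈ D j} =
      ∑' K, ν [] ({K} ×ˢ B) * (K.choose m *
        Measure.infinitePi (fun _ : List ℕ => ν₁) (aliveSet h)ᶜ ^ (K - m) *
        ∏ j ∈ Finset.range m,
          Measure.infinitePi (fun _ : List ℕ => ν₁) (aliveSet h ∩ D j)) := by
  set Λ₁ := Measure.infinitePi (fun _ : List ℕ => ν₁) with hΛ
  -- For `A ⊆ {0, …, K - 1}`, `E K A` is the event that the root has `K` children and a mark in `B`,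
  -- that exactly the branches in `A` survive, and that the survivor of rank `j` lies in `D j`.
  let E : ℕ → Finset ℕ → Set MarkedForest := fun K A =>
    {k | k [] ∈ ({K} : Set ℕ) ×ˢ B ∧ ∀ i < K, branch i k ∈ rankedSet h A D i}
  have hEm : ∀ K A, MeasurableSet (E K A) := fun K A => by
    refine MeasurableSet.inter (measurable_pi_apply [] ((measurableSet_singleton K).prod hB)) ?_
    have : {k : MarkedForest | ∀ i < K, branch i k ∈ rankedSet h A D i} =
        ⋂ i : ℕ, ⋂ _ : i < K, {k : MarkedForest | branch i k ∈ rankedSet h A D i} := by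
      ext k; simp
    change MeasurableSet {k : MarkedForest | ∀ i < K, branch i k ∈ rankedSet h A D i}
    rw [this]
    exact MeasurableSet.iInter fun i => MeasurableSet.iInter fun _ =>
      measurable_branch i (measurableSet_rankedSet hD i)
  -- The probability depends on `A` only through its cardinality `m`, which produces the binomial
  -- coefficient below.
  have hE : ∀ K, ∀ A ∈ (Finset.range K).powersetCard m, Measure.infinitePi ν (E K A) =
      ν [] ({K} ×ˢ B) * (Λ₁ (aliveSet h)ᶜ ^ (K - m) *
        ∏ j ∈ Finset.range m, Λ₁ (aliveSet h ∩ D j)) := by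
    intro K A hA
    obtain ⟨hAK, hAm⟩ := Finset.mem_powersetCard.1 hA
    rw [infinitePi_root_branches ν ν₁ hν ((measurableSet_singleton K).prod hB) K
      (measurableSet_rankedSet hD), ← Finset.prod_sdiff hAK]
    congr 2
    · rw [Finset.prod_congr rfl fun i hi => by
        rw [rankedSet_of_notMem (Finset.mem_sdiff.1 hi).2], Finset.prod_const,
        Finset.card_sdiff_of_subset hAK, Finset.card_range, hAm]
    · rw [prod_enum A, hAm]
      refine Finset.prod_congr rfl fun j hj => ?_
      rw [rankedSet_enum (by rw [hAm]; exact Finset.mem_range.1 hj)]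
  have hset : {k : MarkedForest | (survivors h (kids k)).card = m ∧ (k []).2 ∈ B ∧
      ∀ j < m, branch (enum (survivors h (kids k)) j) k ∈ D j} =
      ⋃ K, ⋃ A ∈ (Finset.range K).powersetCard m, E K A := by
    ext k
    simp only [mem_iUnion]
    constructor
    · rintro ⟨h1, h2, h3⟩
      have hsub : survivors h (kids k) ⊆ Finset.range (k []).1 :=
        fun i hi => Finset.mem_range.2 (mem_survivors.1 hi).1
      refine ⟨(k []).1, survivors h (kids k), Finset.mem_powersetCard.2 ⟨hsub, h1⟩, ?_⟩
      exact (root_and_rankedSet_iff hsub).2 ⟨rfl, h2, rfl, by rw [h1]; exact h3⟩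
    · rintro ⟨K, A, hA, hk⟩
      obtain ⟨hAK, hAm⟩ := Finset.mem_powersetCard.1 hA
      obtain ⟨h1, h2, h3, h4⟩ := (root_and_rankedSet_iff hAK).1 hk
      exact ⟨by rw [h3, hAm], h2, by rw [h3, ← hAm]; exact h4⟩
  rw [hset, measure_iUnion]
  · refine tsum_congr fun K => ?_
    rw [measure_biUnion_finset]
    · rw [Finset.sum_congr rfl (hE K), Finset.sum_const, Finset.card_powersetCard,
        Finset.card_range, nsmul_eq_mul]
      ring
    · intro A hA A' hA' hne
      rw [Function.onFun, Set.disjoint_left]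
      intro k hk hk'
      have h1 := ((root_and_rankedSet_iff (Finset.mem_powersetCard.1 hA).1).1 hk).2.2.1
      have h2 := ((root_and_rankedSet_iff (Finset.mem_powersetCard.1 hA').1).1 hk').2.2.1
      exact hne (h1.symm.trans h2)
    · exact fun A _ => hEm K A
  · intro K K' hne
    rw [Function.onFun, Set.disjoint_left]
    intro k hk hk'
    simp only [mem_iUnion] at hk hk'
    obtain ⟨A, hA, hk⟩ := hk
    obtain ⟨A', hA', hk'⟩ := hk'
    have h1 := ((root_and_rankedSet_iff (Finset.mem_powersetCard.1 hA).1).1 hk).1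
    have h2 := ((root_and_rankedSet_iff (Finset.mem_powersetCard.1 hA').1).1 hk').1
    exact hne (h1.symm.trans h2)
  · exact fun K => Finset.measurableSet_biUnion _ fun A _ => hEm K A

end Thinning

/-! ### The law of the erased forest -/

section ErasedLaw

open scoped Classical in
/-- The marked tree with the data of words outside the tree forgotten; the mark of the root is
kept if it has children. -/
noncomputable def trimTree (k : MarkedForest) : MarkedForest := fun u =>
  if InForest (kids k) u then ((k u).1, if (k u).1 ≠ 0 then (k u).2 else ⊤) else (0, ⊤)

/-- The marked forest without individuals other than the root. -/
def emptyForest : MarkedForest := fun _ => (0, ⊤)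

/-- The marked forests whose data in the first `n` generations belong to the given sets. -/
def treeCylinder (n : ℕ) (s : List ℕ → Set (ℕ × ℝ≥0∞)) : Set MarkedForest :=
  {t | ∀ u, u.length < n → t u ∈ s u}

theorem mem_treeCylinder_succ {n : ℕ} {s : List ℕ → Set (ℕ × ℝ≥0∞)} {t : MarkedForest} :
    t ∈ treeCylinder (n + 1) s ↔
      t [] ∈ s [] ∧ ∀ i, branch i t ∈ treeCylinder n (branch i s) := by
  constructor
  · exact fun H => ⟨H [] (by simp), fun i u hu => H (i :: u) (by simpa using hu)⟩
  · rintro ⟨h1, h2⟩ u hu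
    cases u with
    | nil => exact h1
    | cons i u => exact h2 i u (by simpa using hu)

theorem branch_trimTree (k : MarkedForest) (i : ℕ) :
    branch i (trimTree k) = if i < (k []).1 then trimTree (branch i k) else emptyForest := by
  funext u
  have h1 : InForest (kids k) (i :: u) ↔ i < (k []).1 ∧ InForest (kids (branch i k)) u :=
    cons_mem_individuals
  change trimTree k (i :: u) = _
  by_cases hi : i < (k []).1
  · rw [if_pos hi]
    by_cases hu : InForest (kids (branch i k)) u
    · rw [trimTree, trimTree, if_pos hu, if_pos (h1.2 ⟨hi, hu⟩)]
      rfl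
    · rw [trimTree, trimTree, if_neg hu, if_neg fun hc => hu (h1.1 hc).2]
  · rw [if_neg hi, trimTree, if_neg fun hc => hi (h1.1 hc).1]
    rfl

theorem branch_trimMarked (k : MarkedForest) (i : ℕ) :
    branch i (trimMarked k) = if i < (k []).1 then trimTree (branch i k) else emptyForest := by
  rw [← branch_trimTree]
  funext u
  change trimMarked k (i :: u) = trimTree k (i :: u)
  by_cases hu : InForest (kids k) (i :: u)
  · have hu' : InForest (fun v => (k v).1) (i :: u) := hu
    rw [trimMarked, trimTree, if_pos hu, if_pos hu']
    simp
  · have hu' : ¬ InForest (fun v => (k v).1) (i :: u) := hu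
    rw [trimMarked, trimTree, if_neg hu, if_neg hu']

/-- Branches with index at least `m` are empty, so what a cylinder demands of them is a
deterministic condition that can be split off from the random part. -/
theorem mem_treeCylinder_of_branch {n m : ℕ} {s : List ℕ → Set (ℕ × ℝ≥0∞)} {t : MarkedForest}
    {τ : ℕ → MarkedForest} (ht : ∀ i, branch i t = if i < m then τ i else emptyForest) :
    t ∈ treeCylinder (n + 1) s ↔ (∀ i, m ≤ i → emptyForest ∈ treeCylinder n (branch i s)) ∧
      t [] ∈ s [] ∧ ∀ i < m, τ i ∈ treeCylinder n (branch i s) := by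
  rw [mem_treeCylinder_succ]
  constructor
  · rintro ⟨h1, h2⟩
    refine ⟨fun i hi => ?_, h1, fun i hi => ?_⟩
    · have := h2 i
      rwa [ht, if_neg (not_lt.2 hi)] at this
    · have := h2 i
      rwa [ht, if_pos hi] at this
  · rintro ⟨h1, h2, h3⟩
    refine ⟨h2, fun i => ?_⟩
    rw [ht]
    split_ifs with hi
    · exact h3 i hi
    · exact h1 i (not_lt.1 hi)

theorem trimTree_nil (k : MarkedForest) :
    trimTree k [] = ((k []).1, if (k []).1 ≠ 0 then (k []).2 else ⊤) := by
  have h : InForest (kids k) [] := nil_mem_individuals (kids k)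
  rw [trimTree, if_pos h]

theorem trimMarked_nil (k : MarkedForest) : trimMarked k [] = ((k []).1, ⊤) := by
  have h : InForest (fun v => (k v).1) [] := nil_mem_individuals (kids k)
  rw [trimMarked, if_pos h]
  simp

theorem measurable_trimTree : Measurable trimTree := by
  classical
  refine measurable_pi_lambda _ fun u => ?_
  have hu1 : Measurable fun k : MarkedForest => (k u).1 :=
    measurable_fst.comp (measurable_pi_apply u)
  have hu2 : Measurable fun k : MarkedForest => (k u).2 :=
    measurable_snd.comp (measurable_pi_apply u)
  refine Measurable.ite (measurable_kids (measurableSet_inForest u)) (hu1.prodMk ?_)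
    measurable_const
  exact Measurable.ite (hu1 (measurableSet_singleton 0)).compl hu2 measurable_const

theorem measurableSet_treeCylinder (n : ℕ) {s : List ℕ → Set (ℕ × ℝ≥0∞)}
    (hs : ∀ u, MeasurableSet (s u)) : MeasurableSet (treeCylinder n s) := by
  have : treeCylinder n s = ⋂ u : List ℕ, ⋂ _ : u.length < n, {t : MarkedForest | t u ∈ s u} := by
    ext t; simp [treeCylinder]
  rw [this]
  exact MeasurableSet.iInter fun u => MeasurableSet.iInter fun _ => measurable_pi_apply u (hs u)

theorem measurableSet_trimTree (n : ℕ) {s : List ℕ → Set (ℕ × ℝ≥0∞)}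
    (hs : ∀ u, MeasurableSet (s u)) : MeasurableSet {t | trimTree t ∈ treeCylinder n s} :=
  measurable_trimTree (measurableSet_treeCylinder n hs)

theorem measurableSet_trimTree_eraseForest (h n : ℕ) {s : List ℕ → Set (ℕ × ℝ≥0∞)}
    (hs : ∀ u, MeasurableSet (s u)) :
    MeasurableSet {t | trimTree (eraseForest h t) ∈ treeCylinder n s} :=
  measurable_eraseForest h (measurableSet_trimTree n hs)

theorem measurable_rootChildren : Measurable fun k : MarkedForest => (k []).1 :=
  measurable_fst.comp (measurable_pi_apply _)

theorem measurable_card_survivors (h : ℕ) :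
    Measurable fun k : MarkedForest => (survivors h (kids k)).card :=
  measurable_comp_survivors h measurable_kids (f := fun A _ => A.card) fun _ => measurable_const

theorem mem_aliveSet_of_card_ne_zero {h : ℕ} {k : MarkedForest}
    (hk : (survivors h (kids k)).card ≠ 0) : k ∈ aliveSet h :=
  Alive.mono (Nat.le_succ h) (alive_succ_iff.2 (Finset.card_ne_zero.1 hk))

theorem measurableSet_mark {s : Set (ℕ × ℝ≥0∞)} (hs : MeasurableSet s) (m : ℕ) :
    MeasurableSet {x | (m, x) ∈ s} := (measurable_const.prodMk measurable_id) hs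

theorem measure_and_eq {α : Type*} [MeasurableSpace α] (μ : Measure α) (C : Prop) [Decidable C]
    (p : α → Prop) : μ {a | C ∧ p a} = if C then μ {a | p a} else 0 := by
  split_ifs with h <;> simp [h]

/-- The law of the tree of a surviving individual after erasure. -/
theorem infinitePi_erased_treeCylinder (ν ν' : Measure (ℕ × ℝ≥0∞)) [IsProbabilityMeasure ν]
    [IsProbabilityMeasure ν'] (h : ℕ)
    (h0 : Measure.infinitePi (fun _ : List ℕ => ν) (aliveSet h) * ν' ({0} ×ˢ univ) =
      Measure.infinitePi (fun _ : List ℕ => ν)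
        (aliveSet h ∩ {k | (survivors h (kids k)).card = 0}))
    (h1 : ∀ m ≠ 0, ∀ B : Set ℝ≥0∞, MeasurableSet B →
      Measure.infinitePi (fun _ : List ℕ => ν) (aliveSet h) * ν' ({m} ×ˢ B) =
      ∑' K, ν ({K} ×ˢ B) * (K.choose m *
        Measure.infinitePi (fun _ : List ℕ => ν) (aliveSet h)ᶜ ^ (K - m) *
        Measure.infinitePi (fun _ : List ℕ => ν) (aliveSet h) ^ m))
    (n : ℕ) (s : List ℕ → Set (ℕ × ℝ≥0∞)) (hs : ∀ u, MeasurableSet (s u)) :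
    Measure.infinitePi (fun _ : List ℕ => ν)
        (aliveSet h ∩ {k | trimTree (eraseForest h k) ∈ treeCylinder n s}) =
      Measure.infinitePi (fun _ : List ℕ => ν) (aliveSet h) *
        Measure.infinitePi (fun _ : List ℕ => ν') {k | trimTree k ∈ treeCylinder n s} := by
  classical
  set Λ := Measure.infinitePi (fun _ : List ℕ => ν) with hΛ
  set Λ' := Measure.infinitePi (fun _ : List ℕ => ν') with hΛ'
  induction n generalizing s with
  | zero =>
    have : ∀ t : MarkedForest, t ∈ treeCylinder 0 s := fun t u hu => absurd hu (Nat.not_lt_zero _)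
    simp [this]
  | succ n ih =>
    have hm1 : MeasurableSet
        (aliveSet h ∩ {k | trimTree (eraseForest h k) ∈ treeCylinder (n + 1) s}) :=
      (measurableSet_aliveSet h).inter (measurableSet_trimTree_eraseForest h _ hs)
    have hm2 : MeasurableSet {k | trimTree k ∈ treeCylinder (n + 1) s} :=
      measurable_trimTree (measurableSet_treeCylinder _ hs)
    have hbs : ∀ i u, MeasurableSet (branch i s u) := fun i u => hs _
    rw [measure_eq_tsum_inter_fiber Λ hm1 (measurable_card_survivors h),
      measure_eq_tsum_inter_fiber Λ' hm2 measurable_rootChildren, ← ENNReal.tsum_mul_left]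
    refine tsum_congr fun m => ?_
    have hdec : ∀ k : MarkedForest, trimTree k ∈ treeCylinder (n + 1) s ↔
        (∀ i, (k []).1 ≤ i → emptyForest ∈ treeCylinder n (branch i s)) ∧ trimTree k [] ∈ s [] ∧
        ∀ i < (k []).1, trimTree (branch i k) ∈ treeCylinder n (branch i s) := fun k =>
      mem_treeCylinder_of_branch (branch_trimTree k)
    -- Without surviving branches the tree may or may not reach generation `h`, so `aliveSet h` must
    -- stay in the event; the mark is then trimmed to `⊤`. With a surviving branch the tree
    -- automatically reaches generation `h`, and the event factors over the branches.
    obtain rfl | hm := eq_or_ne m 0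
    · have e1 : (aliveSet h ∩ {k | trimTree (eraseForest h k) ∈ treeCylinder (n + 1) s}) ∩
          {k | (survivors h (kids k)).card = 0} =
          {k | ((∀ i, emptyForest ∈ treeCylinder n (branch i s)) ∧ ((0, ⊤) : ℕ × ℝ≥0∞) ∈ s []) ∧
            k ∈ aliveSet h ∩ {k | (survivors h (kids k)).card = 0}} := by
        ext k
        have hk0 : ((eraseForest h k) []).1 = (survivors h (kids k)).card := rfl
        simp only [mem_inter_iff, mem_ofPred_eq, hdec, trimTree_nil, hk0]
        constructor
        · rintro ⟨⟨ha, h2, h3, -⟩, h4⟩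
          rw [h4] at h2 h3
          exact ⟨⟨fun i => h2 i (Nat.zero_le i), by simpa using h3⟩, ha, h4⟩
        · rintro ⟨⟨h2, h3⟩, ha, h4⟩
          rw [h4]
          exact ⟨⟨ha, fun i _ => h2 i, by simpa using h3, fun i hi => absurd hi (Nat.not_lt_zero _)⟩,
            rfl⟩
      have e2 : {k | trimTree k ∈ treeCylinder (n + 1) s} ∩ {k | (k []).1 = 0} =
          {k | ((∀ i, emptyForest ∈ treeCylinder n (branch i s)) ∧ ((0, ⊤) : ℕ × ℝ≥0∞) ∈ s []) ∧
            k [] ∈ ({0} : Set ℕ) ×ˢ (univ : Set ℝ≥0∞)} := by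
        ext k
        simp only [mem_inter_iff, mem_ofPred_eq, hdec, trimTree_nil]
        constructor
        · rintro ⟨⟨h2, h3, -⟩, h4⟩
          rw [h4] at h2 h3
          exact ⟨⟨fun i => h2 i (Nat.zero_le i), by simpa using h3⟩, h4, mem_univ _⟩
        · rintro ⟨⟨h2, h3⟩, h4, -⟩
          rw [mem_singleton_iff.1 h4]
          exact ⟨⟨fun i _ => h2 i, by simpa using h3, fun i hi => absurd hi (Nat.not_lt_zero _)⟩,
            rfl⟩
      rw [e1, e2, measure_and_eq, measure_and_eq]
      split_ifs with hC
      · rw [show Λ' {k | k [] ∈ ({0} : Set ℕ) ×ˢ (univ : Set ℝ≥0∞)} = ν' ({0} ×ˢ univ) from ?_, h0]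
        · rfl
        · have hms : MeasurableSet (({0} : Set ℕ) ×ˢ (univ : Set ℝ≥0∞)) :=
            (measurableSet_singleton 0).prod MeasurableSet.univ
          rw [← (measurePreserving_eval_infinitePi (fun _ : List ℕ => ν') []).measure_preimage
            hms.nullMeasurableSet]
          rfl
      · rw [mul_zero]
    · have e1 : (aliveSet h ∩ {k | trimTree (eraseForest h k) ∈ treeCylinder (n + 1) s}) ∩
          {k | (survivors h (kids k)).card = m} =
          {k | (∀ i, m ≤ i → emptyForest ∈ treeCylinder n (branch i s)) ∧
            ((survivors h (kids k)).card = m ∧ (k []).2 ∈ {x | (m, x) ∈ s []} ∧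
              ∀ j < m, branch (enum (survivors h (kids k)) j) k ∈
                {t | trimTree (eraseForest h t) ∈ treeCylinder n (branch j s)})} := by
        ext k
        have hk0 : ((eraseForest h k) []).1 = (survivors h (kids k)).card := rfl
        have hk1 : ((eraseForest h k) []).2 = (k []).2 := rfl
        simp only [mem_inter_iff, mem_ofPred_eq, hdec, trimTree_nil, hk0, hk1]
        constructor
        · rintro ⟨⟨ha, h2, h3, h5⟩, h4⟩
          rw [h4] at h2 h3 h5
          rw [if_pos hm] at h3
          exact ⟨h2, h4, h3, h5⟩
        · rintro ⟨h2, h4, h3, h5⟩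
          refine ⟨⟨mem_aliveSet_of_card_ne_zero (by rw [h4]; exact hm), ?_⟩, h4⟩
          rw [h4, if_pos hm]
          exact ⟨h2, h3, h5⟩
      have e2 : {k | trimTree k ∈ treeCylinder (n + 1) s} ∩ {k | (k []).1 = m} =
          {k | (∀ i, m ≤ i → emptyForest ∈ treeCylinder n (branch i s)) ∧
            (k [] ∈ ({m} : Set ℕ) ×ˢ {x | (m, x) ∈ s []} ∧
              ∀ i < m, branch i k ∈ {t | trimTree t ∈ treeCylinder n (branch i s)})} := by
        ext k
        simp only [mem_inter_iff, mem_ofPred_eq, hdec, trimTree_nil]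
        constructor
        · rintro ⟨⟨h2, h3, h5⟩, h4⟩
          rw [h4] at h2 h3 h5
          rw [if_pos hm] at h3
          exact ⟨h2, ⟨h4, h3⟩, h5⟩
        · rintro ⟨h2, ⟨h4, h3⟩, h5⟩
          rw [mem_singleton_iff.1 h4, if_pos hm]
          exact ⟨⟨h2, h3, h5⟩, rfl⟩
      rw [e1, e2, measure_and_eq, measure_and_eq]
      split_ifs with hC
      · have hS := infinitePi_survivors (fun _ => ν) ν (fun _ _ => rfl) h m
          (measurableSet_mark (hs []) m)
          (fun j => measurableSet_trimTree_eraseForest h n (hbs j))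
        have hR := infinitePi_root_branches (fun _ => ν') ν' (fun _ _ => rfl)
            ((measurableSet_singleton m).prod (measurableSet_mark (hs []) m)) m
            (fun j => measurableSet_trimTree n (hbs j))
        rw [← hΛ] at hS
        rw [← hΛ'] at hR
        rw [hS, hR, ← mul_assoc, h1 m hm _ (measurableSet_mark (hs []) m),
          ← ENNReal.tsum_mul_right]
        refine tsum_congr fun K => ?_
        -- Each of the `m` surviving branches contributes one survival probability, and together
        -- they form the power that appears in `h1`.
        rw [Finset.prod_congr rfl fun j _ => ih (branch j s) (hbs j),
          Finset.prod_mul_distrib, Finset.prod_const, Finset.card_range]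
        ring
      · rw [mul_zero]

/-- The law of the forest after erasure. -/
theorem infinitePi_map_trimMarked_eraseForest (μ μ' : List ℕ → Measure (ℕ × ℝ≥0∞))
    [∀ u, IsProbabilityMeasure (μ u)] [∀ u, IsProbabilityMeasure (μ' u)]
    (ν ν' : Measure (ℕ × ℝ≥0∞)) [IsProbabilityMeasure ν] [IsProbabilityMeasure ν']
    (hμ : ∀ i u, μ (i :: u) = ν) (hμ' : ∀ i u, μ' (i :: u) = ν') (h : ℕ)
    (h0 : Measure.infinitePi (fun _ : List ℕ => ν) (aliveSet h) * ν' ({0} ×ˢ univ) =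
      Measure.infinitePi (fun _ : List ℕ => ν)
        (aliveSet h ∩ {k | (survivors h (kids k)).card = 0}))
    (h1 : ∀ m ≠ 0, ∀ B : Set ℝ≥0∞, MeasurableSet B →
      Measure.infinitePi (fun _ : List ℕ => ν) (aliveSet h) * ν' ({m} ×ˢ B) =
      ∑' K, ν ({K} ×ˢ B) * (K.choose m *
        Measure.infinitePi (fun _ : List ℕ => ν) (aliveSet h)ᶜ ^ (K - m) *
        Measure.infinitePi (fun _ : List ℕ => ν) (aliveSet h) ^ m))
    (h2 : ∀ m, μ' [] ({m} ×ˢ univ) = ∑' K, μ [] ({K} ×ˢ univ) * (K.choose m *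
        Measure.infinitePi (fun _ : List ℕ => ν) (aliveSet h)ᶜ ^ (K - m) *
        Measure.infinitePi (fun _ : List ℕ => ν) (aliveSet h) ^ m)) :
    (Measure.infinitePi μ).map (trimMarked ∘ eraseForest h) =
      (Measure.infinitePi μ').map trimMarked := by
  classical
  have hmeas : Measurable (trimMarked ∘ eraseForest h) :=
    measurable_trimMarked.comp (measurable_eraseForest h)
  have key : ∀ (n : ℕ) (s : List ℕ → Set (ℕ × ℝ≥0∞)), (∀ u, MeasurableSet (s u)) →
      Measure.infinitePi μ {k | trimMarked (eraseForest h k) ∈ treeCylinder (n + 1) s} =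
        Measure.infinitePi μ' {k | trimMarked k ∈ treeCylinder (n + 1) s} := by
    intro n s hs
    have hm1 : MeasurableSet {k | trimMarked (eraseForest h k) ∈ treeCylinder (n + 1) s} :=
      hmeas (measurableSet_treeCylinder _ hs)
    have hm2 : MeasurableSet {k | trimMarked k ∈ treeCylinder (n + 1) s} :=
      measurable_trimMarked (measurableSet_treeCylinder _ hs)
    have hbs : ∀ i u, MeasurableSet (branch i s u) := fun i u => hs _
    rw [measure_eq_tsum_inter_fiber _ hm1 (measurable_card_survivors h),
      measure_eq_tsum_inter_fiber _ hm2 measurable_rootChildren]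
    refine tsum_congr fun m => ?_
    have hdec : ∀ k : MarkedForest, trimMarked k ∈ treeCylinder (n + 1) s ↔
        (∀ i, (k []).1 ≤ i → emptyForest ∈ treeCylinder n (branch i s)) ∧ trimMarked k [] ∈ s [] ∧
        ∀ i < (k []).1, trimTree (branch i k) ∈ treeCylinder n (branch i s) := fun k =>
      mem_treeCylinder_of_branch (branch_trimMarked k)
    have e1 : {k | trimMarked (eraseForest h k) ∈ treeCylinder (n + 1) s} ∩
        {k | (survivors h (kids k)).card = m} =
        {k | ((∀ i, m ≤ i → emptyForest ∈ treeCylinder n (branch i s)) ∧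
            ((m, ⊤) : ℕ × ℝ≥0∞) ∈ s []) ∧
          ((survivors h (kids k)).card = m ∧ (k []).2 ∈ (univ : Set ℝ≥0∞) ∧
            ∀ j < m, branch (enum (survivors h (kids k)) j) k ∈
              {t | trimTree (eraseForest h t) ∈ treeCylinder n (branch j s)})} := by
      ext k
      have hk0 : ((eraseForest h k) []).1 = (survivors h (kids k)).card := rfl
      simp only [mem_inter_iff, mem_ofPred_eq, hdec, trimMarked_nil, hk0]
      constructor
      · rintro ⟨⟨h2, h3, h5⟩, h4⟩
        rw [h4] at h2 h3 h5
        exact ⟨⟨h2, h3⟩, h4, mem_univ _, h5⟩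
      · rintro ⟨⟨h2, h3⟩, h4, -, h5⟩
        refine ⟨?_, h4⟩
        rw [h4]
        exact ⟨h2, h3, h5⟩
    have e2 : {k | trimMarked k ∈ treeCylinder (n + 1) s} ∩ {k | (k []).1 = m} =
        {k | ((∀ i, m ≤ i → emptyForest ∈ treeCylinder n (branch i s)) ∧
            ((m, ⊤) : ℕ × ℝ≥0∞) ∈ s []) ∧
          (k [] ∈ ({m} : Set ℕ) ×ˢ (univ : Set ℝ≥0∞) ∧
            ∀ i < m, branch i k ∈ {t | trimTree t ∈ treeCylinder n (branch i s)})} := by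
      ext k
      simp only [mem_inter_iff, mem_ofPred_eq, hdec, trimMarked_nil]
      constructor
      · rintro ⟨⟨h2, h3, h5⟩, h4⟩
        rw [h4] at h2 h3 h5
        exact ⟨⟨h2, h3⟩, ⟨h4, mem_univ _⟩, h5⟩
      · rintro ⟨⟨h2, h3⟩, ⟨h4, -⟩, h5⟩
        rw [mem_singleton_iff.1 h4]
        exact ⟨⟨h2, h3, h5⟩, rfl⟩
    rw [e1, e2, measure_and_eq, measure_and_eq]
    split_ifs with hC
    · have hS := infinitePi_survivors μ ν hμ h m MeasurableSet.univ
        (fun j => measurableSet_trimTree_eraseForest h n (hbs j))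
      have hR := infinitePi_root_branches μ' ν' hμ'
        ((measurableSet_singleton m).prod MeasurableSet.univ) m
        (fun j => measurableSet_trimTree n (hbs j))
      rw [hS, hR, h2 m, ← ENNReal.tsum_mul_right]
      refine tsum_congr fun K => ?_
      rw [Finset.prod_congr rfl fun j _ =>
          infinitePi_erased_treeCylinder ν ν' h h0 h1 n (branch j s) (hbs j),
        Finset.prod_mul_distrib, Finset.prod_const, Finset.card_range]
      ring
    · rfl
  have hprob1 : IsProbabilityMeasure ((Measure.infinitePi μ).map (trimMarked ∘ eraseForest h)) :=
    Measure.isProbabilityMeasure_map hmeas.aemeasurable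
  have hprob2 : IsProbabilityMeasure ((Measure.infinitePi μ').map trimMarked) :=
    Measure.isProbabilityMeasure_map measurable_trimMarked.aemeasurable
  -- Square cylinders form a generating π-system, and each of them is a `treeCylinder` that contains
  -- all generations of its finitely many words.
  refine ext_of_generate_finite _ (generateFrom_squareCylinders (α := fun _ : List ℕ => ℕ × ℝ≥0∞)).symm
    (isPiSystem_squareCylinders (fun _ => MeasurableSpace.isPiSystem_measurableSet)
      fun _ => by simp) ?_ (by simp)
  rintro _ ⟨I, t, ht, rfl⟩
  have ht' : ∀ u, MeasurableSet (t u) := fun u => ht u (mem_univ u)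
  have hcyl : (I : Set (List ℕ)).pi t = treeCylinder (I.sup List.length + 1)
      fun u => if u ∈ I then t u else univ := by
    ext x
    simp only [Set.mem_pi, treeCylinder, mem_ofPred_eq]
    constructor
    · intro H u _
      split_ifs with hu
      · exact H u hu
      · exact mem_univ _
    · intro H u hu
      have := H u (Nat.lt_succ_of_le (Finset.le_sup (f := List.length) hu))
      rwa [if_pos (Finset.mem_coe.1 hu)] at this
  have hms : ∀ u, MeasurableSet (if u ∈ I then t u else univ) := fun u => by
    split_ifs
    · exact ht' u
    · exact MeasurableSet.univ
  rw [hcyl, Measure.map_apply hmeas (measurableSet_treeCylinder _ hms),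
    Measure.map_apply measurable_trimMarked (measurableSet_treeCylinder _ hms)]
  exact key _ _ hms

end ErasedLaw

/-! ### Invariance under trimming -/

section Invariance

theorem alive_trim {h : ℕ} {k : Forest} : Alive h (trim k) ↔ Alive h k := by
  simp only [Alive, inForest_trim]

theorem mem_survivors_iff_exists {h : ℕ} {k : Forest} {i : ℕ} :
    i ∈ survivors h k ↔ ∃ u, InForest k (i :: u) ∧ u.length = h := by
  rw [mem_survivors]
  constructor
  · rintro ⟨h1, u, h2, h3⟩
    exact ⟨u, cons_mem_individuals.2 ⟨h1, h2⟩, h3⟩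
  · rintro ⟨u, h1, h2⟩
    obtain ⟨h3, h4⟩ := cons_mem_individuals.1 h1
    exact ⟨h3, u, h4, h2⟩

theorem survivors_trim (h : ℕ) (k : Forest) : survivors h (trim k) = survivors h k := by
  ext i
  simp only [mem_survivors_iff_exists, inForest_trim]

theorem kids_trimTree (k : MarkedForest) : kids (trimTree k) = trim (kids k) := by
  classical
  funext u
  have h : (trimTree k u).1 = if InForest (kids k) u then (k u).1 else 0 := by
    rw [trimTree]
    split_ifs <;> rfl
  rw [trim]
  convert h <;> rfl

theorem eq_of_branch_eq {α : Type*} {s t : List ℕ → α} (h0 : s [] = t [])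
    (h : ∀ i, branch i s = branch i t) : s = t := by
  funext u
  cases u with
  | nil => exact h0
  | cons i u => exact congrFun (h i) u

/-- Erasure reads only data of individuals of the tree, so trimming beforehand is lost after the
final trimming. This allows the law of the erased forest to be computed from the untrimmed product
measure. -/
theorem trimTree_eraseForest_trimTree (h : ℕ) (k : MarkedForest) :
    trimTree (eraseForest h (trimTree k)) = trimTree (eraseForest h k) := by
  have hs : ∀ k : MarkedForest, survivors h (kids (trimTree k)) = survivors h (kids k) :=
    fun k => by rw [kids_trimTree, survivors_trim]
  funext u
  induction u generalizing k with
  | nil =>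
    rw [trimTree_nil, trimTree_nil]
    change ((survivors h (kids (trimTree k))).card,
      if (survivors h (kids (trimTree k))).card ≠ 0 then (trimTree k []).2 else ⊤) =
      ((survivors h (kids k)).card, if (survivors h (kids k)).card ≠ 0 then (k []).2 else ⊤)
    rw [hs]
    split_ifs with hc
    -- A surviving child makes the original child number positive, so the first trimming kept the
    -- mark of the root of the tree.
    · obtain ⟨i, hi⟩ := Finset.card_ne_zero.1 hc
      have : (k []).1 ≠ 0 := (Nat.zero_le i).trans_lt (mem_survivors.1 hi).1 |>.ne'
      rw [trimTree_nil, if_pos this]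
    · rfl
  | cons j u ih =>
    change branch j (trimTree (eraseForest h (trimTree k))) u =
      branch j (trimTree (eraseForest h k)) u
    rw [branch_trimTree, branch_trimTree]
    change (if j < (survivors h (kids (trimTree k))).card then
        trimTree (eraseForest h (branch (enum (survivors h (kids (trimTree k))) j) (trimTree k)))
        else emptyForest) u =
      (if j < (survivors h (kids k)).card then
        trimTree (eraseForest h (branch (enum (survivors h (kids k)) j) k)) else emptyForest) u
    rw [hs]
    split_ifs with hj
    · rw [branch_trimTree, if_pos (show enum (survivors h (kids k)) j < (k []).1 from
        (mem_survivors.1 (enum_mem_iff.2 hj)).1), ih]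
    · rfl

theorem trimMarked_eraseForest_trimMarked (h : ℕ) (k : MarkedForest) :
    trimMarked (eraseForest h (trimMarked k)) = trimMarked (eraseForest h k) := by
  have hs : survivors h (kids (trimMarked k)) = survivors h (kids k) := by
    rw [trimMarked_fst, survivors_trim]
  refine eq_of_branch_eq ?_ fun j => ?_
  · rw [trimMarked_nil, trimMarked_nil]
    change ((survivors h (kids (trimMarked k))).card, _) = ((survivors h (kids k)).card, _)
    rw [hs]
  · rw [branch_trimMarked, branch_trimMarked]
    change (if j < (survivors h (kids (trimMarked k))).card then
        trimTree (eraseForest h (branch (enum (survivors h (kids (trimMarked k))) j)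
          (trimMarked k))) else emptyForest) =
      (if j < (survivors h (kids k)).card then
        trimTree (eraseForest h (branch (enum (survivors h (kids k)) j) k)) else emptyForest)
    rw [hs]
    split_ifs with hj
    · rw [branch_trimMarked, if_pos (show enum (survivors h (kids k)) j < (k []).1 from
        (mem_survivors.1 (enum_mem_iff.2 hj)).1), trimTree_eraseForest_trimTree]
    · rfl

theorem individuals_reproduce_subset {f : ℕ × ℝ≥0∞ → ℕ} (hf : ∀ a, f a ≤ a.1)
    (k : MarkedForest) : individuals (reproduce f k) ⊆ individuals (kids k) := by
  intro u hu v i hv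
  refine (hu v i hv).trans_le ?_
  rw [reproduce]
  split_ifs
  · exact le_rfl
  · exact hf _

theorem trim_congr {k k' : Forest} (h : ∀ u, InForest k u → k u = k' u) : trim k = trim k' := by
  have h1 := inForest_congr fun u hu _ => h u hu
  funext u
  rw [trim, trim]
  by_cases hu : InForest k u
  · rw [if_pos hu, if_pos ((h1 u).1 hu), h u hu]
  · rw [if_neg hu, if_neg fun hc => hu ((h1 u).2 hc)]

/-- Trimming resets the mark of a childless individual, and this has no effect because such an
individual stays childless when `f a ≤ a.1`. -/
theorem trim_reproduce_trimMarked {f : ℕ × ℝ≥0∞ → ℕ} (hf : ∀ a, f a ≤ a.1)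
    (k : MarkedForest) : trim (reproduce f (trimMarked k)) = trim (reproduce f k) := by
  symm
  refine trim_congr fun u hu => ?_
  have hu' : InForest (fun v => (k v).1) u := individuals_reproduce_subset hf k hu
  rw [reproduce, reproduce, trimMarked, if_pos hu']
  by_cases h0 : u = []
  · rw [if_pos h0, if_pos h0]
  · rw [if_neg h0, if_neg h0]
    by_cases hk : (k u).1 = 0
    · rw [Nat.le_zero.1 ((hf (k u)).trans hk.le)]
      refine (Nat.le_zero.1 (le_trans (hf _) ?_)).symm
      exact hk.le
    · rw [if_pos ⟨h0, hk⟩]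

end Invariance

/-! ### Laws of marked vertices -/

section VertexLaw

theorem markedVertexLaw_prod (ν : PMF ℕ) (H : ℕ → ProbabilityMeasure ℝ≥0∞) (m : ℕ)
    {B : Set ℝ≥0∞} (hB : MeasurableSet B) :
    (markedVertexLaw ν H : Measure (ℕ × ℝ≥0∞)) ({m} ×ˢ B) = ν m * (H m : Measure ℝ≥0∞) B := by
  have : IsMarkovKernel (Kernel.ofFunOfCountable fun m : ℕ => (H m : Measure ℝ≥0∞)) :=
    ⟨fun m => inferInstanceAs (IsProbabilityMeasure (H m : Measure ℝ≥0∞))⟩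
  change (ν.toMeasure ⊗ₘ Kernel.ofFunOfCountable fun m : ℕ => (H m : Measure ℝ≥0∞)) _ = _
  rw [Measure.compProd_apply_prod (measurableSet_singleton m) hB, lintegral_singleton,
    PMF.toMeasure_apply_singleton _ _ (measurableSet_singleton m), mul_comm]
  rfl

theorem markedVertexLaw_prod_univ (ν : PMF ℕ) (H : ℕ → ProbabilityMeasure ℝ≥0∞) (m : ℕ) :
    (markedVertexLaw ν H : Measure (ℕ × ℝ≥0∞)) ({m} ×ˢ univ) = ν m := by
  rw [markedVertexLaw_prod _ _ _ MeasurableSet.univ, measure_univ, mul_one]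

theorem markedVertexLaw_map_fst (ν : PMF ℕ) (H : ℕ → ProbabilityMeasure ℝ≥0∞) :
    (markedVertexLaw ν H : Measure (ℕ × ℝ≥0∞)).map Prod.fst = ν.toMeasure := by
  have : IsMarkovKernel (Kernel.ofFunOfCountable fun m : ℕ => (H m : Measure ℝ≥0∞)) :=
    ⟨fun m => inferInstanceAs (IsProbabilityMeasure (H m : Measure ℝ≥0∞))⟩
  exact Measure.fst_compProd _ _

theorem measurable_reproduce {f : ℕ × ℝ≥0∞ → ℕ} (hf : Measurable f) :
    Measurable (reproduce f) := by
  refine measurable_pi_lambda _ fun u => ?_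
  by_cases hu : u = []
  · simp only [reproduce, if_pos hu]
    exact measurable_fst.comp (measurable_pi_apply u)
  · simp only [reproduce, if_neg hu]
    exact hf.comp (measurable_pi_apply u)

/-- The law of the forest in which the child numbers of the individuals are replaced by
functions of their child numbers and marks. -/
theorem gwMarkedLaw_map_reproduce (ξ ξ' μ : PMF ℕ) (H : ℕ → ProbabilityMeasure ℝ≥0∞)
    {f : ℕ × ℝ≥0∞ → ℕ} (hf : Measurable f) (hle : ∀ a, f a ≤ a.1)
    (hξ' : ξ'.toMeasure = (markedVertexLaw ξ H : Measure (ℕ × ℝ≥0∞)).map f) :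
    (gwMarkedLaw ξ μ H).map (trim ∘ reproduce f) = gwLaw ξ' μ := by
  have h1 : (trim ∘ reproduce f) ∘ trimMarked = trim ∘ reproduce f :=
    funext fun k => trim_reproduce_trimMarked hle k
  have hm := measurable_reproduce hf
  rw [gwMarkedLaw, Measure.map_map (measurable_trim.comp hm) measurable_trimMarked, h1,
    ← Measure.map_map measurable_trim hm, gwLaw]
  congr 1
  have hg : ∀ u : List ℕ, Measurable (if u = [] then Prod.fst else f) := fun u => by
    split_ifs
    · exact measurable_fst
    · exact hf
  have h2 := Measure.infinitePi_map_pi (fun u : List ℕ =>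
    (markedVertexLaw (if u = [] then μ else ξ) H : Measure (ℕ × ℝ≥0∞))) hg
  have h3 : reproduce f = fun (k : MarkedForest) u => (if u = [] then Prod.fst else f) (k u) := by
    funext k u
    rw [reproduce]
    split_ifs <;> rfl
  rw [h3, h2]
  congr 1
  funext u
  split_ifs
  · exact markedVertexLaw_map_fst μ H
  · exact hξ'.symm

end VertexLaw

/-! ### The probability of extinction before a given generation -/

section HeightProb

theorem height_realForest_le_iff (k : Forest) (h : ℕ) :
    height 0 (realForest k) ≤ h ↔ ¬ Alive (h + 1) k := by
  have h1 := height_range_le_iff (W := individuals k) (φ := Subtype.val) isometry_subtype_coe h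
  rw [Subtype.range_coe] at h1
  rw [realForest_eq_wordTree]
  refine h1.trans ⟨?_, fun H u hu => ?_⟩
  · rintro H ⟨u, hu, hl⟩
    have := H u hu
    omega
  · by_contra hc
    exact H (Alive.of_le hu (by omega))

/-- The progenitor is the only child of the root, so the tree has height at most `h` exactly when
the family tree of the progenitor has no generation `h`. The marks are projected away, so any `H`
may be used. -/
theorem heightProb_eq (ξ : PMF ℕ) (H : ℕ → ProbabilityMeasure ℝ≥0∞) (h : ℕ) :
    heightProb ξ h = (Measure.infinitePi (fun _ : List ℕ =>
      (markedVertexLaw ξ H : Measure (ℕ × ℝ≥0∞))) (aliveSet h)ᶜ).toReal := by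
  set Λ := Measure.infinitePi (fun _ : List ℕ =>
      (markedVertexLaw ξ H : Measure (ℕ × ℝ≥0∞))) with hΛ
  have h1 := Measure.infinitePi_map_pi (fun _ : List ℕ =>
    (markedVertexLaw ξ H : Measure (ℕ × ℝ≥0∞))) (fun _ => measurable_fst)
  simp only [markedVertexLaw_map_fst] at h1
  have h2 : Λ (aliveSet h)ᶜ =
      Measure.infinitePi (fun _ : List ℕ => ξ.toMeasure) {k | Alive h k}ᶜ := by
    rw [← h1, Measure.map_apply (by fun_prop) (measurableSet_alive h).compl]
    rfl
  have h3 : {k : Forest | height 0 (realForest k) ≤ (h : ℝ≥0∞)} = {k | Alive (h + 1) k}ᶜ := by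
    ext k
    exact height_realForest_le_iff k h
  rw [heightProb, Measure.real, h3, h2, gwLaw,
    Measure.map_apply measurable_trim (measurableSet_alive _).compl]
  congr 1
  have h4 : trim ⁻¹' {k | Alive (h + 1) k}ᶜ = {k | Alive (h + 1) k}ᶜ := by
    ext k
    exact not_congr alive_trim
  rw [h4]
  set Λ₀ := Measure.infinitePi (fun u : List ℕ => (if u = [] then PMF.pure 1 else ξ).toMeasure)
  -- The root has exactly one child almost surely.
  have h5 : Λ₀ {k | k [] ∈ ({1} : Set ℕ)}ᶜ = 0 := by
    have hms : MeasurableSet ({1} : Set ℕ)ᶜ := (measurableSet_singleton 1).compl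
    have := (measurePreserving_eval_infinitePi (fun u : List ℕ =>
      (if u = [] then PMF.pure 1 else ξ).toMeasure) []).measure_preimage hms.nullMeasurableSet
    refine this.trans ?_
    rw [if_pos rfl, PMF.toMeasure_pure, Measure.dirac_apply' _ hms]
    simp
  have h6 := infinitePi_root_branches (fun u : List ℕ =>
    (if u = [] then PMF.pure 1 else ξ).toMeasure) ξ.toMeasure (fun i u => by simp)
    (measurableSet_singleton 1) 1 (fun _ => (measurableSet_alive h).compl)
  have h7 : (if ([] : List ℕ) = [] then PMF.pure 1 else ξ).toMeasure {1} = 1 := by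
    rw [if_pos rfl, PMF.toMeasure_apply_singleton _ _ (measurableSet_singleton 1)]
    simp
  rw [h7, one_mul, Finset.prod_range_one] at h6
  refine Eq.trans (measure_congr ?_) h6
  have h8 : ∀ᵐ k ∂Λ₀, k [] = 1 := h5
  filter_upwards [h8] with k hk
  refine propext ?_
  change (¬ Alive (h + 1) k) ↔ (k [] = 1 ∧ ∀ i < 1, ¬ Alive h (branch i k))
  rw [alive_succ_iff, and_iff_right hk]
  constructor
  · rintro H i hi ha
    exact H ⟨i, mem_survivors.2 ⟨by omega, ha⟩⟩
  · rintro H ⟨i, hi⟩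
    obtain ⟨h9, h10⟩ := mem_survivors.1 hi
    exact H i (by omega) h10

end HeightProb

/-! ### Random forests obtained from random forests -/

section RandomForests

theorem isFiniteMeasure_of_map_fst {Ω E : Type*} [MeasurableSpace Ω] [MeasurableSpace E]
    {P : Measure Ω} [IsFiniteMeasure P] {Q : Measure (Ω × E)} (h : Q.map Prod.fst = P) :
    IsFiniteMeasure Q := by
  refine ⟨?_⟩
  have h1 := congrArg (fun m : Measure Ω => m univ) h
  simp only [Measure.map_apply measurable_fst MeasurableSet.univ, preimage_univ] at h1
  rw [h1]
  exact measure_lt_top P univ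

theorem map_prodMap_id {Ω E E' : Type*} [MeasurableSpace Ω] [MeasurableSpace E]
    [MeasurableSpace E'] (Q : Measure (Ω × E)) {f : E → E'} (hf : Measurable f) :
    (Q.map (Prod.map id f)).map Prod.fst = Q.map Prod.fst ∧
      (Q.map (Prod.map id f)).map Prod.snd = (Q.map Prod.snd).map f := by
  rw [Measure.map_map measurable_fst (by fun_prop), Measure.map_map measurable_snd (by fun_prop),
    Measure.map_map hf measurable_snd]
  exact ⟨rfl, rfl⟩

variable {X Ω : Type*} [MetricSpace X] [MeasurableSpace Ω] {P : Measure Ω} {ρ : X}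
  {ξ μ : PMF ℕ} {H : ℕ → ProbabilityMeasure ℝ≥0∞} {F : Ω → Set X} {Θ : Ω → X → ℝ≥0∞}
  {B : ℝ≥0 → Ω → Set X}

/-- The coupling is pushed forward by the modification of the child numbers. The hypothesis on `G`
concerns every coding of the forest, since the coupling may choose any of them. -/
theorem IsMarkedGWForest.isGWForest_of_reproduce [IsProbabilityMeasure P]
    (hF : IsMarkedGWForest P ρ ξ μ H F Θ) {ξ' : PMF ℕ} (h1 : ξ' 1 < 1)
    {f : ℕ × ℝ≥0∞ → ℕ} (hf : Measurable f) (hle : ∀ a, f a ≤ a.1)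
    (hξ' : ξ'.toMeasure = (markedVertexLaw ξ H : Measure (ℕ × ℝ≥0∞)).map f)
    {G : Ω → Set X} (hG : ∀ᵐ ω ∂P, ∀ k, IsMarkedCodedBy ρ (F ω) (Θ ω) k →
      IsCodedBy ρ (G ω) (reproduce f k)) :
    IsGWForest P ρ ξ' μ G := by
  obtain ⟨-, Q, hQ1, hQ2, hQ3⟩ := hF
  have := isFiniteMeasure_of_map_fst hQ1
  have hm : Measurable (trim ∘ reproduce f) := measurable_trim.comp (measurable_reproduce hf)
  obtain ⟨h2, h3⟩ := map_prodMap_id Q hm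
  refine ⟨h1, Q.map (Prod.map id (trim ∘ reproduce f)), h2.trans hQ1, ?_, ?_⟩
  · rw [h3, hQ2, gwMarkedLaw_map_reproduce ξ ξ' μ H hf hle hξ']
  · rw [← hQ1] at hG
    refine ae_map_prodMap_of_imp hm (hQ3.and (ae_of_ae_map measurable_fst.aemeasurable hG))
      fun ω k hk => isCodedBy_trim.2 (hk.2 k hk.1)

theorem IsMarkedGWForest.isGWForest [IsProbabilityMeasure P]
    (hF : IsMarkedGWForest P ρ ξ μ H F Θ) : IsGWForest P ρ ξ μ F := by
  refine hF.isGWForest_of_reproduce hF.1 measurable_fst (fun _ => le_rfl)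
    (markedVertexLaw_map_fst ξ H).symm (ae_of_all _ fun ω k hk => ?_)
  have : reproduce Prod.fst k = kids k := by
    funext u
    rw [reproduce]
    split_ifs <;> rfl
  rw [this]
  exact hk.isCodedBy

theorem measurable_pruneVertex (θ : ℝ≥0∞) :
    Measurable fun a : ℕ × ℝ≥0∞ => if a.2 ≤ θ then 0 else a.1 :=
  Measurable.ite (measurableSet_le measurable_snd measurable_const) measurable_const measurable_fst

/-- The forest at time `θ` of a pruning process is a Galton-Watson forest. -/
theorem IsHPruningProcess.isGWForest [IsProbabilityMeasure P]
    (hB : IsHPruningProcess P ρ ξ μ H F B) (θ : ℝ≥0) {ξ' : PMF ℕ} (h1 : ξ' 1 < 1)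
    (hξ' : ξ'.toMeasure = (markedVertexLaw ξ H : Measure (ℕ × ℝ≥0∞)).map
      fun a => if a.2 ≤ (θ : ℝ≥0∞) then 0 else a.1) :
    IsGWForest P ρ ξ' μ (B θ) := by
  obtain ⟨-, -, Θ, hF, hΘ⟩ := hB
  refine hF.isGWForest_of_reproduce h1 (measurable_pruneVertex θ) (fun a => ?_) hξ' ?_
  · split_ifs
    · exact Nat.zero_le _
    · exact le_rfl
  · filter_upwards [hΘ] with ω hω k hk
    rw [hω]
    exact hk.prune θ

theorem IsMarkedGWForest.erase [IsProbabilityMeasure P]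
    (hF : IsMarkedGWForest P ρ ξ μ H F Θ) (h : ℕ) {ξh μh : PMF ℕ}
    {Hh : ℕ → ProbabilityMeasure ℝ≥0∞} (h1 : ξh 1 < 1)
    (hlaw : (gwMarkedLaw ξ μ H).map (trimMarked ∘ eraseForest h) = gwMarkedLaw ξh μh Hh) :
    IsMarkedGWForest P ρ ξh μh Hh (fun ω => GWPruning.erase ρ h (F ω)) Θ := by
  obtain ⟨-, Q, hQ1, hQ2, hQ3⟩ := hF
  have := isFiniteMeasure_of_map_fst hQ1
  have hm : Measurable (trimMarked ∘ eraseForest h) :=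
    measurable_trimMarked.comp (measurable_eraseForest h)
  obtain ⟨h2, h3⟩ := map_prodMap_id Q hm
  refine ⟨h1, Q.map (Prod.map id (trimMarked ∘ eraseForest h)), h2.trans hQ1, ?_, ?_⟩
  · rw [h3, hQ2, hlaw]
  · exact ae_map_prodMap_of_imp hm hQ3 fun ω k hk => isMarkedCodedBy_trimMarked.2 (hk.erase h)

/-- The erasure of a pruning process is a pruning process. -/
theorem IsHPruningProcess.erase [IsProbabilityMeasure P]
    (hB : IsHPruningProcess P ρ ξ μ H F B) (h : ℕ) {ξh μh : PMF ℕ}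
    {Hh : ℕ → ProbabilityMeasure ℝ≥0∞} (h1 : ξh 1 < 1)
    (hH : ∀ m, 1 ≤ m → (Hh m : Measure ℝ≥0∞) {0} = 0)
    (hlaw : (gwMarkedLaw ξ μ H).map (trimMarked ∘ eraseForest h) = gwMarkedLaw ξh μh Hh) :
    IsHPruningProcess P ρ ξh μh Hh (fun ω => GWPruning.erase ρ h (F ω))
      (fun θ ω => B θ ω ∩ GWPruning.erase ρ h (F ω)) := by
  obtain ⟨-, hpr, Θ, hF, hΘ⟩ := hB
  have hF' := hF
  obtain ⟨-, Q, hQ1, hQ2, hQ3⟩ := hF'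
  have := isFiniteMeasure_of_map_fst hQ1
  have hall : ∀ᵐ ω ∂P, (IsPruningProcess ρ (GWPruning.erase ρ h (F ω))
      fun θ => B θ ω ∩ GWPruning.erase ρ h (F ω)) ∧
      ∀ θ, B θ ω ∩ GWPruning.erase ρ h (F ω) =
        GWPruning.prune ρ (GWPruning.erase ρ h (F ω)) (Θ ω) θ := by
    have hP := hpr.and hΘ
    rw [← hQ1] at hP ⊢
    -- All remaining claims about `ω` are deterministic as soon as one marked forest codes `F ω`.
    refine ae_of_ae_coupling (hQ3.and (ae_of_ae_map measurable_fst.aemeasurable hP)) ?_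
    rintro ω k ⟨hk, h2, h3⟩
    have h4 : ∀ θ, B θ ω ∩ GWPruning.erase ρ h (F ω) =
        GWPruning.prune ρ (GWPruning.erase ρ h (F ω)) (Θ ω) θ := fun θ => by
      rw [show B θ ω = _ from h3 θ]
      exact hk.prune_inter_erase h θ
    have h5 : B 0 ω ∩ GWPruning.erase ρ h (F ω) = GWPruning.erase ρ h (F ω) := by
      rw [show B 0 ω = F ω from h2.start]
      refine inter_eq_right.2 ?_
      obtain ⟨φ, hφ, h6, h7, -⟩ := isMarkedCodedBy_iff.1 hk
      rw [← h6, ← h7, erase_range_eq (prefixClosed_individuals _) hφ]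
      exact image_subset_range _ _
    refine ⟨?_, h4⟩
    simp only [h4]
    exact IsMarkedCodedBy.isPruningProcess (hk.erase h) ((h4 0).symm.trans h5)
  exact ⟨hH, hall.mono fun ω hω => hω.1, Θ, hF.erase h h1 hlaw, hall.mono fun ω hω => hω.2⟩

end RandomForests

/-! ### Generating functions -/

section Gen

/-- The generating function with values in `[0, ∞]`. -/
noncomputable def egen (ξ : PMF ℕ) (s : ℝ≥0∞) : ℝ≥0∞ := ∑' n, ξ n * s ^ n

/-- The coefficients of the expansion of the generating function at `a`. -/
noncomputable def taylorCoeff (ξ : PMF ℕ) (a : ℝ≥0∞) (m : ℕ) : ℝ≥0∞ :=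
  ∑' K, ξ K * (K.choose m * a ^ (K - m))

theorem gen_eq_toReal_egen (ξ : PMF ℕ) {s : ℝ} (hs : 0 ≤ s) :
    gen ξ s = (egen ξ (ENNReal.ofReal s)).toReal := by
  rw [egen, ENNReal.tsum_toReal_eq fun n =>
    ENNReal.mul_ne_top (ξ.apply_ne_top n) (ENNReal.pow_ne_top ENNReal.ofReal_ne_top)]
  refine tsum_congr fun n => ?_
  rw [ENNReal.toReal_mul, ENNReal.toReal_pow, ENNReal.toReal_ofReal hs]

theorem egen_le_one (ξ : PMF ℕ) {s : ℝ≥0∞} (hs : s ≤ 1) : egen ξ s ≤ 1 := by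
  rw [← ξ.tsum_coe, egen]
  exact ENNReal.tsum_le_tsum fun n => mul_le_of_le_one_right' (pow_le_one₀ zero_le hs)

theorem egen_one (ξ : PMF ℕ) : egen ξ 1 = 1 := by simp [egen, ξ.tsum_coe]

theorem egen_eq_add (ξ : PMF ℕ) (s : ℝ≥0∞) :
    egen ξ s = ξ 0 + ∑' m, ξ (m + 1) * s ^ (m + 1) := by
  rw [egen, tsum_eq_zero_add' ENNReal.summable]
  simp

theorem tsum_choose_mul (a t : ℝ≥0∞) (K : ℕ) :
    ∑' m, (K.choose m * a ^ (K - m)) * t ^ m = (a + t) ^ K := by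
  rw [add_comm, add_pow, tsum_eq_sum (s := Finset.range (K + 1))]
  · exact Finset.sum_congr rfl fun m _ => by ring
  · intro m hm
    rw [Nat.choose_eq_zero_of_lt (by simpa using hm)]
    simp

/-- Interchange of sums and the binomial theorem. In `[0, ∞]` no convergence condition is needed, so
the identity remains available when `a + t = 1`. -/
theorem tsum_taylorCoeff_mul_pow (ξ : PMF ℕ) (a t : ℝ≥0∞) :
    ∑' m, taylorCoeff ξ a m * t ^ m = egen ξ (a + t) := by
  simp only [taylorCoeff, ← ENNReal.tsum_mul_right]
  rw [ENNReal.tsum_comm, egen]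
  refine tsum_congr fun K => ?_
  rw [← tsum_choose_mul, ← ENNReal.tsum_mul_left]
  exact tsum_congr fun m => by ring

theorem taylorCoeff_zero_add (ξ : PMF ℕ) (a t : ℝ≥0∞) :
    taylorCoeff ξ a 0 + ∑' m, taylorCoeff ξ a (m + 1) * t ^ (m + 1) = egen ξ (a + t) := by
  rw [← tsum_taylorCoeff_mul_pow, tsum_eq_zero_add' ENNReal.summable (f := fun m =>
    taylorCoeff ξ a m * t ^ m)]
  simp

/-- The `m`-th formal derivative of the generating function. -/
noncomputable def genDeriv (ξ : PMF ℕ) (m : ℕ) (x : ℝ) : ℝ :=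
  ∑' K, (ξ K).toReal * (K.descFactorial m * x ^ (K - m))

theorem summable_descFactorial_mul_pow (m : ℕ) {r : ℝ} (hr0 : 0 ≤ r) (hr : r < 1) :
    Summable fun K : ℕ => (K.descFactorial m : ℝ) * r ^ (K - m) := by
  rw [← summable_nat_add_iff m]
  simpa using summable_descFactorial_mul_geometric_of_norm_lt_one (R := ℝ) m (r := r)
    (by rwa [Real.norm_of_nonneg hr0])

theorem norm_genDeriv_term_le (ξ : PMF ℕ) (m K : ℕ) {x r : ℝ} (hx : |x| ≤ r) :
    ‖(ξ K).toReal * ((K.descFactorial m : ℝ) * x ^ (K - m))‖ ≤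
      K.descFactorial m * r ^ (K - m) := by
  rw [norm_mul, norm_mul, norm_pow, Real.norm_of_nonneg ENNReal.toReal_nonneg,
    Real.norm_of_nonneg (Nat.cast_nonneg _), Real.norm_eq_abs]
  have h1 : (ξ K).toReal ≤ 1 := by
    simpa using ENNReal.toReal_mono ENNReal.one_ne_top (ξ.coe_le_one K)
  have h2 : (K.descFactorial m : ℝ) * |x| ^ (K - m) ≤ K.descFactorial m * r ^ (K - m) := by
    gcongr
  refine (mul_le_of_le_one_left (by positivity) h1).trans h2

theorem summable_genDeriv (ξ : PMF ℕ) (m : ℕ) {x : ℝ} (hx : |x| < 1) :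
    Summable fun K : ℕ => (ξ K).toReal * ((K.descFactorial m : ℝ) * x ^ (K - m)) :=
  Summable.of_norm_bounded (summable_descFactorial_mul_pow m (abs_nonneg x) hx)
    fun K => norm_genDeriv_term_le ξ m K le_rfl

/-- Termwise differentiation on a smaller disc: since `ξ K ≤ 1`, the derivatives are dominated there
by the summable terms of a differentiated geometric series. -/
theorem hasDerivAt_genDeriv (ξ : PMF ℕ) (m : ℕ) {x : ℝ} (hx : |x| < 1) :
    HasDerivAt (genDeriv ξ m) (genDeriv ξ (m + 1) x) x := by
  obtain ⟨r, hxr, hr⟩ := exists_between hx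
  have hr0 : 0 ≤ r := (abs_nonneg x).trans hxr.le
  have hmem : ∀ y, y ∈ Metric.ball (0 : ℝ) r ↔ |y| < r := fun y => by simp
  refine hasDerivAt_tsum_of_isPreconnected (t := Metric.ball 0 r)
    (g' := fun K y => (ξ K).toReal * ((K.descFactorial (m + 1) : ℝ) * y ^ (K - (m + 1))))
    (summable_descFactorial_mul_pow (m + 1) hr0 hr)
    Metric.isOpen_ball (convex_ball 0 r).isPreconnected (fun K y _ => ?_)
    (fun K y hy => norm_genDeriv_term_le ξ (m + 1) K ((hmem y).1 hy).le) ((hmem x).2 hxr)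
    (summable_genDeriv ξ m hx) ((hmem x).2 hxr)
  have h1 := (((hasDerivAt_pow (K - m) y).const_mul (K.descFactorial m : ℝ)).const_mul
    (ξ K).toReal)
  refine h1.congr_deriv ?_
  rw [Nat.descFactorial_succ, Nat.cast_mul, Nat.sub_sub]
  ring

theorem iteratedDeriv_gen (ξ : PMF ℕ) (m : ℕ) {x : ℝ} (hx : |x| < 1) :
    iteratedDeriv m (gen ξ) x = genDeriv ξ m x := by
  induction m generalizing x with
  | zero => simp [gen, genDeriv]
  | succ m ih =>
    rw [iteratedDeriv_succ]
    have h1 : iteratedDeriv m (gen ξ) =ᶠ[𝓝 x] genDeriv ξ m := by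
      filter_upwards [(isOpen_lt continuous_abs continuous_const).mem_nhds hx] with y hy
      exact ih hy
    rw [h1.deriv_eq]
    exact (hasDerivAt_genDeriv ξ m hx).deriv

/-- This links the real derivatives in the tail formulas to the expansion coefficients with values
in `[0, ∞]`, through `K.descFactorial m = m! * K.choose m`. -/
theorem ofReal_iteratedDeriv_gen (ξ : PMF ℕ) (m : ℕ) {x : ℝ} (hx0 : 0 ≤ x) (hx : x < 1) :
    ENNReal.ofReal (iteratedDeriv m (gen ξ) x) =
      m.factorial * taylorCoeff ξ (ENNReal.ofReal x) m := by
  have hx' : |x| < 1 := by rwa [abs_of_nonneg hx0]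
  rw [iteratedDeriv_gen ξ m hx', genDeriv,
    ENNReal.ofReal_tsum_of_nonneg (fun K => by positivity) (summable_genDeriv ξ m hx'),
    taylorCoeff, ← ENNReal.tsum_mul_left]
  refine tsum_congr fun K => ?_
  rw [ENNReal.ofReal_mul ENNReal.toReal_nonneg, ENNReal.ofReal_toReal (ξ.apply_ne_top K),
    ENNReal.ofReal_mul (Nat.cast_nonneg _), ENNReal.ofReal_natCast, ENNReal.ofReal_pow hx0,
    Nat.descFactorial_eq_factorial_mul_choose, Nat.cast_mul]
  ring

theorem iteratedDeriv_gen_nonneg (ξ : PMF ℕ) (m : ℕ) {x : ℝ} (hx0 : 0 ≤ x) (hx : x < 1) :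
    0 ≤ iteratedDeriv m (gen ξ) x := by
  rw [iteratedDeriv_gen ξ m (by rwa [abs_of_nonneg hx0])]
  exact tsum_nonneg fun K => by positivity

theorem taylorCoeff_ne_top (ξ : PMF ℕ) (m : ℕ) {x : ℝ} (hx0 : 0 ≤ x) (hx : x < 1) :
    taylorCoeff ξ (ENNReal.ofReal x) m ≠ ⊤ := by
  intro hc
  have h1 := ofReal_iteratedDeriv_gen ξ m hx0 hx
  rw [hc, ENNReal.mul_top (by exact_mod_cast m.factorial_ne_zero)] at h1
  exact ENNReal.ofReal_ne_top h1

theorem iteratedDeriv_gen_ne_zero_iff (ξ : PMF ℕ) (m : ℕ) {x : ℝ} (hx0 : 0 ≤ x) (hx : x < 1) :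
    iteratedDeriv m (gen ξ) x ≠ 0 ↔ taylorCoeff ξ (ENNReal.ofReal x) m ≠ 0 := by
  refine not_congr ?_
  have h1 := ofReal_iteratedDeriv_gen ξ m hx0 hx
  constructor
  · intro h
    rw [h, ENNReal.ofReal_zero] at h1
    exact (mul_eq_zero.1 h1.symm).resolve_left (by exact_mod_cast m.factorial_ne_zero)
  · intro h
    rw [h, mul_zero, ENNReal.ofReal_eq_zero] at h1
    exact le_antisymm h1 (iteratedDeriv_gen_nonneg ξ m hx0 hx)

end Gen

/-! ### Pruning times after erasure -/

section ErasedTimes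

theorem branchPointLaws_of_two_le {K : ℕ} (hK : 2 ≤ K) :
    (branchPointLaws K : Measure ℝ≥0∞) = (expMeasure ((K : ℝ) - 1)).map ENNReal.ofReal :=
  congrArg (fun ν : ProbabilityMeasure ℝ≥0∞ => (ν : Measure ℝ≥0∞)) (dif_pos hK)

theorem branchPointLaws_one : (branchPointLaws 1 : Measure ℝ≥0∞) = Measure.dirac ⊤ :=
  congrArg (fun ν : ProbabilityMeasure ℝ≥0∞ => (ν : Measure ℝ≥0∞)) (dif_neg (by omega))

/-- One formula covers all `K ≥ 1`: for `K = 1` the power is `1`, which is the tail of the point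
mass at `∞`. -/
theorem branchPointLaws_Ioi {K : ℕ} (hK : 1 ≤ K) (θ : ℝ≥0) :
    (branchPointLaws K : Measure ℝ≥0∞) (Ioi (θ : ℝ≥0∞)) =
      ENNReal.ofReal (Real.exp (-θ)) ^ (K - 1) := by
  by_cases h : 2 ≤ K
  · have hpos : (0 : ℝ) < K - 1 := by
      have : (2 : ℝ) ≤ K := by exact_mod_cast h
      linarith
    have := isProbabilityMeasure_expMeasure hpos
    rw [branchPointLaws_of_two_le h, Measure.map_apply ENNReal.measurable_ofReal measurableSet_Ioi]
    have h1 : ENNReal.ofReal ⁻¹' Ioi (θ : ℝ≥0∞) = (Iic (θ : ℝ))ᶜ := by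
      ext x
      rw [mem_preimage, mem_Ioi, mem_compl_iff, mem_Iic, not_le,
        ← ENNReal.ofReal_coe_nnreal, ENNReal.ofReal_lt_ofReal_iff_of_nonneg θ.coe_nonneg]
    have h2 : (expMeasure ((K : ℝ) - 1)).real (Iic (θ : ℝ)) =
        1 - Real.exp (-(((K : ℝ) - 1) * θ)) := by
      rw [← cdf_eq_real, cdf_expMeasure_eq hpos, if_pos θ.coe_nonneg]
    rw [h1, ← ofReal_measureReal, probReal_compl_eq_one_sub measurableSet_Iic, h2,
      ← ENNReal.ofReal_pow (Real.exp_pos _).le, ← Real.exp_nat_mul, Nat.cast_sub hK]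
    congr 1
    rw [sub_sub_cancel]
    congr 1
    push_cast
    ring
  · obtain rfl : K = 1 := by omega
    rw [branchPointLaws_one, Measure.dirac_apply' _ measurableSet_Ioi]
    simp

/-- The pruning time laws of vertices with `m` children after erasure, up to normalization. -/
noncomputable def erasedTimes (ξ : PMF ℕ) (a : ℝ≥0∞) (m : ℕ) : Measure ℝ≥0∞ :=
  Measure.sum fun K => (ξ K * (K.choose m * a ^ (K - m))) • (branchPointLaws K : Measure ℝ≥0∞)

theorem erasedTimes_apply (ξ : PMF ℕ) (a : ℝ≥0∞) (m : ℕ) {B : Set ℝ≥0∞} (hB : MeasurableSet B) :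
    erasedTimes ξ a m B =
      ∑' K, ξ K * (K.choose m * a ^ (K - m)) * (branchPointLaws K : Measure ℝ≥0∞) B := by
  rw [erasedTimes, Measure.sum_apply _ hB]
  rfl

theorem erasedTimes_univ (ξ : PMF ℕ) (a : ℝ≥0∞) (m : ℕ) :
    erasedTimes ξ a m univ = taylorCoeff ξ a m := by
  rw [erasedTimes_apply _ _ _ MeasurableSet.univ]
  simp [taylorCoeff]

/-- Split `K - 1 = (m - 1) + (K - m)`: the first part comes out of the sum and the second scales
`a`. Terms with `K < m` vanish, so the restriction `1 ≤ K` for the tail of the `K`-th law holds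
wherever it is needed. -/
theorem erasedTimes_Ioi (ξ : PMF ℕ) (a : ℝ≥0∞) {m : ℕ} (hm : 1 ≤ m) (θ : ℝ≥0) :
    erasedTimes ξ a m (Ioi (θ : ℝ≥0∞)) = ENNReal.ofReal (Real.exp (-θ)) ^ (m - 1) *
      taylorCoeff ξ (a * ENNReal.ofReal (Real.exp (-θ))) m := by
  rw [erasedTimes_apply _ _ _ measurableSet_Ioi, taylorCoeff, ← ENNReal.tsum_mul_left]
  refine tsum_congr fun K => ?_
  obtain hK | hK := lt_or_ge K m
  · simp [Nat.choose_eq_zero_of_lt hK]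
  · rw [branchPointLaws_Ioi (hm.trans hK), mul_pow,
      show K - 1 = (m - 1) + (K - m) by omega, pow_add]
    ring

variable {ξ : PMF ℕ} {p : ℝ}

theorem erasedTimes_Ioi_eq (hp0 : 0 ≤ p) (hp1 : p < 1) {m : ℕ} (hm : 1 ≤ m) (θ : ℝ≥0) :
    erasedTimes ξ (ENNReal.ofReal p) m (Ioi (θ : ℝ≥0∞)) =
      taylorCoeff ξ (ENNReal.ofReal p) m * ENNReal.ofReal (Real.exp (-((m : ℝ) - 1) * θ) *
        iteratedDeriv m (gen ξ) (p * Real.exp (-θ)) / iteratedDeriv m (gen ξ) p) := by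
  have he0 := (Real.exp_pos (-(θ : ℝ))).le
  have he1 : Real.exp (-(θ : ℝ)) ≤ 1 := Real.exp_le_one_iff.2 (by simp)
  have hpe : p * Real.exp (-θ) < 1 := (mul_le_of_le_one_right hp0 he1).trans_lt hp1
  have hpe0 : 0 ≤ p * Real.exp (-(θ : ℝ)) := mul_nonneg hp0 he0
  have hexp : ENNReal.ofReal (Real.exp (-((m : ℝ) - 1) * θ)) =
      ENNReal.ofReal (Real.exp (-θ)) ^ (m - 1) := by
    rw [← ENNReal.ofReal_pow he0, ← Real.exp_nat_mul, Nat.cast_sub hm]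
    congr 2
    push_cast
    ring
  by_cases hc : taylorCoeff ξ (ENNReal.ofReal p) m = 0
  · rw [hc, zero_mul]
    exact measure_mono_null (subset_univ _) ((erasedTimes_univ _ _ _).trans hc)
  · have hd := (iteratedDeriv_gen_ne_zero_iff ξ m hp0 hp1).2 hc
    have hdpos : 0 < iteratedDeriv m (gen ξ) p :=
      (iteratedDeriv_gen_nonneg ξ m hp0 hp1).lt_of_ne' hd
    have hf0 : (m.factorial : ℝ≥0∞) ≠ 0 := by exact_mod_cast m.factorial_ne_zero
    rw [erasedTimes_Ioi _ _ hm, ENNReal.ofReal_div_of_pos hdpos,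
      ENNReal.ofReal_mul (Real.exp_pos _).le, hexp, ofReal_iteratedDeriv_gen ξ m hp0 hp1,
      ofReal_iteratedDeriv_gen ξ m hpe0 hpe, ← ENNReal.ofReal_mul hp0, div_eq_mul_inv,
      ENNReal.mul_inv (Or.inl hf0) (Or.inl (ENNReal.natCast_ne_top _))]
    set c := taylorCoeff ξ (ENNReal.ofReal p) m
    set c' := taylorCoeff ξ (ENNReal.ofReal (p * Real.exp (-θ))) m
    calc _ = ENNReal.ofReal (Real.exp (-θ)) ^ (m - 1) * c' *
          (m.factorial * (m.factorial : ℝ≥0∞)⁻¹) * (c * c⁻¹) := by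
          rw [ENNReal.mul_inv_cancel hf0 (ENNReal.natCast_ne_top _),
            ENNReal.mul_inv_cancel hc (taylorCoeff_ne_top ξ m hp0 hp1), mul_one, mul_one]
      _ = _ := by ring

/-- The case `m = 1` has the same form as the others because its exponential factor is `exp 0`. -/
theorem hasErasedTails_iff {H : ℕ → ProbabilityMeasure ℝ≥0∞} :
    HasErasedTails ξ p H ↔ (∀ m, 1 ≤ m → (H m : Measure ℝ≥0∞) {0} = 0) ∧
      ∀ m, 1 ≤ m → iteratedDeriv m (gen ξ) p ≠ 0 → ∀ θ : ℝ≥0,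
        (H m : Measure ℝ≥0∞) (Ioi (θ : ℝ≥0∞)) =
          ENNReal.ofReal (Real.exp (-((m : ℝ) - 1) * θ) *
            iteratedDeriv m (gen ξ) (p * Real.exp (-θ)) / iteratedDeriv m (gen ξ) p) := by
  refine and_congr_right fun _ => ⟨?_, fun h => ⟨fun h1 θ => ?_, fun m hm => h m (by omega)⟩⟩
  · rintro ⟨h1, h2⟩ m hm
    obtain rfl | hm := hm.eq_or_lt
    · simpa using h1
    · exact h2 m hm
  · simpa using h 1 le_rfl (by simpa using h1) θ

theorem isFiniteMeasure_erasedTimes (hp0 : 0 ≤ p) (hp1 : p < 1) (m : ℕ) :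
    IsFiniteMeasure (erasedTimes ξ (ENNReal.ofReal p) m) :=
  ⟨by rw [erasedTimes_univ]; exact (taylorCoeff_ne_top ξ m hp0 hp1).lt_top⟩

/-- The tails determine the pruning time laws. -/
theorem HasErasedTails.smul_eq (hp0 : 0 ≤ p) (hp1 : p < 1) {H : ℕ → ProbabilityMeasure ℝ≥0∞}
    (hH : HasErasedTails ξ p H) {m : ℕ} (hm : 1 ≤ m) :
    taylorCoeff ξ (ENNReal.ofReal p) m • (H m : Measure ℝ≥0∞) =
      erasedTimes ξ (ENNReal.ofReal p) m := by
  have := isFiniteMeasure_erasedTimes (ξ := ξ) hp0 hp1 m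
  have huniv : taylorCoeff ξ (ENNReal.ofReal p) m * (H m : Measure ℝ≥0∞) univ =
      erasedTimes ξ (ENNReal.ofReal p) m univ := by
    rw [erasedTimes_univ, measure_univ, mul_one]
  by_cases hc : taylorCoeff ξ (ENNReal.ofReal p) m = 0
  -- Where the coefficient vanishes both sides are the zero measure, so the free choice of `H m`
  -- does no harm.
  · rw [hc, zero_smul, eq_comm, ← Measure.measure_univ_eq_zero, erasedTimes_univ, hc]
  · symm
    refine Measure.ext_of_Iic _ _ fun x => ?_
    rw [Measure.smul_apply, smul_eq_mul]
    induction x with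
    -- Equality of total masses accounts for the possible atom at `∞`, which the tails at finite `θ`
    -- include but do not isolate.
    | top => rw [Iic_top, huniv]
    | coe θ =>
      have h1 := (hasErasedTails_iff.1 hH).2 m hm
        ((iteratedDeriv_gen_ne_zero_iff ξ m hp0 hp1).2 hc) θ
      have h2 : Iic (θ : ℝ≥0∞) = (Ioi (θ : ℝ≥0∞))ᶜ := by simp
      rw [h2, measure_compl measurableSet_Ioi (measure_ne_top _ _),
        measure_compl measurableSet_Ioi (measure_ne_top _ _), h1, erasedTimes_Ioi_eq hp0 hp1 hm,
        ENNReal.mul_sub fun _ _ => taylorCoeff_ne_top ξ m hp0 hp1, huniv]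

theorem exists_hasErasedTails (hp0 : 0 ≤ p) (hp1 : p < 1) : ∃ H, HasErasedTails ξ p H := by
  have h1 : ∀ m, ∃ H : ProbabilityMeasure ℝ≥0∞, (1 ≤ m → (H : Measure ℝ≥0∞) {0} = 0) ∧
      (1 ≤ m → iteratedDeriv m (gen ξ) p ≠ 0 → ∀ θ : ℝ≥0,
        (H : Measure ℝ≥0∞) (Ioi (θ : ℝ≥0∞)) =
          ENNReal.ofReal (Real.exp (-((m : ℝ) - 1) * θ) *
            iteratedDeriv m (gen ξ) (p * Real.exp (-θ)) / iteratedDeriv m (gen ξ) p)) := by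
    intro m
    by_cases hc : taylorCoeff ξ (ENNReal.ofReal p) m = 0
    · refine ⟨⟨Measure.dirac ⊤, inferInstance⟩, fun _ => ?_, fun _ h => ?_⟩
      · change Measure.dirac (⊤ : ℝ≥0∞) {0} = 0
        rw [Measure.dirac_apply' _ (measurableSet_singleton 0)]
        simp
      · exact absurd hc ((iteratedDeriv_gen_ne_zero_iff ξ m hp0 hp1).1 h)
    · have hct := taylorCoeff_ne_top ξ m hp0 hp1
      have hprob : IsProbabilityMeasure ((taylorCoeff ξ (ENNReal.ofReal p) m)⁻¹ •
          erasedTimes ξ (ENNReal.ofReal p) m) := by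
        refine ⟨?_⟩
        rw [Measure.smul_apply, erasedTimes_univ, smul_eq_mul, ENNReal.inv_mul_cancel hc hct]
      have htail : 1 ≤ m → ∀ θ : ℝ≥0, ((taylorCoeff ξ (ENNReal.ofReal p) m)⁻¹ •
          erasedTimes ξ (ENNReal.ofReal p) m) (Ioi (θ : ℝ≥0∞)) =
          ENNReal.ofReal (Real.exp (-((m : ℝ) - 1) * θ) *
            iteratedDeriv m (gen ξ) (p * Real.exp (-θ)) / iteratedDeriv m (gen ξ) p) := by
        intro hm θ
        rw [Measure.smul_apply, smul_eq_mul, erasedTimes_Ioi_eq hp0 hp1 hm, ← mul_assoc,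
          ENNReal.inv_mul_cancel hc hct, one_mul]
      refine ⟨⟨_, hprob⟩, fun hm => ?_, fun hm _ => htail hm⟩
      -- The tail at `θ = 0` equals `1`, so the normalized measure has no atom at `0`.
      have h2 := htail hm 0
      have hd := (iteratedDeriv_gen_ne_zero_iff ξ m hp0 hp1).2 hc
      simp only [NNReal.coe_zero, mul_zero, neg_zero, Real.exp_zero, one_mul, mul_one,
        div_self hd, ENNReal.ofReal_one, ENNReal.coe_zero] at h2
      refine measure_mono_null (t := (Ioi 0)ᶜ) (by simp) ?_
      exact (prob_compl_eq_zero_iff (μ := (taylorCoeff ξ (ENNReal.ofReal p) m)⁻¹ •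
        erasedTimes ξ (ENNReal.ofReal p) m) measurableSet_Ioi).2 h2
  choose H hH using h1
  exact ⟨H, hasErasedTails_iff.2 ⟨fun m => (hH m).1, fun m => (hH m).2⟩⟩

end ErasedTimes

/-! ### Offspring laws after erasure -/

section ErasedOffspring

/-- The law of the vertex data of all words in a Galton-Watson tree with marks. -/
noncomputable def vertexDataLaw (ξ : PMF ℕ) (H : ℕ → ProbabilityMeasure ℝ≥0∞) :
    Measure MarkedForest :=
  Measure.infinitePi fun _ : List ℕ => (markedVertexLaw ξ H : Measure (ℕ × ℝ≥0∞))

instance (ξ : PMF ℕ) (H : ℕ → ProbabilityMeasure ℝ≥0∞) :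
    IsProbabilityMeasure (vertexDataLaw ξ H) := by
  unfold vertexDataLaw
  infer_instance

variable (ξ μ : PMF ℕ) (H : ℕ → ProbabilityMeasure ℝ≥0∞) (h : ℕ)

/-- Binomial thinning of the children of the root; no condition is put on the surviving branches. -/
theorem infinitePi_card_survivors (m : ℕ) :
    (Measure.infinitePi fun u : List ℕ =>
      (markedVertexLaw (if u = [] then μ else ξ) H : Measure (ℕ × ℝ≥0∞)))
        {k | (survivors h (kids k)).card = m} =
      taylorCoeff μ (vertexDataLaw ξ H (aliveSet h)ᶜ) m * vertexDataLaw ξ H (aliveSet h) ^ m := by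
  have h1 := infinitePi_survivors (fun u : List ℕ =>
    (markedVertexLaw (if u = [] then μ else ξ) H : Measure (ℕ × ℝ≥0∞)))
    (markedVertexLaw ξ H : Measure (ℕ × ℝ≥0∞)) (fun i u => by simp) h m MeasurableSet.univ
    (D := fun _ => univ) (fun _ => MeasurableSet.univ)
  simp only [mem_univ, implies_true, and_true, inter_univ, Finset.prod_const,
    Finset.card_range, if_true, markedVertexLaw_prod_univ] at h1
  rw [h1, taylorCoeff, ← ENNReal.tsum_mul_right]
  exact tsum_congr fun K => (mul_assoc _ _ _).symm

theorem vertexDataLaw_card_survivors (m : ℕ) :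
    vertexDataLaw ξ H {k | (survivors h (kids k)).card = m} =
      taylorCoeff ξ (vertexDataLaw ξ H (aliveSet h)ᶜ) m * vertexDataLaw ξ H (aliveSet h) ^ m := by
  rw [← infinitePi_card_survivors]
  simp only [ite_self]
  rfl

theorem vertexDataLaw_alive_add :
    vertexDataLaw ξ H (aliveSet h)ᶜ + vertexDataLaw ξ H (aliveSet h) = 1 := by
  rw [add_comm, prob_add_prob_compl (measurableSet_aliveSet h)]

theorem exists_survivorLaw : ∃ μh : PMF ℕ, ∀ m, μh m =
    taylorCoeff μ (vertexDataLaw ξ H (aliveSet h)ᶜ) m * vertexDataLaw ξ H (aliveSet h) ^ m := by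
  have := Measure.isProbabilityMeasure_map (μ := Measure.infinitePi fun u : List ℕ =>
      (markedVertexLaw (if u = [] then μ else ξ) H : Measure (ℕ × ℝ≥0∞)))
    (measurable_card_survivors h).aemeasurable
  refine ⟨Measure.toPMF (Measure.map (fun k => (survivors h (kids k)).card)
    (Measure.infinitePi fun u : List ℕ =>
      (markedVertexLaw (if u = [] then μ else ξ) H : Measure (ℕ × ℝ≥0∞)))), fun m => ?_⟩
  rw [Measure.toPMF_apply, Measure.map_apply (measurable_card_survivors h)
    (measurableSet_singleton m), ← infinitePi_card_survivors]
  rfl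

/-- `ξh` is the law of the number of surviving children, given survival. -/
def IsErasedOffspringLaw (ξh : PMF ℕ) : Prop :=
  ∀ m, vertexDataLaw ξ H (aliveSet h) * ξh m =
    vertexDataLaw ξ H (aliveSet h ∩ {k | (survivors h (kids k)).card = m})

/-- The law is that of the number of surviving children conditioned on reaching generation `h`,
which is possible because this event has positive probability. -/
theorem exists_isErasedOffspringLaw (hq : vertexDataLaw ξ H (aliveSet h) ≠ 0) :
    ∃ ξh : PMF ℕ, IsErasedOffspringLaw ξ H h ξh := by
  have h1 := cond_isProbabilityMeasure hq
  have := Measure.isProbabilityMeasure_map (μ := (vertexDataLaw ξ H)[|aliveSet h])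
    (measurable_card_survivors h).aemeasurable
  refine ⟨Measure.toPMF (Measure.map (fun k => (survivors h (kids k)).card)
    (vertexDataLaw ξ H)[|aliveSet h]), fun m => ?_⟩
  rw [Measure.toPMF_apply, Measure.map_apply (measurable_card_survivors h)
    (measurableSet_singleton m), mul_comm,
    cond_mul_eq_inter (measurableSet_aliveSet h)]
  rfl

variable {ξ H h} {ξh : PMF ℕ}

/-- A positive number of surviving children already implies survival, so the conditioning does not
restrict the event. -/
theorem IsErasedOffspringLaw.of_ne_zero (hξ : IsErasedOffspringLaw ξ H h ξh) {m : ℕ} (hm : m ≠ 0) :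
    vertexDataLaw ξ H (aliveSet h) * ξh m =
      taylorCoeff ξ (vertexDataLaw ξ H (aliveSet h)ᶜ) m * vertexDataLaw ξ H (aliveSet h) ^ m := by
  rw [hξ m, ← vertexDataLaw_card_survivors, inter_eq_right.2]
  intro k hk
  exact mem_aliveSet_of_card_ne_zero (by rw [show _ = m from hk]; exact hm)

/-- The event of no surviving child splits into extinction before generation `h`, which implies it,
and the part on which the tree reaches generation `h`. The constant term is thus corrected by the
extinction probability. -/
theorem IsErasedOffspringLaw.zero (hξ : IsErasedOffspringLaw ξ H h ξh) :
    vertexDataLaw ξ H (aliveSet h) * ξh 0 + vertexDataLaw ξ H (aliveSet h)ᶜ =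
      taylorCoeff ξ (vertexDataLaw ξ H (aliveSet h)ᶜ) 0 := by
  have h1 := vertexDataLaw_card_survivors ξ H h 0
  rw [pow_zero, mul_one] at h1
  have h2 : (aliveSet h)ᶜ = {k | (survivors h (kids k)).card = 0} \ aliveSet h := by
    ext k
    refine ⟨fun hk => ⟨?_, hk⟩, fun hk => hk.2⟩
    by_contra hc
    exact hk (mem_aliveSet_of_card_ne_zero hc)
  rw [← h1, hξ 0, inter_comm]
  rw [h2]
  exact measure_inter_add_sdiff _ (measurableSet_aliveSet h)

/-- The law of the marked forest after erasure. -/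
theorem gwMarkedLaw_map_eraseForest (hξ : IsErasedOffspringLaw ξ H h ξh) {μ μh : PMF ℕ}
    (hμ : ∀ m, μh m = taylorCoeff μ (vertexDataLaw ξ H (aliveSet h)ᶜ) m *
      vertexDataLaw ξ H (aliveSet h) ^ m) {Hh : ℕ → ProbabilityMeasure ℝ≥0∞}
    (hH : ∀ m ≠ 0, ∀ B : Set ℝ≥0∞, MeasurableSet B →
      taylorCoeff ξ (vertexDataLaw ξ H (aliveSet h)ᶜ) m * (Hh m : Measure ℝ≥0∞) B =
        ∑' K, ξ K * (K.choose m * vertexDataLaw ξ H (aliveSet h)ᶜ ^ (K - m)) *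
          (H K : Measure ℝ≥0∞) B) :
    (gwMarkedLaw ξ μ H).map (trimMarked ∘ eraseForest h) = gwMarkedLaw ξh μh Hh := by
  have hm : Measurable (trimMarked ∘ eraseForest h) :=
    measurable_trimMarked.comp (measurable_eraseForest h)
  have h1 : (trimMarked ∘ eraseForest h) ∘ trimMarked = trimMarked ∘ eraseForest h :=
    funext fun k => trimMarked_eraseForest_trimMarked h k
  rw [gwMarkedLaw, Measure.map_map hm measurable_trimMarked, h1]
  refine infinitePi_map_trimMarked_eraseForest _ _ (markedVertexLaw ξ H : Measure (ℕ × ℝ≥0∞))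
    (markedVertexLaw ξh Hh : Measure (ℕ × ℝ≥0∞)) (fun i u => by simp) (fun i u => by simp) h
    ?_ ?_ ?_
  · rw [markedVertexLaw_prod_univ]
    exact hξ 0
  · intro m hm B hB
    simp only [markedVertexLaw_prod _ _ _ hB]
    have h2 := hξ.of_ne_zero hm
    change vertexDataLaw ξ H (aliveSet h) * _ = ∑' K, _ * (_ * vertexDataLaw ξ H (aliveSet h)ᶜ ^ _ *
      vertexDataLaw ξ H (aliveSet h) ^ m)
    rw [← mul_assoc, h2, mul_right_comm, hH m hm B hB, ← ENNReal.tsum_mul_right]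
    exact tsum_congr fun K => by ring
  · intro m
    simp only [if_true, markedVertexLaw_prod_univ, hμ, taylorCoeff]
    change _ = ∑' K, _ * (_ * vertexDataLaw ξ H (aliveSet h)ᶜ ^ _ *
      vertexDataLaw ξ H (aliveSet h) ^ m)
    rw [← ENNReal.tsum_mul_right]
    exact tsum_congr fun K => by ring

end ErasedOffspring

/-! ### Generating functions of the offspring laws after erasure -/

section ErasedGen

variable {ξ μ ξh μh ξθ : PMF ℕ} {a q : ℝ≥0∞}

theorem egen_survivorLaw (hμ : ∀ m, μh m = taylorCoeff μ a m * q ^ m) (s : ℝ≥0∞) :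
    egen μh s = egen μ (a + q * s) := by
  rw [← tsum_taylorCoeff_mul_pow, egen]
  exact tsum_congr fun m => by rw [hμ, mul_pow, mul_assoc]

theorem egen_erasedOffspringLaw (h0 : q * ξh 0 + a = taylorCoeff ξ a 0)
    (h1 : ∀ m ≠ 0, q * ξh m = taylorCoeff ξ a m * q ^ m) (s : ℝ≥0∞) :
    q * egen ξh s + a = egen ξ (a + q * s) := by
  rw [← taylorCoeff_zero_add, ← h0, egen_eq_add, mul_add, ← ENNReal.tsum_mul_left,
    add_right_comm]
  congr 1
  refine tsum_congr fun m => ?_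
  rw [← mul_assoc, h1 _ m.succ_ne_zero, mul_pow, mul_assoc]

/-- All terms of positive order are those of a binomial expansion. The two constant terms differ and
are kept on opposite sides, since subtraction in `[0, ∞]` is truncated. -/
theorem egen_prunedOffspringLaw {e : ℝ≥0∞}
    (h1 : ∀ m ≠ 0, e * q * ξθ m = taylorCoeff ξ (a * e) m * (q * e) ^ m) (s : ℝ≥0∞) :
    e * q * egen ξθ s + taylorCoeff ξ (a * e) 0 =
      egen ξ (a * e + q * e * s) + e * q * ξθ 0 := by
  rw [← taylorCoeff_zero_add, egen_eq_add, mul_add, ← ENNReal.tsum_mul_left]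
  have : ∀ m, e * q * (ξθ (m + 1) * s ^ (m + 1)) =
      taylorCoeff ξ (a * e) (m + 1) * (q * e * s) ^ (m + 1) := fun m => by
    rw [← mul_assoc, h1 _ m.succ_ne_zero, mul_pow (q * e), mul_assoc]
  simp only [this]
  ring

/-- If the erased law were the point mass at `1`, all coefficients of order at least `2` would
vanish, hence `ξ n = 0` for `n ≥ 2`. The coefficient of order `1` is then `ξ 1`, and the relation
for `m = 1` forces `ξ 1 = 1`. -/
theorem apply_one_lt_one_of_erased (hξ : ξ 1 < 1) (hq : q ≠ 0) (hq' : q ≠ ⊤)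
    (h1 : ∀ m ≠ 0, q * ξh m = taylorCoeff ξ a m * q ^ m) : ξh 1 < 1 := by
  refine (ξh.coe_le_one 1).lt_of_ne fun hc => hξ.ne ?_
  have h2 : ∀ m ≠ 1, ξh m = 0 := fun m hm => by
    by_contra hne
    have h3 : ∑ i ∈ {1, m}, ξh i ≤ 1 := by
      rw [← ξh.tsum_coe]
      exact ENNReal.sum_le_tsum _
    rw [Finset.sum_pair hm.symm, hc] at h3
    exact absurd h3 (not_le.2 (ENNReal.lt_add_right ENNReal.one_ne_top hne))
  have h3 : ∀ n, 2 ≤ n → ξ n = 0 := fun n hn => by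
    have h4 := h1 n (by omega)
    rw [h2 n (by omega), mul_zero, eq_comm, mul_eq_zero] at h4
    have h5 := ENNReal.tsum_eq_zero.1 (h4.resolve_right (pow_ne_zero n hq)) n
    simpa using h5
  have h4 := h1 1 one_ne_zero
  rw [hc, mul_one, pow_one, taylorCoeff, tsum_eq_single 1] at h4
  · simp only [Nat.choose_self, Nat.cast_one, Nat.sub_self, pow_zero, mul_one] at h4
    exact (ENNReal.mul_left_inj hq hq').1 (h4.symm.trans (one_mul q).symm)
  · intro n hn
    obtain rfl | hn : n = 0 ∨ 2 ≤ n := by omega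
    · simp
    · rw [h3 n hn, zero_mul]

/-- The new child number equals `m ≠ 0` exactly when the old one does and the time exceeds `θ`. The
value `0` is excluded because it also absorbs the pruned individuals. -/
theorem exists_prunedOffspringLaw (ν : PMF ℕ) (H : ℕ → ProbabilityMeasure ℝ≥0∞) (θ : ℝ≥0) :
    ∃ ν' : PMF ℕ, ν'.toMeasure = (markedVertexLaw ν H : Measure (ℕ × ℝ≥0∞)).map
        (fun a => if a.2 ≤ (θ : ℝ≥0∞) then 0 else a.1) ∧
      ∀ m ≠ 0, ν' m = ν m * (H m : Measure ℝ≥0∞) (Ioi (θ : ℝ≥0∞)) := by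
  have hf := measurable_pruneVertex (θ : ℝ≥0∞)
  have := Measure.isProbabilityMeasure_map
    (μ := (markedVertexLaw ν H : Measure (ℕ × ℝ≥0∞))) hf.aemeasurable
  refine ⟨_, Measure.toPMF_toMeasure _, fun m hm => ?_⟩
  rw [Measure.toPMF_apply, Measure.map_apply hf (measurableSet_singleton m),
    ← markedVertexLaw_prod _ _ _ measurableSet_Ioi]
  congr 1
  ext ⟨k, x⟩
  simp only [mem_preimage, mem_singleton_iff, mem_prod, mem_Ioi]
  split_ifs with hx
  · exact iff_of_false hm.symm fun hc => absurd hx (not_le.2 hc.2)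
  · exact (and_iff_left (not_le.1 hx)).symm

end ErasedGen

/-! ### Real-valued generating functions of the erased and pruned laws -/

section RealGen

variable {ξ μ ξh μh ξθ : PMF ℕ} {p : ℝ}

theorem egen_ofReal_ne_top (ξ : PMF ℕ) {s : ℝ} (hs : s ≤ 1) :
    egen ξ (ENNReal.ofReal s) ≠ ⊤ :=
  ((egen_le_one ξ (ENNReal.ofReal_le_one.2 hs)).trans_lt ENNReal.one_lt_top).ne

theorem gen_one (ξ : PMF ℕ) : gen ξ 1 = 1 := by
  rw [gen_eq_toReal_egen ξ zero_le_one, ENNReal.ofReal_one, egen_one, ENNReal.toReal_one]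

theorem gen_survivorLaw (hp0 : 0 ≤ p) (hp1 : p < 1)
    (hμ : ∀ m, μh m = taylorCoeff μ (ENNReal.ofReal p) m * ENNReal.ofReal (1 - p) ^ m)
    {s : ℝ} (hs : s ∈ Icc (0 : ℝ) 1) : gen μh s = gen μ (p + s * (1 - p)) := by
  have hq : 0 ≤ 1 - p := by linarith
  rw [gen_eq_toReal_egen _ hs.1, gen_eq_toReal_egen _ (add_nonneg hp0 (mul_nonneg hs.1 hq)),
    egen_survivorLaw hμ, mul_comm s, ENNReal.ofReal_add hp0 (mul_nonneg hq hs.1),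
    ENNReal.ofReal_mul hq]

theorem gen_erasedOffspringLaw (hp0 : 0 ≤ p) (hp1 : p < 1)
    (h0 : ENNReal.ofReal (1 - p) * ξh 0 + ENNReal.ofReal p = taylorCoeff ξ (ENNReal.ofReal p) 0)
    (h1 : ∀ m ≠ 0, ENNReal.ofReal (1 - p) * ξh m =
      taylorCoeff ξ (ENNReal.ofReal p) m * ENNReal.ofReal (1 - p) ^ m)
    {s : ℝ} (hs : s ∈ Icc (0 : ℝ) 1) : gen ξh s = (gen ξ (p + s * (1 - p)) - p) / (1 - p) := by
  have hq : 0 < 1 - p := by linarith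
  have h2 := congrArg ENNReal.toReal (egen_erasedOffspringLaw h0 h1 (ENNReal.ofReal s))
  rw [← ENNReal.ofReal_mul hq.le, ← ENNReal.ofReal_add hp0 (mul_nonneg hq.le hs.1),
    ENNReal.toReal_add (ENNReal.mul_ne_top ENNReal.ofReal_ne_top
      (egen_ofReal_ne_top _ hs.2)) ENNReal.ofReal_ne_top, ENNReal.toReal_mul,
    ENNReal.toReal_ofReal hq.le, ENNReal.toReal_ofReal hp0, ← gen_eq_toReal_egen _ hs.1,
    ← gen_eq_toReal_egen _ (add_nonneg hp0 (mul_nonneg hq.le hs.1))] at h2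
  rw [mul_comm s, ← h2, add_sub_cancel_right, mul_div_cancel_left₀ _ hq.ne']

theorem gen_prunedOffspringLaw (hp0 : 0 ≤ p) (hp1 : p < 1) {e : ℝ} (he0 : 0 < e) (he1 : e ≤ 1)
    (h1 : ∀ m ≠ 0, ENNReal.ofReal e * ENNReal.ofReal (1 - p) * ξθ m =
      taylorCoeff ξ (ENNReal.ofReal p * ENNReal.ofReal e) m *
        (ENNReal.ofReal (1 - p) * ENNReal.ofReal e) ^ m)
    {s : ℝ} (hs : s ∈ Icc (0 : ℝ) 1) :
    gen ξθ s = (gen ξ (p * e + s * (1 - p) * e) - p * e - gen ξ e + e) / ((1 - p) * e) := by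
  have hq : 0 < 1 - p := by linarith
  have hpe : p * e < 1 := (mul_le_of_le_one_right hp0 he1).trans_lt hp1
  have hpe0 : 0 ≤ p * e := mul_nonneg hp0 he0.le
  have key : ∀ s ∈ Icc (0 : ℝ) 1, e * (1 - p) * gen ξθ s +
      (taylorCoeff ξ (ENNReal.ofReal (p * e)) 0).toReal =
      gen ξ (p * e + s * (1 - p) * e) + e * (1 - p) * (ξθ 0).toReal := by
    intro s hs
    have hqe : 0 ≤ (1 - p) * e * s := mul_nonneg (mul_nonneg hq.le he0.le) hs.1
    have hle : p * e + (1 - p) * e * s ≤ 1 := by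
      have : (1 - p) * e * s ≤ (1 - p) * e :=
        mul_le_of_le_one_right (mul_nonneg hq.le he0.le) hs.2
      linarith
    have h2 := congrArg ENNReal.toReal (egen_prunedOffspringLaw h1 (ENNReal.ofReal s))
    rw [← ENNReal.ofReal_mul he0.le, ← ENNReal.ofReal_mul hp0, ← ENNReal.ofReal_mul hq.le,
      ← ENNReal.ofReal_mul (mul_nonneg hq.le he0.le), ← ENNReal.ofReal_add hpe0 hqe,
      ENNReal.toReal_add (ENNReal.mul_ne_top ENNReal.ofReal_ne_top
        (egen_ofReal_ne_top _ hs.2)) (taylorCoeff_ne_top ξ 0 hpe0 hpe),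
      ENNReal.toReal_add (egen_ofReal_ne_top _ hle)
        (ENNReal.mul_ne_top ENNReal.ofReal_ne_top (ξθ.apply_ne_top 0)),
      ENNReal.toReal_mul, ENNReal.toReal_mul, ENNReal.toReal_ofReal (mul_nonneg he0.le hq.le),
      ← gen_eq_toReal_egen _ hs.1, ← gen_eq_toReal_egen _ (add_nonneg hpe0 hqe)] at h2
    rw [h2, show (1 - p) * e * s = s * (1 - p) * e by ring]
  have k1 := key s hs
  -- At `s = 1` both the generating function and its argument are known, and subtracting this
  -- instance eliminates the unknown mass `ξθ 0` and the coefficient of order `0`.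
  have k2 := key 1 ⟨zero_le_one, le_rfl⟩
  rw [gen_one, show p * e + 1 * (1 - p) * e = e by ring] at k2
  rw [eq_div_iff (mul_pos hq he0).ne']
  linarith

end RealGen

end GWPruning

/-! ### The erased forest and its pruning process -/

open GWPruning in
theorem mainTheorem12 {X Ω : Type*} [MetricSpace X] [MeasurableSpace Ω]
    (P : Measure Ω) [IsProbabilityMeasure P] (ρ : X) (ξ μ : PMF ℕ) (h : ℕ)
    (F : Ω → Set X) (B : ℝ≥0 → Ω → Set X)
    (hB : IsHPruningProcess P ρ ξ μ branchPointLaws F B)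
    (p : ℝ) (hp : p = heightProb ξ h) (hp1 : p < 1) :
    ∃ ξh μh : PMF ℕ,
      (∀ s ∈ Icc (0 : ℝ) 1, gen ξh s = (gen ξ (p + s * (1 - p)) - p) / (1 - p)) ∧
      (∀ s ∈ Icc (0 : ℝ) 1, gen μh s = gen μ (p + s * (1 - p))) ∧
      IsGWForest P ρ ξh μh (fun ω => erase ρ h (F ω)) ∧
      (∃ H, HasErasedTails ξ p H) ∧
      (∀ H, HasErasedTails ξ p H →
        IsHPruningProcess P ρ ξh μh H (fun ω => erase ρ h (F ω))
          (fun θ ω => B θ ω ∩ erase ρ h (F ω))) ∧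
      ∀ θ : ℝ≥0, ∃ ξθ : PMF ℕ,
        (∀ s ∈ Icc (0 : ℝ) 1, gen ξθ s =
          (gen ξ (p * Real.exp (-θ) + s * (1 - p) * Real.exp (-θ)) - p * Real.exp (-θ)
            - gen ξ (Real.exp (-θ)) + Real.exp (-θ)) / ((1 - p) * Real.exp (-θ))) ∧
        IsGWForest P ρ ξθ μh (fun ω => B θ ω ∩ erase ρ h (F ω)) := by
  have hξ1 : ξ 1 < 1 := by
    obtain ⟨-, -, Θ, hF, -⟩ := hB
    exact hF.1
  have hpa : p = (vertexDataLaw ξ branchPointLaws (aliveSet h)ᶜ).toReal :=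
    hp.trans (heightProb_eq ξ branchPointLaws h)
  have hp0 : 0 ≤ p := hpa ▸ ENNReal.toReal_nonneg
  have ha : vertexDataLaw ξ branchPointLaws (aliveSet h)ᶜ = ENNReal.ofReal p := by
    rw [hpa, ENNReal.ofReal_toReal (measure_ne_top _ _)]
  have hq : vertexDataLaw ξ branchPointLaws (aliveSet h) = ENNReal.ofReal (1 - p) := by
    have h1 := vertexDataLaw_alive_add ξ branchPointLaws h
    rw [ha, add_comm] at h1
    rw [ENNReal.ofReal_sub _ hp0, ENNReal.ofReal_one, ← h1,
      ENNReal.add_sub_cancel_right ENNReal.ofReal_ne_top]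
  have hq0 : ENNReal.ofReal (1 - p) ≠ 0 := (ENNReal.ofReal_pos.2 (by linarith)).ne'
  obtain ⟨μh, hμ⟩ := exists_survivorLaw ξ μ branchPointLaws h
  obtain ⟨ξh, hξh⟩ := exists_isErasedOffspringLaw ξ branchPointLaws h (by rwa [hq])
  have h0 := hξh.zero
  have h1 := fun m (hm : m ≠ 0) => hξh.of_ne_zero hm
  have hμ' := hμ
  simp only [ha, hq] at h0 h1 hμ'
  have hξh1 : ξh 1 < 1 := apply_one_lt_one_of_erased hξ1 hq0 ENNReal.ofReal_ne_top h1
  have hall : ∀ H, HasErasedTails ξ p H →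
      IsHPruningProcess P ρ ξh μh H (fun ω => erase ρ h (F ω))
        (fun θ ω => B θ ω ∩ erase ρ h (F ω)) := fun H hH => by
    refine hB.erase h hξh1 hH.1 (gwMarkedLaw_map_eraseForest hξh hμ fun m hm A hA => ?_)
    -- The laws `H m` are determined by their tails whenever the coefficient is nonzero, so every
    -- admissible family satisfies the mixture identity.
    rw [ha, ← erasedTimes_apply ξ _ m hA, ← hH.smul_eq hp0 hp1 (Nat.one_le_iff_ne_zero.2 hm)]
    rfl
  obtain ⟨H, hH⟩ := exists_hasErasedTails (ξ := ξ) hp0 hp1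
  have hprune := hall H hH
  refine ⟨ξh, μh, fun s hs => gen_erasedOffspringLaw hp0 hp1 h0 h1 hs,
    fun s hs => gen_survivorLaw hp0 hp1 hμ' hs, ?_, ⟨H, hH⟩, hall, fun θ => ?_⟩
  · obtain ⟨-, -, Θ, hF, -⟩ := hprune
    exact hF.isGWForest
  · obtain ⟨ξθ, h2, h3⟩ := exists_prunedOffspringLaw ξh H θ
    refine ⟨ξθ, fun s hs => gen_prunedOffspringLaw hp0 hp1 (Real.exp_pos _)
      (Real.exp_le_one_iff.2 (by simp)) (fun m hm => ?_) hs, hprune.isGWForest θ ?_ h2⟩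
    · have hm1 : 1 ≤ m := Nat.one_le_iff_ne_zero.2 hm
      have h4 := congrArg (fun ν : Measure ℝ≥0∞ => ν (Ioi (θ : ℝ≥0∞)))
        (hH.smul_eq hp0 hp1 hm1)
      simp only [Measure.smul_apply, smul_eq_mul, erasedTimes_Ioi ξ _ hm1] at h4
      set e := ENNReal.ofReal (Real.exp (-θ))
      set q := ENNReal.ofReal (1 - p)
      -- The extra factor `e` on the left turns the `e ^ (m - 1)` of the tail formula into `e ^ m`,
      -- so that the masses become the terms of a binomial expansion at `p * e` with increment `(1 -
      -- p) * e * s`.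
      calc e * q * ξθ m = e * (q * ξh m) * (H m : Measure ℝ≥0∞) (Ioi (θ : ℝ≥0∞)) := by
            rw [h3 m hm]; ring
        _ = e * q ^ m * (taylorCoeff ξ (ENNReal.ofReal p) m *
            (H m : Measure ℝ≥0∞) (Ioi (θ : ℝ≥0∞))) := by rw [h1 m hm]; ring
        _ = (e * e ^ (m - 1)) * q ^ m * taylorCoeff ξ (ENNReal.ofReal p * e) m := by
            rw [h4]; ring
        _ = _ := by
            rw [← pow_succ', Nat.sub_add_cancel hm1, mul_pow]; ring
    · rw [h3 1 one_ne_zero]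
      exact (mul_le_of_le_one_right' prob_le_one).trans_lt hξh1
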